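/- Let $\mathbb T=\mathbb R/2\pi\mathbb Z$, $D=\mathbb R^2\times\mathbb T$ with its flat distance and Lebesgue measure, $x=(\widetilde x,x_3)$, $B(x,l)$ the ball and $C(x,l)=\{y\in D:|\widetilde y-\widetilde x|<l\}$ the cylinder of radius $l$ about $x$. Put $\|f\|_{L^r_{\rm uloc}}=\sup_{x_0\in D}\|f\|_{L^r(B(x_0,1))}$. Let $$N(y)=\frac1{4\pi}\sum_{k\in\mathbb Z}\Big(\frac1{|(y_1,y_2,y_3+2\pi k)|}-\frac{\mathbf 1_{k\ne0}}{2\pi|k|}\Big)$$ be the Newtonian potential of $D$ (so $-\Delta N=\delta_0$), and $N_{ij}=\partial_i\partial_jN$; repeated indices are summed. For a vector field $v:D\to\mathbb R^3$ and $x_0\in D$ put $$p_{x_0,1}[v](x)=-\tfrac13|v(x)|^2+\mathrm{p.v.}\!\int_{C(x_0,2)}N_{ij}(x-y)v_i(y)v_j(y)\,dy,$$ $$p_{x_0,2}[v](x)=\int_{D\setminus C(x_0,2)}\big(N_{ij}(x-y)-N_{ij}(x_0-y)\big)v_i(y)v_j(y)\,dy,$$ where $\mathrm{p.v.}\int_{C(x_0,2)}=\lim_{\varepsilon\to0^+}\int_{C(x_0,2)\setminus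 B(x,\varepsilon)}$. Definition. Let $0<T<\infty$ and let $u_0\in L^2_{\rm uloc}(D)$ be divergence free. A vector field $u\in L^2_{\rm loc}([0,T]\times D)$ is a local energy weak solution of the Navier–Stokes equations $\partial_tu+u\cdot\nabla u-\Delta u+\nabla p=0$, $\nabla\cdot u=0$ with initial datum $u_0$, with associated pressure $p\in L^{3/2}_{\rm loc}([0,T]\times D)$, if 1. $u\in L^\infty([0,T];L^2_{\rm uloc})$ and $\nabla u\in L^2_{\rm uloc}([0,T]\times D)$, i.e. $\sup_{x_0}\int_0^T\!\int_{B(x_0,1)}|\nabla u|^2<\infty$; 2. $(u,p)$ solves the equations in the sense of distributions on $(0,T)\times D$; 3. $u(t)\to u_0$ in $L^2(K)$ as $t\to0^+$ for every compact $K\subset D$; 4. $t\mapsto\int_Du(t)\cdot h\,dx$ is well defined and continuous on $[0,T)$ for every compactly supported $h\in L^2(D)$; 5. for almost every $t\in(0,T)$ and all $0\le\phi\in C_c^\infty((0,T)\times D)$, $$\int_D|u(t)|^2\phi(t)\,dx+2\int_0^t\!\!\int_D|\nabla u|^2\phi\,dx\,ds\le\int_0^t\!\!\int_D|u|^2(\partial_s\phi+\Delta\phi)+(|u|^2+2p)(u\cdot\nabla)\phi\,dx\,ds;$$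 6. for every $x_0\in D$ there is $c_{x_0}\in L^{3/2}(0,T)$ such that for almost every $(t,x)\in(0,T)\times C(x_0,3/2)$ the principal value below exists and $$p(t,x)-c_{x_0}(t)=p_{x_0,1}[u(t)](x)+p_{x_0,2}[u(t)](x).$$ Proposition. For every $1<q<\infty$ there is a constant $A_q$ depending only on $q$, and there is an absolute constant $B$, such that the following holds for all $T$ and $u_0$ as above, every local energy weak solution $u$ on $(0,T)$ with initial datum $u_0$ and associated pressure $p$, and every $x_0\in D$. There is $c_{x_0}\in L^{3/2}(0,T)$ such that for almost every $(t,x)\in(0,T)\times C(x_0,3/2)$ the principal value exists and $$p(t,x)-c_{x_0}(t)=p_{x_0,1}[u(t)](x)+p_{x_0,2}[u(t)](x).$$ Moreover, for almost every $t\in(0,T)$: the integral defining $p_{x_0,2}[u(t)](x)$ converges absolutely for every $x\in C(x_0,3/2)$; the functions $p_{x_0,1}[u(t)]$ and $p_{x_0,2}[u(t)]$ are measurable on $C(x_0,3/2)$; and $$\|p_{x_0,1}[u(t)]\|_{L^q(C(x_0,1))}\le A_q\|u(t)\|_{L^{2q}_{\rm uloc}}^2\ \ (1<q<\infty),\qquad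 \|p_{x_0,2}[u(t)]\|_{L^\infty(C(x_0,1))}\le B\|u(t)\|_{L^2_{\rm uloc}}^2,$$ where the right-hand side of the first bound may be infinite. -/

import Mathlib

open MeasureTheory Set Filter Topology
open scoped ENNReal NNReal ContDiff

namespace NSCyl

noncomputable section

/-! ### The domain `ℝ² × 𝕋`, `𝕋 = ℝ / 2πℤ` -/

instance factTwoPiPos : Fact (0 < 2 * Real.pi) := ⟨Real.two_pi_pos⟩

abbrev E2 := EuclideanSpace ℝ (Fin 2)

abbrev E3 := EuclideanSpace ℝ (Fin 3)

/-- The domain `ℝ² × 𝕋`. Its measure `volume` is Lebesgue measure on `ℝ²` times the measure of total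
mass `2π` on `𝕋`. (The product metric that Mathlib puts on it is not used, see `len`.) -/
abbrev Dom := E2 × AddCircle (2 * Real.pi)

/-- The covering map `ℝ³ → ℝ² × 𝕋`. -/
def proj (v : E3) : Dom := (!₂[v 0, v 1], ((v 2 : ℝ) : AddCircle (2 * Real.pi)))

/-- The Euclidean (flat) distance from `z` to the origin of `ℝ² × 𝕋`; the norm on `AddCircle` is the
distance to `0` modulo `2π`. -/
def len (z : Dom) : ℝ := Real.sqrt (‖z.1‖ ^ 2 + ‖z.2‖ ^ 2)

/-- The ball `B(x, r)` for the flat distance. -/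
def ball (x : Dom) (r : ℝ) : Set Dom := {y | len (y - x) < r}

/-- The vertical cylinder `C(x, r)`. -/
def cyl (x : Dom) (r : ℝ) : Set Dom := {y | ‖y.1 - x.1‖ < r}

/-! ### Differential calculus on `ℝ² × 𝕋` -/

/-- The classical partial derivative `∂ᵢ f`, as the derivative along translations in the `i`-th
coordinate direction. -/
def pd {F : Type*} [NormedAddCommGroup F] [NormedSpace ℝ F] (i : Fin 3) (f : Dom → F) (x : Dom) : F :=
  deriv (fun s : ℝ => f (x + proj (EuclideanSpace.single i s))) 0

/-- The Laplacian on `ℝ² × 𝕋`. -/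
def lapl {F : Type*} [NormedAddCommGroup F] [NormedSpace ℝ F] (f : Dom → F) (x : Dom) : F :=
  ∑ i : Fin 3, pd i (pd i f) x

/-- `f ∈ C_c^∞(ℝ² × 𝕋)`. -/
def IsTest {F : Type*} [NormedAddCommGroup F] [NormedSpace ℝ F] (f : Dom → F) : Prop :=
  ContDiff ℝ ∞ (fun v : E3 => f (proj v)) ∧ HasCompactSupport f

/-- `φ ∈ C_c^∞((0, T) × (ℝ² × 𝕋))`. -/
def IsSpaceTimeTest {F : Type*} [NormedAddCommGroup F] [NormedSpace ℝ F] (T : ℝ)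
    (φ : ℝ → Dom → F) : Prop :=
  ContDiff ℝ ∞ (fun q : ℝ × E3 => φ q.1 (proj q.2)) ∧
  HasCompactSupport (fun q : ℝ × Dom => φ q.1 q.2) ∧
  tsupport (fun q : ℝ × Dom => φ q.1 q.2) ⊆ Ioo 0 T ×ˢ univ

/-! ### Uniformly local Lebesgue spaces -/

/-- `‖f‖_{L^r_uloc} = sup_{x₀} ‖f‖_{L^r(B(x₀, 1))}`. -/
def ulocNorm {F : Type*} [NormedAddCommGroup F] (f : Dom → F) (r : ℝ≥0∞) : ℝ≥0∞ :=
  ⨆ x₀ : Dom, eLpNorm f r (volume.restrict (ball x₀ 1))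

/-- `f ∈ L^r_uloc(ℝ² × 𝕋)`. -/
def MemUloc {F : Type*} [NormedAddCommGroup F] (f : Dom → F) (r : ℝ≥0∞) : Prop :=
  AEStronglyMeasurable f volume ∧ ulocNorm f r < ⊤

/-- `g ∈ L^2_uloc([0, T] × ℝ² × 𝕋)`. -/
def MemSpaceTimeUloc (T : ℝ) (g : ℝ → Dom → ℝ) : Prop :=
  AEStronglyMeasurable (fun q : ℝ × Dom => g q.1 q.2) (volume.restrict (Icc 0 T ×ˢ univ)) ∧
  (⨆ x₀ : Dom, eLpNorm (fun q : ℝ × Dom => g q.1 q.2) 2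
    (volume.restrict (Icc 0 T ×ˢ ball x₀ 1))) < ⊤

/-- `g ∈ L^r_loc([0, T] × ℝ² × 𝕋)`. -/
def MemSpaceTimeLoc {F : Type*} [NormedAddCommGroup F] (T : ℝ) (g : ℝ → Dom → F) (r : ℝ≥0∞) : Prop :=
  ∀ K : Set Dom, IsCompact K →
    MemLp (fun q : ℝ × Dom => g q.1 q.2) r (volume.restrict (Icc 0 T ×ˢ K))

/-! ### The Newtonian potential of `ℝ² × 𝕋` -/

/-- The representative of a point of `𝕋` in `(-π, π]`. -/
def rep (s : AddCircle (2 * Real.pi)) : ℝ := (AddCircle.equivIoc (2 * Real.pi) (-Real.pi) s : ℝ)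

/-- The Newtonian potential `N` of `ℝ² × 𝕋` (so `-Δ N = δ₀`): the periodization in the third variable
of `1 / (4π|·|)`, renormalized by subtracting constants from the terms `k ≠ 0` so that the series
converges,
`N(y) = (1/4π) ∑_{k ∈ ℤ} (1 / |(y₁, y₂, y₃ + 2πk)| - 1_{k ≠ 0} / (2π|k|))`. -/
def newton (y : Dom) : ℝ :=
  (1 / (4 * Real.pi)) * ∑' k : ℤ,
    (1 / Real.sqrt (‖y.1‖ ^ 2 + (rep y.2 + 2 * Real.pi * k) ^ 2)
      - if k = 0 then 0 else 1 / (2 * Real.pi * |(k : ℝ)|))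

/-- The kernel `N_{ij} = ∂ᵢ ∂ⱼ N`. -/
def newtonD2 (i j : Fin 3) : Dom → ℝ := pd i (pd j newton)

/-- `∑_{i,j} N_{ij}(z) wᵢ wⱼ`. -/
def kerQuad (z : Dom) (w : E3) : ℝ := ∑ i : Fin 3, ∑ j : Fin 3, newtonD2 i j z * (w i * w j)

/-! ### Principal values and the two parts of the pressure -/

/-- The principal value `p.v. ∫_S f`, singular at `x`, exists and equals `I`. -/
def HasPV (f : Dom → ℝ) (S : Set Dom) (x : Dom) (I : ℝ) : Prop :=
  (∀ ε : ℝ, 0 < ε → IntegrableOn f (S \ ball x ε)) ∧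
  Tendsto (fun ε : ℝ => ∫ y in S \ ball x ε, f y) (𝓝[>] 0) (𝓝 I)

open Classical in
/-- The principal value `p.v. ∫_S f`, singular at `x` (with value `0` if it does not exist). -/
def pv (f : Dom → ℝ) (S : Set Dom) (x : Dom) : ℝ :=
  if h : ∃ I, HasPV f S x I then h.choose else 0

/-- The local part of the pressure of the velocity field `v`. -/
def pNear (x₀ : Dom) (v : Dom → E3) (x : Dom) : ℝ :=
  -(1 / 3) * ‖v x‖ ^ 2 + pv (fun y => kerQuad (x - y) (v y)) (cyl x₀ 2) x

/-- The far-field integrand. -/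
def farIntegrand (x₀ : Dom) (v : Dom → E3) (x y : Dom) : ℝ :=
  kerQuad (x - y) (v y) - kerQuad (x₀ - y) (v y)

/-- The far-field part of the pressure of the velocity field `v`. -/
def pFar (x₀ : Dom) (v : Dom → E3) (x : Dom) : ℝ := ∫ y in (cyl x₀ 2)ᶜ, farIntegrand x₀ v x y

/-- The pressure `p`, normalized by a function `c` of time, is given at almost every point of
`(0, T) × C(x₀, 3/2)` by the singular-integral formula. -/
def PressureFormula (T : ℝ) (u : ℝ → Dom → E3) (p : ℝ → Dom → ℝ) (x₀ : Dom) (c : ℝ → ℝ) : Prop :=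
  ∀ᵐ t ∂(volume.restrict (Ioo 0 T)), ∀ᵐ x ∂(volume.restrict (cyl x₀ (3 / 2))),
    (∃ I, HasPV (fun y => kerQuad (x - y) (u t y)) (cyl x₀ 2) x I) ∧
    p t x - c t = pNear x₀ (u t) x + pFar x₀ (u t) x

/-! ### Local energy weak solutions of the Navier-Stokes equations -/

/-- The vector field `v` is divergence free in the sense of distributions. -/
def IsDivFree (v : Dom → E3) : Prop :=
  ∀ ψ : Dom → ℝ, IsTest ψ → ∫ x, ∑ i : Fin 3, v x i * pd i ψ x = 0

/-- `G t x i j` is the distributional derivative `∂ⱼ uᵢ` on `(0, T) × (ℝ² × 𝕋)`. -/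
def IsWeakGradient (T : ℝ) (u : ℝ → Dom → E3) (G : ℝ → Dom → Fin 3 → Fin 3 → ℝ) : Prop :=
  ∀ i j : Fin 3, ∀ ψ : ℝ → Dom → ℝ, IsSpaceTimeTest T ψ →
    ∫ t in Ioo 0 T, ∫ x, u t x i * pd j (ψ t) x = - ∫ t in Ioo 0 T, ∫ x, G t x i j * ψ t x

/-- `(u, p)` solves `∂ₜ u + u · ∇u - Δu + ∇p = 0`, `div u = 0` in the sense of distributions on
`(0, T) × (ℝ² × 𝕋)`. -/
def IsDistribSolution (T : ℝ) (u : ℝ → Dom → E3) (p : ℝ → Dom → ℝ) : Prop :=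
  (∀ φ : ℝ → Dom → E3, IsSpaceTimeTest T φ →
    ∫ t in Ioo 0 T, ∫ x,
      ((∑ i : Fin 3, u t x i * ((deriv (fun s => φ s x) t) i + (lapl (φ t) x) i))
        + (∑ i : Fin 3, ∑ j : Fin 3, u t x i * u t x j * (pd j (φ t) x) i)
        + p t x * ∑ i : Fin 3, (pd i (φ t) x) i) = 0) ∧
  (∀ ψ : ℝ → Dom → ℝ, IsSpaceTimeTest T ψ →
    ∫ t in Ioo 0 T, ∫ x, ∑ i : Fin 3, u t x i * pd i (ψ t) x = 0)

/-- The local energy inequality, where `G` is the gradient of `u`. -/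
def LocalEnergyInequality (T : ℝ) (u : ℝ → Dom → E3) (G : ℝ → Dom → Fin 3 → Fin 3 → ℝ)
    (p : ℝ → Dom → ℝ) : Prop :=
  ∀ᵐ t ∂(volume.restrict (Ioo 0 T)), ∀ φ : ℝ → Dom → ℝ, IsSpaceTimeTest T φ →
    (∀ s x, 0 ≤ φ s x) →
    (∫ x, ‖u t x‖ ^ 2 * φ t x)
        + 2 * ∫ s in Ioo 0 t, ∫ x, (∑ i : Fin 3, ∑ j : Fin 3, G s x i j ^ 2) * φ s x
      ≤ ∫ s in Ioo 0 t, ∫ x,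
          (‖u s x‖ ^ 2 * (deriv (fun r => φ r x) s + lapl (φ s) x)
            + (‖u s x‖ ^ 2 + 2 * p s x) * ∑ i : Fin 3, u s x i * pd i (φ s) x)

/-- `u` is a local energy weak solution on `(0, T)` of the Navier-Stokes equations (with viscosity
`1`) on `ℝ² × 𝕋` with initial data `u₀`, and `p` is an associated pressure. -/
structure IsLocalEnergyWeakSolution (T : ℝ) (u₀ : Dom → E3) (u : ℝ → Dom → E3)
    (p : ℝ → Dom → ℝ) : Prop where
  time_pos : 0 < T
  initial_memUloc : MemUloc u₀ 2
  initial_divFree : IsDivFree u₀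
  velocity_memLoc : MemSpaceTimeLoc T u 2
  velocity_bounded : ∃ M : ℝ≥0, ∀ᵐ t ∂(volume.restrict (Ioo 0 T)), ulocNorm (u t) 2 ≤ M
  pressure_memLoc : MemSpaceTimeLoc T p (3 / 2)
  equation : IsDistribSolution T u p
  initial_limit : ∀ K : Set Dom, IsCompact K →
    Tendsto (fun t => eLpNorm (fun x => u t x - u₀ x) 2 (volume.restrict K)) (𝓝[>] 0) (𝓝 0)
  weak_continuity : ∀ h : Dom → E3, MemLp h 2 volume → HasCompactSupport h →
    (∀ t ∈ Ico 0 T, Integrable (fun x => inner ℝ (u t x) (h x))) ∧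
    ContinuousOn (fun t => ∫ x, inner ℝ (u t x) (h x)) (Ico 0 T)
  gradient_energy : ∃ G : ℝ → Dom → Fin 3 → Fin 3 → ℝ, IsWeakGradient T u G ∧
    (∀ i j : Fin 3, MemSpaceTimeUloc T (fun t x => G t x i j)) ∧ LocalEnergyInequality T u G p
  pressure_formula : ∀ x₀ : Dom, ∃ c : ℝ → ℝ,
    MemLp c (3 / 2) (volume.restrict (Ioo 0 T)) ∧ PressureFormula T u p x₀ c

end

end NSCyl

/-! The function `c` and the principal values are supplied by condition 6 of the definition of a
solution. What has to be proved is measurability, absolute convergence and the two bounds, for a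
velocity field v = u(t) at a fixed time.

The kernel. Termwise differentiation of the series for N shows that, off a null set, N_ij is the sum
over the vertical lattice of the translates of K_ij = ∂ᵢ∂ⱼ(1/(4π|x|)) (`newtonD2_proj`,
`ae_newtonD2_eq`). Inside one period the translates k ≠ 0 contribute a bounded function, so the only
singularity is that of the kernel K_ij on ℝ³.

The far field. K_ij(a) - K_ij(b) is of size |a - b| m⁻⁴ if |a|, |b| ≥ m. Writing m⁻⁴ = m^(-5/2)
m^(-3/2), one factor is summed over the lattice and the other leaves the decay (horizontal
distance)^(-5/2), integrable on ℝ² × 𝕋. Such a weight is integrated against |v|² by averaging over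
all unit balls (`lintegral_mul_le_uloc`), which gives the constant B.

The near field. Lifted to ℝ³, the integral over the cylinder outside B(x, ε) is a convolution with a
truncated periodized kernel (`nearTrunc_eq`), a bounded perturbation of the truncation of K_ij at
|x| ≥ ε. An L^q bound uniform in ε suffices, since Fatou's lemma carries it to the principal value.

The uniform L^p bound rests on a Bellman function and the heat flow. With gauss_l the Gaussian
proportional to exp(-l|x|²), K_ij is the integral over l in (0, ∞) of (1/(2l²)) ∂ᵢ∂ⱼ gauss_{l/2}. By
the semigroup law, pairing the integrand with f and g amounts to integrating the product of ∂ᵢ of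
the flow of f and ∂ⱼ of the flow of g. If B(u, v) is of size u^p + v^q and its Hessian dominates
2|du||dv|, this is at most the l-derivative of ∫ B(flow of f, flow of g). Integration in l
telescopes, whence a bound by C(∫f^p + ∫g^q) independent of the frequency cutoffs
(`BellmanFn.abs_integral_riesz_le`). Duality turns it into an L^p bound. Finally, cutting
frequencies at l = ε⁻² differs from cutting space at |x| = ε by an integrable bump of fixed mass
plus a constant (`abs_rieszT_sub_riesz_le`), which Schur's test controls on balls. -/

namespace NSCyl

noncomputable section

/-! ### A Bellman function -/

/-- A function of two positive variables of size `u ^ p + v ^ q`, together with its derivatives up to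
order two, whose Hessian dominates `2 |du| |dv|`. -/
structure BellmanFn (p q : ℝ) where
  (B Bu Bv Buu Buv Bvv α β : ℝ → ℝ → ℝ)
  C : ℝ
  measB : Measurable (Function.uncurry B)
  measBu : Measurable (Function.uncurry Bu)
  measBv : Measurable (Function.uncurry Bv)
  measBuu : Measurable (Function.uncurry Buu)
  measBuv : Measurable (Function.uncurry Buv)
  measBvv : Measurable (Function.uncurry Bvv)
  hasDerivAt_B : ∀ {U V : ℝ → ℝ} {U' V' s : ℝ}, 0 < U s → 0 < V s → HasDerivAt U U' s →
    HasDerivAt V V' s → HasDerivAt (fun r => B (U r) (V r)) (Bu (U s) (V s) * U' + Bv (U s) (V s) * V') s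
  hasDerivAt_Bu : ∀ {U V : ℝ → ℝ} {U' V' s : ℝ}, 0 < U s → 0 < V s → HasDerivAt U U' s →
    HasDerivAt V V' s →
    HasDerivAt (fun r => Bu (U r) (V r)) (Buu (U s) (V s) * U' + Buv (U s) (V s) * V') s
  hasDerivAt_Bv : ∀ {U V : ℝ → ℝ} {U' V' s : ℝ}, 0 < U s → 0 < V s → HasDerivAt U U' s →
    HasDerivAt V V' s →
    HasDerivAt (fun r => Bv (U r) (V r)) (Buv (U s) (V s) * U' + Bvv (U s) (V s) * V') s
  C_nonneg : 0 ≤ C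
  B_nonneg : ∀ {u v : ℝ}, 0 < u → 0 < v → 0 ≤ B u v
  B_le : ∀ {u v : ℝ}, 0 < u → 0 < v → B u v ≤ C * (u ^ p + v ^ q)
  Bu_le : ∀ {u v : ℝ}, 0 < u → 0 < v → |Bu u v| * u ≤ C * (u ^ p + v ^ q)
  Bv_le : ∀ {u v : ℝ}, 0 < u → 0 < v → |Bv u v| * v ≤ C * (u ^ p + v ^ q)
  Buu_le : ∀ {u v : ℝ}, 0 < u → 0 < v → |Buu u v| * (u * u) ≤ C * (u ^ p + v ^ q)
  Buv_le : ∀ {u v : ℝ}, 0 < u → 0 < v → |Buv u v| * (u * v) ≤ C * (u ^ p + v ^ q)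
  Bvv_le : ∀ {u v : ℝ}, 0 < u → 0 < v → |Bvv u v| * (v * v) ≤ C * (u ^ p + v ^ q)
  α_nonneg : ∀ {u v : ℝ}, 0 < u → 0 < v → 0 ≤ α u v
  β_nonneg : ∀ {u v : ℝ}, 0 < u → 0 < v → 0 ≤ β u v
  one_le : ∀ {u v : ℝ}, 0 < u → 0 < v → 1 ≤ α u v * β u v
  hess_ge : ∀ {u v : ℝ}, 0 < u → 0 < v → ∀ ξ η : ℝ,
    α u v * ξ ^ 2 + β u v * η ^ 2 ≤ Buu u v * ξ ^ 2 + 2 * Buv u v * ξ * η + Bvv u v * η ^ 2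

/-- Positivity of the Hessian in the logarithmic increments x = du/u, y = dv/v. Here P = u^p, Q =
v^q, a = P/(P + Q) and M = u²(P + Q)^(1 - 2/p). The x² coefficient is at least 2M, and K is so large
that the y² coefficient is at least 5Q; the mixed term costs M x² + 4Q y², because M(1 - a) ≤ Q. -/
theorem bellman_hess_aux {p q K P Q M a x y : ℝ} (hp : 2 ≤ p) (hq : 1 < q) (hq2 : q ≤ 2)
    (hP : 0 ≤ P) (hM : 0 ≤ M) (ha : 0 ≤ a) (ha1 : a ≤ 1)
    (hMQ : M * (1 - a) ≤ Q) (hK : 6 ≤ K * (q * (q - 1))) (hK0 : 0 ≤ K) :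
    M * x ^ 2 + Q * y ^ 2 ≤
      (p * (p - 1) * K * P + M * (2 + (p - 2) * (p + 3) * a - 2 * (p - 2) * a ^ 2)) * x ^ 2 +
      2 * (2 * (2 - q) * M * (1 - a) ^ 2) * x * y +
      (q * (q - 1) * K * Q + M * (2 - q) * (q - 1) * (1 - a) * (2 * a - 1)) * y ^ 2 := by
  have h1 : 0 ≤ p * (p - 1) * K * P := by
    have : 0 ≤ p - 1 := by linarith
    positivity
  have h2 : 0 ≤ (p - 2) * (p + 3) * a - 2 * (p - 2) * a ^ 2 := by
    have : (p - 2) * (p + 3) * a - 2 * (p - 2) * a ^ 2 = (p - 2) * a * (p + 3 - 2 * a) := by ring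
    rw [this]
    have := mul_nonneg (sub_nonneg.2 hp) ha
    exact mul_nonneg this (by linarith)
  have hx : (2 * M) * x ^ 2 ≤ (p * (p - 1) * K * P +
      M * (2 + (p - 2) * (p + 3) * a - 2 * (p - 2) * a ^ 2)) * x ^ 2 := by
    apply mul_le_mul_of_nonneg_right _ (sq_nonneg x)
    nlinarith [mul_nonneg hM h2]
  have hb : 0 ≤ 1 - a := by linarith
  have hQ : 0 ≤ Q := le_trans (mul_nonneg hM hb) hMQ
  -- With c = 2(2 - q)(1 - a)², the mixed term is completed to the square M(x + cy)²; its remainder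
  -- Mc²y² is at most 4Qy² since c² ≤ 4(1 - a).
  have hxy : -(M * x ^ 2 + 4 * Q * y ^ 2) ≤ 2 * (2 * (2 - q) * M * (1 - a) ^ 2) * x * y := by
    set c := 2 * (2 - q) * (1 - a) ^ 2 with hc
    have hb2 : (1 - a) ^ 2 ≤ 1 - a := by nlinarith
    have hc0 : 0 ≤ c := by
      have : 0 ≤ 2 - q := by linarith
      positivity
    have hc1 : c ≤ 2 * (1 - a) := by
      have : (2 - q) * (1 - a) ^ 2 ≤ 1 * (1 - a) :=
        mul_le_mul (by linarith) hb2 (sq_nonneg _) (by norm_num)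
      rw [hc]; linarith
    have hc2 : c ^ 2 ≤ 4 * (1 - a) := by nlinarith
    have h3 : 0 ≤ M * (x + c * y) ^ 2 := by positivity
    have h4 : M * c ^ 2 * y ^ 2 ≤ 4 * Q * y ^ 2 := by
      apply mul_le_mul_of_nonneg_right _ (sq_nonneg y)
      nlinarith [mul_le_mul_of_nonneg_left hc2 hM]
    have h5 : 2 * (2 * (2 - q) * M * (1 - a) ^ 2) * x * y = 2 * M * c * x * y := by rw [hc]; ring
    rw [h5]; nlinarith
  have hy : (5 * Q) * y ^ 2 ≤
      (q * (q - 1) * K * Q + M * (2 - q) * (q - 1) * (1 - a) * (2 * a - 1)) * y ^ 2 := by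
    apply mul_le_mul_of_nonneg_right _ (sq_nonneg y)
    have h6 : 6 * Q ≤ q * (q - 1) * K * Q := by nlinarith
    have h7 : 0 ≤ (2 - q) * (q - 1) := mul_nonneg (by linarith) (by linarith)
    have h8 : (2 - q) * (q - 1) ≤ 1 := by nlinarith
    have h9 : (2 - q) * (q - 1) * (M * (1 - a)) ≤ Q := by
      have := mul_nonneg hM hb
      nlinarith
    have h10 : 0 ≤ (2 - q) * (q - 1) * (M * (1 - a)) := mul_nonneg h7 (mul_nonneg hM hb)
    nlinarith
  linarith

/-- The exponent 1 - 2/p is forced by scaling: u² ≤ (u^p + v^q)^(2/p) makes the second summand of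
the Bellman function no larger than u^p + v^q, while q(1 - 2/p) = 2 - q makes the product of the two
Hessian weights M/u² and v^q/v² at least 1. -/
theorem bellman_size {p q u v : ℝ} (hp : 2 ≤ p) (hpq : p.HolderConjugate q) (hu : 0 < u) (hv : 0 < v) :
    u ^ 2 * (u ^ p + v ^ q) ^ (1 - 2 / p) ≤ u ^ p + v ^ q ∧
    1 ≤ (u ^ p + v ^ q) ^ (1 - 2 / p) * (v ^ q * (v ^ 2)⁻¹) := by
  have hP : 0 < u ^ p := Real.rpow_pos_of_pos hu p
  have hQ : 0 < v ^ q := Real.rpow_pos_of_pos hv q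
  have hp0 : 0 < p := by linarith
  have hθ : 0 ≤ 1 - 2 / p := by
    have : 2 / p ≤ 1 := (div_le_one hp0).2 hp
    linarith
  constructor
  · have h1 : u ^ 2 = (u ^ p) ^ (2 / p) := by
      rw [← Real.rpow_mul hu.le, mul_div_cancel₀ _ hp0.ne']
      norm_num
    calc u ^ 2 * (u ^ p + v ^ q) ^ (1 - 2 / p)
        ≤ (u ^ p + v ^ q) ^ (2 / p) * (u ^ p + v ^ q) ^ (1 - 2 / p) := by
          rw [h1]
          gcongr
          linarith
      _ = u ^ p + v ^ q := by
          rw [← Real.rpow_add (by positivity)]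
          simp
  · have hqp : q * (1 - 2 / p) = 2 - q := by
      have := hpq.inv_add_inv_eq_one
      have hq0 : q ≠ 0 := hpq.symm.ne_zero
      have hp0 := hp0.ne'
      field_simp at this ⊢
      linarith
    have h2 : (v ^ q) ^ (1 - 2 / p) * (v ^ q * (v ^ 2)⁻¹) = 1 := by
      rw [← Real.rpow_mul hv.le, hqp, ← mul_assoc, ← Real.rpow_add hv]
      have : 2 - q + q = (2 : ℕ) := by norm_num
      rw [this, Real.rpow_natCast]
      field_simp
    refine h2.symm.le.trans ?_
    have : (v ^ q) ^ (1 - 2 / p) ≤ (u ^ p + v ^ q) ^ (1 - 2 / p) :=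
      Real.rpow_le_rpow hQ.le (by linarith) hθ
    exact mul_le_mul_of_nonneg_right this (by positivity)

/-- The function is B = K(u^p + v^q) + u²(u^p + v^q)^(1 - 2/p) with K large. Every derivative of the
second summand M is M times a polynomial in a = u^p/(u^p + v^q), divided by the appropriate powers
of u and v. Since a lies in [0, 1] these polynomials are bounded, which gives all the size
conditions at once. -/
theorem exists_bellmanFn {p q : ℝ} (hp : 2 ≤ p) (hpq : p.HolderConjugate q) :
    Nonempty (BellmanFn p q) := by
  have hp0 : 0 < p := by linarith
  have hq1 : 1 < q := hpq.symm.lt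
  have hq0 : q ≠ 0 := hpq.symm.ne_zero
  have hinv := hpq.inv_add_inv_eq_one
  have hpq' : p + q = p * q := by
    have h1 := hp0.ne'
    field_simp at hinv
    linarith
  have hq2 : q ≤ 2 := by nlinarith
  set θ := 1 - 2 / p with hθ
  have hθp : θ * p = p - 2 := by rw [hθ]; field_simp
  have hθq : θ * q = 2 - q := by
    rw [hθ]; field_simp; linarith
  -- The 6 splits as 1 + 4 + 1: the lower bound Q y² to be kept, the cost 4Q y² of the mixed term,
  -- and Q y² for the possibly negative pure second derivative of M in v.
  obtain ⟨K, hK0, hK⟩ : ∃ K : ℝ, 0 ≤ K ∧ 6 ≤ K * (q * (q - 1)) := by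
    have : 0 < q * (q - 1) := mul_pos (by linarith) (by linarith)
    exact ⟨6 / (q * (q - 1)), by positivity, by rw [div_mul_cancel₀ _ this.ne']⟩
  let w : ℝ → ℝ → ℝ := fun u v => u ^ p + v ^ q
  let M : ℝ → ℝ → ℝ := fun u v => u ^ 2 * (u ^ p + v ^ q) ^ θ
  let a : ℝ → ℝ → ℝ := fun u v => u ^ p / (u ^ p + v ^ q)
  have hw : ∀ {u v : ℝ}, 0 < u → 0 < v → 0 < w u v := fun hu hv => by
    have := Real.rpow_pos_of_pos hu p
    have := Real.rpow_pos_of_pos hv q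
    positivity
  have hM0 : ∀ {u v : ℝ}, 0 < u → 0 < v → 0 ≤ M u v := fun hu hv => by
    have := hw hu hv
    positivity
  have hMw : ∀ {u v : ℝ}, 0 < u → 0 < v → M u v ≤ w u v := fun hu hv => (bellman_size hp hpq hu hv).1
  have ha0 : ∀ {u v : ℝ}, 0 < u → 0 < v → 0 ≤ a u v := fun hu hv => by
    have := hw hu hv
    positivity
  have ha1 : ∀ {u v : ℝ}, 0 < u → 0 < v → a u v ≤ 1 := fun {u v} hu hv => by
    have h1 := hw hu hv
    have h2 := Real.rpow_pos_of_pos hv q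
    refine (div_le_one h1).2 ?_
    simp only [w]; linarith
  have hPw : ∀ {u v : ℝ}, 0 < u → 0 < v → |u ^ p| ≤ w u v ∧ |v ^ q| ≤ w u v := fun {u v} hu hv => by
    have h1 := Real.rpow_pos_of_pos hu p
    have h2 := Real.rpow_pos_of_pos hv q
    rw [abs_of_pos h1, abs_of_pos h2]
    constructor <;> simp only [w] <;> linarith
  have key : ∀ {c₁ c₂ P X W A : ℝ}, |P| ≤ W → |X| ≤ W → |A| ≤ c₂ → |c₁ * P + X * A| ≤ (|c₁| + c₂) * W := by
    intro c₁ c₂ P X W A h1 h2 h3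
    calc |c₁ * P + X * A| ≤ |c₁ * P| + |X * A| := abs_add_le _ _
      _ = |c₁| * |P| + |X| * |A| := by rw [abs_mul, abs_mul]
      _ ≤ |c₁| * W + W * c₂ := by
        have : 0 ≤ W := le_trans (abs_nonneg _) h1
        gcongr
      _ = _ := by ring
  have hMw' : ∀ {u v : ℝ}, 0 < u → 0 < v → |M u v| ≤ w u v := fun hu hv => by
    rw [abs_of_nonneg (hM0 hu hv)]; exact hMw hu hv
  have hMd : ∀ {U V : ℝ → ℝ} {U' V' s : ℝ}, 0 < U s → 0 < V s → HasDerivAt U U' s →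
      HasDerivAt V V' s → HasDerivAt (fun r => U r ^ p) (p * (U s) ^ p * (U' / U s)) s ∧
      HasDerivAt (fun r => V r ^ q) (q * (V s) ^ q * (V' / V s)) s ∧
      HasDerivAt (fun r => M (U r) (V r)) (M (U s) (V s) *
        ((2 + (p - 2) * a (U s) (V s)) * (U' / U s) +
          (2 - q) * (1 - a (U s) (V s)) * (V' / V s))) s ∧
      HasDerivAt (fun r => a (U r) (V r)) (a (U s) (V s) * (1 - a (U s) (V s)) *
        (p * (U' / U s) - q * (V' / V s))) s := by
    intro U V U' V' s hu hv hU hV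
    have h1 : HasDerivAt (fun r => U r ^ p) (p * (U s) ^ p * (U' / U s)) s := by
      convert hU.rpow_const (p := p) (Or.inl hu.ne') using 1
      rw [Real.rpow_sub_one hu.ne']; field_simp
    have h2 : HasDerivAt (fun r => V r ^ q) (q * (V s) ^ q * (V' / V s)) s := by
      convert hV.rpow_const (p := q) (Or.inl hv.ne') using 1
      rw [Real.rpow_sub_one hv.ne']; field_simp
    have hww : 0 < U s ^ p + V s ^ q := hw hu hv
    have h3 := h1.add h2
    refine ⟨h1, h2, ?_, ?_⟩
    · have h4 := (hU.pow 2).mul (h3.rpow_const (p := θ) (Or.inl hww.ne'))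
      refine HasDerivAt.congr_deriv h4 ?_
      simp only [M, a, Pi.add_apply, Pi.pow_apply]
      rw [Real.rpow_sub_one hww.ne', ← hθp, ← hθq]
      push_cast
      have := hu.ne'
      have := hv.ne'
      field_simp
      ring
    · have h4 := h1.div h3 hww.ne'
      refine HasDerivAt.congr_deriv h4 ?_
      simp only [a, Pi.add_apply]
      have := hu.ne'
      have := hv.ne'
      field_simp
      ring
  have absle : ∀ {x y : ℝ}, 0 < y → ∀ z, |z * (y)⁻¹| * y = |z| := by
    intro x y hy z
    rw [abs_mul, abs_inv, abs_of_pos hy, mul_assoc, inv_mul_cancel₀ hy.ne', mul_one]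
  -- The factors of M in its derivatives, as polynomials in a: M_u = M cu(a)/u, M_uv = M
  -- cuv(a)/(uv), and so on.
  let cu : ℝ → ℝ := fun t => 2 + (p - 2) * t
  let cv : ℝ → ℝ := fun t => (2 - q) * (1 - t)
  let cuu : ℝ → ℝ := fun t => 2 + (p - 2) * (p + 3) * t - 2 * (p - 2) * t ^ 2
  let cuv : ℝ → ℝ := fun t => 2 * (2 - q) * (1 - t) ^ 2
  let cvv : ℝ → ℝ := fun t => (2 - q) * (q - 1) * (1 - t) * (2 * t - 1)
  obtain ⟨D, hD⟩ : ∃ D : ℝ, ∀ t ∈ Icc (0 : ℝ) 1, |cu t| ≤ D ∧ |cv t| ≤ D ∧ |cuu t| ≤ D ∧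
      |cuv t| ≤ D ∧ |cvv t| ≤ D := by
    have hc : ContinuousOn (fun t => |cu t| + |cv t| + |cuu t| + |cuv t| + |cvv t|) (Icc (0 : ℝ) 1) := by
      simp only [cu, cv, cuu, cuv, cvv]; fun_prop
    obtain ⟨D, hD⟩ := isCompact_Icc.exists_bound_of_continuousOn hc
    refine ⟨D, fun t ht => ?_⟩
    have := (le_abs_self _).trans (hD t ht)
    have h1 := abs_nonneg (cu t)
    have h2 := abs_nonneg (cv t)
    have h3 := abs_nonneg (cuu t)
    have h4 := abs_nonneg (cuv t)
    have h5 := abs_nonneg (cvv t)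
    refine ⟨?_, ?_, ?_, ?_, ?_⟩ <;> linarith
  have hDa : ∀ {u v : ℝ}, 0 < u → 0 < v → _ := fun {u v} hu hv => hD (a u v) ⟨ha0 hu hv, ha1 hu hv⟩
  have hD0 : 0 ≤ D := (abs_nonneg _).trans (hD 0 (by simp)).1
  have hCle : ∀ {c : ℝ}, c ∈ ({p * K, q * K, p * (p - 1) * K, q * (q - 1) * K, K + 1, 0} : Set ℝ) →
      |c| + D ≤ |p * K| + |q * K| + |p * (p - 1) * K| + |q * (q - 1) * K| + |K + 1| + D := by
    intro c hc
    have h1 := abs_nonneg (p * K)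
    have h2 := abs_nonneg (q * K)
    have h3 := abs_nonneg (p * (p - 1) * K)
    have h4 := abs_nonneg (q * (q - 1) * K)
    have h5 := abs_nonneg (K + 1)
    rcases hc with rfl | rfl | rfl | rfl | rfl | rfl <;> try simp only [abs_zero]
    all_goals linarith
  have fin : ∀ {u v c x z : ℝ}, 0 < u → 0 < v →
      c ∈ ({p * K, q * K, p * (p - 1) * K, q * (q - 1) * K, K + 1, 0} : Set ℝ) →
      |x| ≤ w u v → |z| ≤ D → |c * x + M u v * z| ≤
      (|p * K| + |q * K| + |p * (p - 1) * K| + |q * (q - 1) * K| + |K + 1| + D) * (u ^ p + v ^ q) := by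
    intro u v c x z hu hv hc hx hz
    refine (key hx (hMw' hu hv) hz).trans ?_
    exact mul_le_mul_of_nonneg_right (hCle hc) (hw hu hv).le
  have hwm : Measurable fun x : ℝ × ℝ => x.1 ^ p + x.2 ^ q := by fun_prop
  have hMm : Measurable fun x : ℝ × ℝ => M x.1 x.2 := by simp only [M]; fun_prop
  have ham : Measurable fun x : ℝ × ℝ => a x.1 x.2 := by simp only [a]; fun_prop
  refine ⟨{
    B := fun u v => K * w u v + M u v
    Bu := fun u v => (p * K * u ^ p + M u v * cu (a u v)) * u⁻¹
    Bv := fun u v => (q * K * v ^ q + M u v * cv (a u v)) * v⁻¹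
    Buu := fun u v => (p * (p - 1) * K * u ^ p + M u v * cuu (a u v)) * (u * u)⁻¹
    Buv := fun u v => (0 * u ^ p + M u v * cuv (a u v)) * (u * v)⁻¹
    Bvv := fun u v => (q * (q - 1) * K * v ^ q + M u v * cvv (a u v)) * (v * v)⁻¹
    α := fun u v => M u v * (u ^ 2)⁻¹
    β := fun u v => v ^ q * (v ^ 2)⁻¹
    C := |p * K| + |q * K| + |p * (p - 1) * K| + |q * (q - 1) * K| + |K + 1| + D
    measB := by simp only [Function.uncurry_def, w]; fun_prop
    measBu := by simp only [Function.uncurry_def, cu]; fun_prop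
    measBv := by simp only [Function.uncurry_def, cv]; fun_prop
    measBuu := by simp only [Function.uncurry_def, cuu]; fun_prop
    measBuv := by simp only [Function.uncurry_def, cuv]; fun_prop
    measBvv := by simp only [Function.uncurry_def, cvv]; fun_prop
    hasDerivAt_B := ?_
    hasDerivAt_Bu := ?_
    hasDerivAt_Bv := ?_
    C_nonneg := by positivity
    B_nonneg := fun hu hv => add_nonneg (mul_nonneg hK0 (hw hu hv).le) (hM0 hu hv)
    B_le := ?_
    Bu_le := ?_
    Bv_le := ?_
    Buu_le := ?_
    Buv_le := ?_
    Bvv_le := ?_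
    α_nonneg := fun {u v} hu hv => mul_nonneg (hM0 hu hv) (by positivity)
    β_nonneg := fun {u v} hu hv => mul_nonneg (Real.rpow_nonneg hv.le _) (by positivity)
    one_le := ?_
    hess_ge := ?_ }⟩
  · intro U V U' V' s hu hv hU hV
    obtain ⟨h1, h2, h3, h4⟩ := hMd hu hv hU hV
    refine HasDerivAt.congr_deriv (((h1.add h2).const_mul K).add h3) ?_
    simp only [cu, cv]
    have := hu.ne'
    have := hv.ne'
    field_simp
    ring
  · intro U V U' V' s hu hv hU hV
    obtain ⟨h1, h2, h3, h4⟩ := hMd hu hv hU hV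
    have h5 := ((h1.const_mul (p * K)).add (h3.mul ((h4.const_mul (p - 2)).const_add 2))).mul
      (hU.inv hu.ne')
    refine HasDerivAt.congr_deriv h5 ?_
    simp only [cuu, cuv, Pi.add_apply, Pi.mul_apply, Pi.inv_apply]
    have := hu.ne'
    have := hv.ne'
    -- Both sides equal (1 - 2/p)pq. This identity makes the derivative of `Bu` in v agree with the
    -- same `cuv` that arises from the derivative of `Bv` in u.
    have e : (2 - q) * p = (p - 2) * q := by linarith
    generalize a (U s) (V s) = A
    generalize M (U s) (V s) = MM
    field_simp
    linear_combination (MM * U s * V' * A * (1 - A)) * e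
  · intro U V U' V' s hu hv hU hV
    obtain ⟨h1, h2, h3, h4⟩ := hMd hu hv hU hV
    have h5 := ((h2.const_mul (q * K)).add (h3.mul ((h4.const_sub 1).const_mul (2 - q)))).mul
      (hV.inv hv.ne')
    refine HasDerivAt.congr_deriv h5 ?_
    simp only [cvv, cuv, Pi.add_apply, Pi.mul_apply, Pi.inv_apply]
    have := hu.ne'
    have := hv.ne'
    generalize a (U s) (V s) = A
    generalize M (U s) (V s) = MM
    field_simp
    ring
  · intro u v hu hv
    have h := fin (z := 0) (x := w u v) hu hv (c := K + 1) (by simp) (by rw [abs_of_pos (hw hu hv)])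
      (by simpa using hD0)
    have := hMw hu hv
    have h' := le_of_abs_le h
    refine le_trans ?_ h'
    linarith
  · intro u v hu hv
    rw [absle (x := 0) hu]
    exact fin hu hv (by simp) (hPw hu hv).1 (hDa hu hv).1
  · intro u v hu hv
    rw [absle (x := 0) hv]
    exact fin hu hv (by simp) (hPw hu hv).2 (hDa hu hv).2.1
  · intro u v hu hv
    rw [absle (x := 0) (mul_pos hu hu)]
    exact fin hu hv (by simp) (hPw hu hv).1 (hDa hu hv).2.2.1
  · intro u v hu hv
    rw [absle (x := 0) (mul_pos hu hv)]
    exact fin hu hv (by simp) (hPw hu hv).1 (hDa hu hv).2.2.2.1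
  · intro u v hu hv
    rw [absle (x := 0) (mul_pos hv hv)]
    exact fin hu hv (by simp) (hPw hu hv).2 (hDa hu hv).2.2.2.2
  · intro u v hu hv
    have := (bellman_size hp hpq hu hv).2
    have h0 := hu.ne'
    convert this using 2
    simp only [M, hθ]
    rw [mul_comm (u ^ 2), mul_assoc, mul_inv_cancel₀ (by positivity), mul_one]
  · intro u v hu hv ξ η
    have hP := (Real.rpow_pos_of_pos hu p).le
    have h1a : 1 - a u v = v ^ q / w u v := by
      have := (hw hu hv).ne'
      simp only [a, w] at this ⊢
      field_simp
      ring
    have hMQ : M u v * (1 - a u v) ≤ v ^ q := by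
      rw [h1a, ← mul_div_assoc, div_le_iff₀ (hw hu hv), mul_comm]
      exact mul_le_mul_of_nonneg_left (hMw hu hv) (Real.rpow_nonneg hv.le _)
    have := bellman_hess_aux (x := ξ / u) (y := η / v) hp hq1 hq2 hP (hM0 hu hv) (ha0 hu hv) (ha1 hu hv)
      hMQ hK hK0
    have h0 := hu.ne'
    have h0' := hv.ne'
    convert this using 1
    · field_simp
    · simp only [cuu, cuv, cvv]
      field_simp
      ring

end

end NSCyl

namespace NSCyl

noncomputable section

/-! ### Gaussian averages on `ℝ³` -/

/-- The `i`-th vector of the standard basis of `ℝ³`. -/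
abbrev bv (i : Fin 3) : E3 := EuclideanSpace.single i (1 : ℝ)

/-- The Gaussian probability density on `ℝ³` proportional to `exp (-l ‖x‖ ^ 2)`. -/
def gauss (l : ℝ) (x : E3) : ℝ := (l / Real.pi) ^ (3 / 2 : ℝ) * Real.exp (-l * ‖x‖ ^ 2)

/-- The derivative `∂ᵢ` of the Gaussian density. -/
def gauss1 (l : ℝ) (i : Fin 3) (x : E3) : ℝ := -2 * l * x i * gauss l x

/-- The derivative `∂ᵢ ∂ⱼ` of the Gaussian density. -/
def gauss2 (l : ℝ) (i j : Fin 3) (x : E3) : ℝ :=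
  (4 * l ^ 2 * x i * x j - 2 * l * (if i = j then 1 else 0)) * gauss l x

/-- The derivative of the Gaussian density in its parameter. -/
def gaussl (l : ℝ) (x : E3) : ℝ := (3 / (2 * l) - ‖x‖ ^ 2) * gauss l x

/-- The convolution `k * f`. -/
def cv (k f : E3 → ℝ) (x : E3) : ℝ := ∫ y, k (x - y) * f y

theorem gauss_pos {l : ℝ} (hl : 0 < l) (x : E3) : 0 < gauss l x := by
  have := Real.pi_pos
  unfold gauss; positivity

theorem continuous_gauss (l : ℝ) : Continuous (gauss l) := by unfold gauss; fun_prop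

theorem continuous_gauss1 (l : ℝ) (i : Fin 3) : Continuous (gauss1 l i) := by
  have := continuous_gauss l
  unfold gauss1; fun_prop

theorem continuous_gauss2 (l : ℝ) (i j : Fin 3) : Continuous (gauss2 l i j) := by
  have := continuous_gauss l
  unfold gauss2; fun_prop

theorem continuous_gaussl (l : ℝ) : Continuous (gaussl l) := by
  have := continuous_gauss l
  unfold gaussl; fun_prop

theorem integrable_gauss {l : ℝ} (hl : 0 < l) : Integrable (gauss l) := by
  have h := GaussianFourier.integrable_cexp_neg_mul_sq_norm_add (V := E3) (b := (l : ℂ)) (by simpa) 0 0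
  have h2 := h.re
  refine (h2.const_mul ((l / Real.pi) ^ (3 / 2 : ℝ))).congr (Eventually.of_forall fun x => ?_)
  simp only [gauss]
  congr 1
  have : (-(l : ℂ) * (‖x‖ : ℂ) ^ 2 + 0 * (inner ℝ 0 x : ℝ)) = ((-l * ‖x‖ ^ 2 : ℝ) : ℂ) := by
    push_cast; ring
  rw [this, ← Complex.ofReal_exp]
  exact Complex.ofReal_re _

theorem integral_gauss {l : ℝ} (hl : 0 < l) : ∫ x, gauss l x = 1 := by
  have h := GaussianFourier.integral_rexp_neg_mul_sq_norm (V := E3) hl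
  have hpi := Real.pi_pos
  simp only [gauss, integral_const_mul, h]
  rw [finrank_euclideanSpace_fin, Nat.cast_ofNat, ← Real.mul_rpow (by positivity) (by positivity)]
  have : l / Real.pi * (Real.pi / l) = 1 := by field_simp
  rw [this]; simp

/-- Cubing 1 + t² ≤ (1 + 3/l₀) exp(lt²/3) gives the decay, uniformly for l in a compact interval.
The power 6 is chosen so that two powers can be spent on polynomial factors of derivatives and the
remaining (1 + |x|)⁻⁴ is still integrable on ℝ³. -/
theorem gauss_decay {l₀ l₁ l : ℝ} (h0 : 0 < l₀) (hl : l ∈ Icc l₀ l₁) (x : E3) :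
    gauss l x * (1 + ‖x‖) ^ 6 ≤ 8 * (1 + 3 / l₀) ^ 3 * (l₁ / Real.pi) ^ (3 / 2 : ℝ) := by
  have hpi := Real.pi_pos
  have hl0 : 0 < l := h0.trans_le hl.1
  set t := ‖x‖
  have h1 : (1 + t) ^ 6 ≤ 8 * (1 + t ^ 2) ^ 3 := by
    have h2 : (1 + t) ^ 2 ≤ 2 * (1 + t ^ 2) := by nlinarith [sq_nonneg (1 - t)]
    calc (1 + t) ^ 6 = ((1 + t) ^ 2) ^ 3 := by ring
      _ ≤ (2 * (1 + t ^ 2)) ^ 3 := by gcongr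
      _ = _ := by ring
  have h2 : 1 + t ^ 2 ≤ (1 + 3 / l₀) * Real.exp (l / 3 * t ^ 2) := by
    have h3 := Real.add_one_le_exp (l / 3 * t ^ 2)
    calc 1 + t ^ 2 ≤ (1 + 3 / l₀) * (l / 3 * t ^ 2 + 1) := by
          have h4 : 1 ≤ 3 / l₀ * (l / 3) := by
            rw [div_mul_div_comm, le_div_iff₀ (by positivity)]; linarith [hl.1]
          have h5 : 0 ≤ 3 / l₀ := by positivity
          have h6 : 0 ≤ l / 3 * t ^ 2 := by positivity
          nlinarith [mul_le_mul_of_nonneg_right h4 (sq_nonneg t)]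
      _ ≤ _ := by gcongr
  have h3 : (1 + t ^ 2) ^ 3 ≤ (1 + 3 / l₀) ^ 3 * Real.exp (l * t ^ 2) := by
    calc (1 + t ^ 2) ^ 3 ≤ ((1 + 3 / l₀) * Real.exp (l / 3 * t ^ 2)) ^ 3 := by gcongr
      _ = (1 + 3 / l₀) ^ 3 * Real.exp (l * t ^ 2) := by
        rw [mul_pow, ← Real.exp_nat_mul]; congr 2; push_cast; ring
  have h4 : Real.exp (-l * t ^ 2) * Real.exp (l * t ^ 2) = 1 := by
    rw [← Real.exp_add]; simp
  have h5 : (l / Real.pi) ^ (3 / 2 : ℝ) ≤ (l₁ / Real.pi) ^ (3 / 2 : ℝ) := by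
    have := hl.2
    gcongr
  have he := Real.exp_pos (-l * t ^ 2)
  have hE : Real.exp (-l * t ^ 2) * (1 + t) ^ 6 ≤ 8 * (1 + 3 / l₀) ^ 3 := by
    calc Real.exp (-l * t ^ 2) * (1 + t) ^ 6
        ≤ Real.exp (-l * t ^ 2) * (8 * ((1 + 3 / l₀) ^ 3 * Real.exp (l * t ^ 2))) := by
          gcongr; linarith
      _ = 8 * (1 + 3 / l₀) ^ 3 * (Real.exp (-l * t ^ 2) * Real.exp (l * t ^ 2)) := by ring
      _ = _ := by rw [h4, mul_one]
  have hl1 : 0 < l₁ := hl0.trans_le hl.2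
  calc gauss l x * (1 + t) ^ 6
      = (l / Real.pi) ^ (3 / 2 : ℝ) * (Real.exp (-l * t ^ 2) * (1 + t) ^ 6) := by
        simp only [gauss, t]; ring
    _ ≤ (l₁ / Real.pi) ^ (3 / 2 : ℝ) * (8 * (1 + 3 / l₀) ^ 3) := by gcongr
    _ = _ := by ring

theorem abs_coord_le (x : E3) (i : Fin 3) : |x i| ≤ ‖x‖ := by
  simpa using PiLp.norm_apply_le x i

theorem abs_gauss1_le {l : ℝ} (hl : 0 < l) (i : Fin 3) (x : E3) :
    |gauss1 l i x| ≤ 2 * l * (1 + ‖x‖) * gauss l x := by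
  have h := abs_coord_le x i
  have hg := gauss_pos hl x
  rw [gauss1, abs_mul, abs_of_pos hg]
  gcongr
  rw [abs_mul, abs_mul, abs_of_pos hl]
  norm_num
  nlinarith [mul_le_mul_of_nonneg_left h hl.le]

theorem abs_gauss2_le {l : ℝ} (hl : 0 < l) (i j : Fin 3) (x : E3) :
    |gauss2 l i j x| ≤ (4 * l ^ 2 + 2 * l) * (1 + ‖x‖) ^ 2 * gauss l x := by
  have hi := abs_coord_le x i
  have hj := abs_coord_le x j
  have hg := gauss_pos hl x
  have hn := norm_nonneg x
  rw [gauss2, abs_mul, abs_of_pos hg]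
  gcongr
  have h1 : |4 * l ^ 2 * x i * x j| ≤ 4 * l ^ 2 * ‖x‖ ^ 2 := by
    rw [mul_assoc, abs_mul, abs_of_pos (by positivity : 0 < 4 * l ^ 2), abs_mul, sq ‖x‖]
    gcongr
  have h2 : |2 * l * (if i = j then (1 : ℝ) else 0)| ≤ 2 * l := by
    split_ifs <;> simp [abs_of_pos hl, hl.le]
  refine (abs_sub _ _).trans ((add_le_add h1 h2).trans ?_)
  nlinarith [mul_nonneg (sq_nonneg l) hn, mul_nonneg hl.le hn, mul_nonneg hl.le (sq_nonneg ‖x‖)]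

theorem abs_gaussl_le {l : ℝ} (hl : 0 < l) (x : E3) :
    |gaussl l x| ≤ (3 / (2 * l) + 1) * (1 + ‖x‖) ^ 2 * gauss l x := by
  have hg := gauss_pos hl x
  have hn := norm_nonneg x
  rw [gaussl, abs_mul, abs_of_pos hg]
  gcongr
  have h0 : 0 < 3 / (2 * l) := by positivity
  have h1 : |3 / (2 * l) - ‖x‖ ^ 2| ≤ 3 / (2 * l) + ‖x‖ ^ 2 := by
    rw [abs_le]; constructor <;> nlinarith [sq_nonneg ‖x‖]
  refine h1.trans ?_
  nlinarith [mul_nonneg h0.le hn, mul_nonneg h0.le (sq_nonneg ‖x‖)]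

theorem hasDerivAt_norm_sq_line (x : E3) (i : Fin 3) :
    HasDerivAt (fun s : ℝ => ‖x + s • bv i‖ ^ 2) (2 * x i) 0 := by
  have h1 : HasDerivAt (fun s : ℝ => x + s • bv i) (bv i) 0 := by
    simpa using ((hasDerivAt_id (0 : ℝ)).smul_const (bv i)).const_add x
  have h2 := h1.norm_sq
  convert h2 using 1
  simp [EuclideanSpace.inner_single_right]

theorem hasDerivAt_coord_line (x : E3) (i j : Fin 3) :
    HasDerivAt (fun s : ℝ => (x + s • bv i) j) (if i = j then 1 else 0) 0 := by
  have h1 : HasDerivAt (fun s : ℝ => x j + s * (if i = j then (1 : ℝ) else 0))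
      (1 * (if i = j then (1 : ℝ) else 0)) 0 :=
    ((hasDerivAt_id (0 : ℝ)).mul_const _).const_add _
  rw [one_mul] at h1
  refine h1.congr_of_eventuallyEq (Eventually.of_forall fun s => ?_)
  simp [eq_comm]

theorem hasLineDerivAt_gauss (l : ℝ) (i : Fin 3) (x : E3) :
    HasLineDerivAt ℝ (gauss l) (gauss1 l i x) x (bv i) := by
  have h := (((hasDerivAt_norm_sq_line x i).const_mul (-l)).exp).const_mul ((l / Real.pi) ^ (3 / 2 : ℝ))
  refine HasDerivAt.congr_deriv h ?_
  simp [gauss1, gauss]; ring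

theorem hasLineDerivAt_gauss1 (l : ℝ) (i j : Fin 3) (x : E3) :
    HasLineDerivAt ℝ (gauss1 l j) (gauss2 l i j x) x (bv i) := by
  have h := ((hasDerivAt_coord_line x i j).const_mul (-2 * l)).mul
    (hasLineDerivAt_gauss l i x : HasDerivAt _ _ _)
  refine HasDerivAt.congr_deriv h ?_
  simp only [gauss2, gauss1, zero_smul, add_zero]; ring

theorem hasDerivAt_gauss {l : ℝ} (hl : 0 < l) (x : E3) :
    HasDerivAt (fun r => gauss r x) (gaussl l x) l := by
  have hpi := Real.pi_pos
  have h1 : HasDerivAt (fun r : ℝ => (r / Real.pi) ^ (3 / 2 : ℝ)) _ l :=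
    ((hasDerivAt_id l).div_const Real.pi).rpow_const (p := 3 / 2) (Or.inl (by have := hl.ne'; simp; positivity))
  have h2 : HasDerivAt (fun r : ℝ => Real.exp (-r * ‖x‖ ^ 2)) _ l :=
    ((hasDerivAt_id l).neg.mul_const (‖x‖ ^ 2)).exp
  refine HasDerivAt.congr_deriv (h1.mul h2) ?_
  have h3 : l / Real.pi ≠ 0 := by positivity
  simp only [gaussl, gauss, id, Pi.neg_apply]
  rw [Real.rpow_sub_one h3]
  field_simp
  ring

/-- The heat equation in the parameter l: the Gaussian is the heat kernel at time 1/(4l), whose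
derivative in l is -1/(4l²). Increasing l therefore runs the heat flow backwards. -/
theorem gaussl_eq {l : ℝ} (hl : 0 < l) (x : E3) :
    gaussl l x = -(1 / (4 * l ^ 2)) * ∑ i, gauss2 l i i x := by
  have : ‖x‖ ^ 2 = ∑ i, x i ^ 2 := by rw [EuclideanSpace.norm_sq_eq]; simp
  simp only [gaussl, gauss2, this, Fin.sum_univ_three, if_true]
  field_simp
  ring

theorem integrable_cv {k f : E3 → ℝ} (hk : Measurable k) {C : ℝ} (hC : ∀ z, |k z| ≤ C)
    (hf : Integrable f) (x : E3) : Integrable (fun y => k (x - y) * f y) :=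
  hf.bdd_mul (c := C) (hk.comp (measurable_const.sub measurable_id)).aestronglyMeasurable (Eventually.of_forall fun _ => hC _)

theorem hasLineDerivAt_cv {k k' f : E3 → ℝ} (hk : Continuous k) (hk' : Continuous k') {C C' : ℝ}
    (hC : ∀ z, |k z| ≤ C) (hC' : ∀ z, |k' z| ≤ C') {v : E3} (hd : ∀ z, HasLineDerivAt ℝ k (k' z) z v)
    (hf : Integrable f) (x : E3) : HasLineDerivAt ℝ (cv k f) (cv k' f x) x v := by
  have key := hasDerivAt_integral_of_dominated_loc_of_deriv_le (𝕜 := ℝ) (μ := (volume : Measure E3))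
    (F := fun (s : ℝ) y => k (x + s • v - y) * f y) (F' := fun (s : ℝ) y => k' (x + s • v - y) * f y)
    (x₀ := 0) (s := univ) (bound := fun y => C' * ‖f y‖) univ_mem
    (Eventually.of_forall fun s => (integrable_cv hk.measurable hC hf _).aestronglyMeasurable)
    (integrable_cv hk.measurable hC hf _) ?_ ?_ (hf.norm.const_mul C') ?_
  · have h := key.2
    simp only [zero_smul, add_zero] at h
    exact h
  · exact (integrable_cv hk'.measurable hC' hf _).aestronglyMeasurable
  · refine Eventually.of_forall fun y s _ => ?_
    rw [norm_mul]
    exact mul_le_mul_of_nonneg_right (hC' _) (norm_nonneg _)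
  · refine Eventually.of_forall fun y s _ => ?_
    have h := hd (x + s • v - y)
    have h2 : HasDerivAt (fun r : ℝ => k (x + r • v - y)) (k' (x + s • v - y)) s := by
      have h3 : HasDerivAt (fun r : ℝ => k (x + s • v - y + r • v)) (k' (x + s • v - y)) (s - s) := by
        rw [sub_self]; exact h
      have h4 := h3.comp_sub_const s s
      refine h4.congr_of_eventuallyEq (Eventually.of_forall fun r => ?_)
      simp only
      congr 1
      module
    exact h2.mul_const _

/-- The comparison of kernels is needed only where f is nonzero, and m may depend on x. This is what
allows polynomial weights in x - y to be traded for weights in x when f has bounded support. -/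
theorem abs_cv_le {k m f : E3 → ℝ} {x : E3} (hm : Integrable (fun y => m (x - y) * f y))
    (hf : ∀ y, 0 ≤ f y) (h : ∀ y, f y ≠ 0 → |k (x - y)| ≤ m (x - y)) :
    |cv k f x| ≤ cv m f x := by
  refine norm_integral_le_of_norm_le (f := fun y => k (x - y) * f y) hm (Eventually.of_forall fun y => ?_)
  rw [norm_mul, Real.norm_of_nonneg (hf y)]
  by_cases hy : f y = 0
  · simp [hy]
  · exact mul_le_mul_of_nonneg_right (h y hy) (hf y)

theorem measurable_cv {k f : E3 → ℝ} (hk : Measurable k) (hf : Integrable f) :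
    Measurable (cv k f) := by
  obtain ⟨f', hf', hff'⟩ := hf.aestronglyMeasurable
  have : cv k f = fun x => ∫ y, k (x - y) * f' y := by
    ext x
    exact integral_congr_ae (hff'.mono fun y hy => by simp only [hy])
  rw [this]
  have h2 : StronglyMeasurable (Function.uncurry fun x y : E3 => k (x - y) * f' y) :=
    (hk.comp (measurable_fst.sub measurable_snd)).stronglyMeasurable.mul
      (hf'.comp_measurable measurable_snd)
  exact h2.integral_prod_right.measurable

end

end NSCyl

/-! ### Gaussian integrals and the semigroup law for gradients. -/

namespace NSCyl

noncomputable section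

theorem integrable_one_add_norm_four : Integrable (fun x : E3 => ((1 + ‖x‖) ^ 4)⁻¹) := by
  have h : Integrable (fun x : E3 => (1 + ‖x‖) ^ (-(4 : ℝ))) :=
    integrable_one_add_norm (by rw [finrank_euclideanSpace_fin]; norm_num)
  refine h.congr (Eventually.of_forall fun x => ?_)
  have : 0 ≤ 1 + ‖x‖ := by positivity
  simp only [Real.rpow_neg this]
  norm_cast

theorem integrable_of_gauss_bound {l : ℝ} (hl : 0 < l) {k : E3 → ℝ} (hk : Continuous k) {c : ℝ}
    (hc : 0 ≤ c) (h : ∀ x, |k x| ≤ c * (1 + ‖x‖) ^ 2 * gauss l x) : Integrable k := by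
  refine (integrable_one_add_norm_four.const_mul
    (c * (8 * (1 + 3 / l) ^ 3 * (l / Real.pi) ^ (3 / 2 : ℝ)))).mono' hk.aestronglyMeasurable
    (Eventually.of_forall fun x => (h x).trans ?_)
  have h1 := gauss_decay hl ⟨le_rfl, le_rfl⟩ x
  have h2 : 0 < 1 + ‖x‖ := by positivity
  rw [← div_eq_mul_inv, le_div_iff₀ (by positivity)]
  calc c * (1 + ‖x‖) ^ 2 * gauss l x * (1 + ‖x‖) ^ 4 = c * (gauss l x * (1 + ‖x‖) ^ 6) := by ring
    _ ≤ _ := by gcongr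

theorem bounded_of_gauss_bound {l : ℝ} (hl : 0 < l) {k : E3 → ℝ} {c : ℝ}
    (hc : 0 ≤ c) (h : ∀ x, |k x| ≤ c * (1 + ‖x‖) ^ 2 * gauss l x) (x : E3) :
    |k x| ≤ c * (8 * (1 + 3 / l) ^ 3 * (l / Real.pi) ^ (3 / 2 : ℝ)) := by
  refine (h x).trans ?_
  have h1 := gauss_decay hl ⟨le_rfl, le_rfl⟩ x
  have h2 : 1 ≤ 1 + ‖x‖ := by linarith [norm_nonneg x]
  have h3 := gauss_pos hl x
  calc c * (1 + ‖x‖) ^ 2 * gauss l x = c * (gauss l x * (1 + ‖x‖) ^ 2) := by ring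
    _ ≤ c * (gauss l x * (1 + ‖x‖) ^ 6) := by gcongr; norm_num
    _ ≤ _ := by gcongr

theorem gauss_le_weight {l : ℝ} (hl : 0 < l) (x : E3) :
    |gauss l x| ≤ 1 * (1 + ‖x‖) ^ 2 * gauss l x := by
  have h3 := gauss_pos hl x
  rw [abs_of_pos h3]
  have : 1 ≤ (1 + ‖x‖) ^ 2 := one_le_pow₀ (by linarith [norm_nonneg x])
  nlinarith

theorem gauss1_le_weight {l : ℝ} (hl : 0 < l) (i : Fin 3) (x : E3) :
    |gauss1 l i x| ≤ (2 * l) * (1 + ‖x‖) ^ 2 * gauss l x := by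
  have h3 := gauss_pos hl x
  refine (abs_gauss1_le hl i x).trans ?_
  have : 1 + ‖x‖ ≤ (1 + ‖x‖) ^ 2 := le_self_pow₀ (by linarith [norm_nonneg x]) (by norm_num)
  gcongr

theorem integrable_gauss1 {l : ℝ} (hl : 0 < l) (i : Fin 3) : Integrable (gauss1 l i) :=
  integrable_of_gauss_bound hl (continuous_gauss1 l i) (by positivity) (gauss1_le_weight hl i)

theorem integrable_gauss2 {l : ℝ} (hl : 0 < l) (i j : Fin 3) : Integrable (gauss2 l i j) :=
  integrable_of_gauss_bound hl (continuous_gauss2 l i j) (by positivity) (abs_gauss2_le hl i j)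

theorem integral_lineDeriv_eq_zero {k k' : E3 → ℝ} {v : E3} (hk : Integrable k) (hk' : Integrable k')
    (hd : ∀ x, HasLineDerivAt ℝ k (k' x) x v) : ∫ x, k' x = 0 := by
  have := integral_bilinear_hasLineDerivAt_right_eq_neg_left_of_integrable
    (μ := (volume : Measure E3)) (f := fun _ => (1 : ℝ)) (f' := fun _ => (0 : ℝ)) (g := k) (g' := k')
    (v := v) (B := ContinuousLinearMap.mul ℝ ℝ) (by simp) (by simpa using hk') (by simpa using hk)
    (fun x _ => by
      have : HasDerivAt (fun t : ℝ => (1 : ℝ)) 0 0 := hasDerivAt_const _ _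
      exact this) (fun x _ => hd x)
  simpa using this

theorem integral_gauss1 {l : ℝ} (hl : 0 < l) (i : Fin 3) : ∫ x, gauss1 l i x = 0 :=
  integral_lineDeriv_eq_zero (integrable_gauss hl) (integrable_gauss1 hl i) (hasLineDerivAt_gauss l i)

theorem integral_gauss2 {l : ℝ} (hl : 0 < l) (i j : Fin 3) : ∫ x, gauss2 l i j x = 0 :=
  integral_lineDeriv_eq_zero (integrable_gauss1 hl j) (integrable_gauss2 hl i j)
    (hasLineDerivAt_gauss1 l i j)

/-- By the parallelogram law the product of two Gaussians separates into a Gaussian about the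
midpoint and a Gaussian in the difference of the centres. -/
theorem gauss_mul_gauss {l : ℝ} (hl : 0 < l) (w d : E3) :
    gauss l (w - (1 / 2 : ℝ) • d) * gauss l (w + (1 / 2 : ℝ) • d) = gauss (2 * l) w * gauss (l / 2) d := by
  have hpi := Real.pi_pos
  have h1 : ‖w - (1 / 2 : ℝ) • d‖ ^ 2 + ‖w + (1 / 2 : ℝ) • d‖ ^ 2 = 2 * ‖w‖ ^ 2 + ‖d‖ ^ 2 / 2 := by
    have := parallelogram_law_with_norm ℝ w ((1 / 2 : ℝ) • d)
    rw [norm_smul] at this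
    norm_num at this
    linarith
  have e : ∀ a b c d : ℝ, (a * b) * (c * d) = (a * c) * (b * d) := fun a b c d => by ring
  simp only [gauss]
  rw [e, e ((2 * l / Real.pi) ^ (3 / 2 : ℝ)), ← Real.exp_add, ← Real.exp_add,
    ← Real.mul_rpow (by positivity) (by positivity), ← Real.mul_rpow (by positivity) (by positivity)]
  congr 2
  · field_simp
  · linear_combination (-l) * h1

/-- The semigroup law, differentiated once in each centre. About the midpoint the integrand is a
combination of the Gaussian of parameter 2l and its derivatives; the derivatives integrate to zero,
so only the coefficient of the Gaussian itself survives. -/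
theorem integral_gauss1_mul_gauss1 {l : ℝ} (hl : 0 < l) (i j : Fin 3) (y z : E3) :
    ∫ x, gauss1 l i (x - y) * gauss1 l j (x - z) = -gauss2 (l / 2) i j (y - z) := by
  set m := (1 / 2 : ℝ) • (y + z)
  set d := y - z
  have h2l : 0 < 2 * l := by positivity
  have key : ∀ x, gauss1 l i (x - y) * gauss1 l j (x - z) =
      gauss (l / 2) d * ((1 / 4) * gauss2 (2 * l) i j (x - m) +
        (l * (if i = j then 1 else 0) - l ^ 2 * d i * d j) * gauss (2 * l) (x - m) +
        (-(l / 2) * d j) * gauss1 (2 * l) i (x - m) + (l / 2 * d i) * gauss1 (2 * l) j (x - m)) := by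
    intro x
    have e1 : x - y = (x - m) - (1 / 2 : ℝ) • d := by simp only [m, d]; module
    have e2 : x - z = (x - m) + (1 / 2 : ℝ) • d := by simp only [m, d]; module
    have h := gauss_mul_gauss hl (x - m) d
    rw [e1, e2]
    generalize x - m = w at h ⊢
    simp only [gauss1, gauss2]
    calc _ = (4 * l ^ 2 * ((w - (1 / 2 : ℝ) • d) i * (w + (1 / 2 : ℝ) • d) j)) *
          (gauss l (w - (1 / 2 : ℝ) • d) * gauss l (w + (1 / 2 : ℝ) • d)) := by ring
      _ = _ := by
        rw [h]
        simp only [PiLp.sub_apply, PiLp.add_apply, PiLp.smul_apply, smul_eq_mul]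
        ring
  simp only [key]
  rw [integral_const_mul]
  have i2 := ((integrable_gauss2 h2l i j).comp_sub_right m).const_mul (1 / 4)
  have i0 := ((integrable_gauss h2l).comp_sub_right m).const_mul
    (l * (if i = j then 1 else 0) - l ^ 2 * d i * d j)
  have i1 := ((integrable_gauss1 h2l i).comp_sub_right m).const_mul (-(l / 2) * d j)
  have i1' := ((integrable_gauss1 h2l j).comp_sub_right m).const_mul (l / 2 * d i)
  rw [integral_add (by exact (i2.add i0).add i1) i1', integral_add (by exact i2.add i0) i1, integral_add i2 i0]
  simp only [integral_const_mul]
  rw [integral_sub_right_eq_self (gauss2 (2 * l) i j), integral_sub_right_eq_self (gauss (2 * l)),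
    integral_sub_right_eq_self (gauss1 (2 * l) i), integral_sub_right_eq_self (gauss1 (2 * l) j),
    integral_gauss2 h2l, integral_gauss1 h2l, integral_gauss1 h2l, integral_gauss h2l]
  simp only [gauss2]
  ring

/-- The bridge between the two sides of the method: a product of gradients of heat flows, which the
Bellman Hessian controls, is a pairing with the kernel ∂ᵢ∂ⱼ gauss_{l/2}, out of which the Riesz
kernel is built. Fubini is applied once for each convolution. -/
theorem integral_cv_gauss1_mul {l : ℝ} (hl : 0 < l) (i j : Fin 3) {f g : E3 → ℝ} (hf : Integrable f)
    (hg : Integrable g) :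
    ∫ x, cv (gauss1 l i) f x * cv (gauss1 l j) g x =
      -∫ y, cv (gauss2 (l / 2) i j) g y * f y := by
  set C := 2 * l * (8 * (1 + 3 / l) ^ 3 * (l / Real.pi) ^ (3 / 2 : ℝ)) with hCdef
  have hb : ∀ (i : Fin 3) (z : E3), |gauss1 l i z| ≤ C := fun i =>
    bounded_of_gauss_bound hl (by positivity) (gauss1_le_weight hl i)
  have hpt : ∀ x, cv (gauss1 l i) f x * cv (gauss1 l j) g x =
      ∫ y, (cv (gauss1 l j) g x * gauss1 l i (x - y)) * f y := by
    intro x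
    rw [cv, mul_comm, ← integral_const_mul]
    simp only [mul_assoc]
  have hgm : Measurable (cv (gauss1 l j) g) := measurable_cv (continuous_gauss1 l j).measurable hg
  have hgb : ∀ x, |cv (gauss1 l j) g x| ≤ C * ∫ z, |g z| := by
    intro x
    rw [← integral_const_mul]
    refine norm_integral_le_of_norm_le (f := fun z => gauss1 l j (x - z) * g z)
      (hg.norm.const_mul C) (Eventually.of_forall fun z => ?_)
    rw [norm_mul]
    exact mul_le_mul_of_nonneg_right (hb _ _) (norm_nonneg _)
  have hprod : Integrable (Function.uncurry fun x y => (cv (gauss1 l j) g x * gauss1 l i (x - y)) * f y)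
      ((volume : Measure E3).prod volume) := by
    have h1 : Integrable (fun p : E3 × E3 => gauss1 l i (p.1 - p.2) * f p.2)
        ((volume : Measure E3).prod volume) := by
      have := (hf.convolution_integrand (ContinuousLinearMap.mul ℝ ℝ) (integrable_gauss1 hl i))
      refine this.congr (Eventually.of_forall fun p => ?_)
      simp [mul_comm]
    have h2 := h1.bdd_mul (c := C * ∫ z, |g z|) (f := fun p : E3 × E3 => cv (gauss1 l j) g p.1)
      (hgm.comp measurable_fst).aestronglyMeasurable (Eventually.of_forall fun p => hgb p.1)
    refine h2.congr (Eventually.of_forall fun p => ?_)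
    simp [Function.uncurry, mul_assoc]
  simp only [hpt]
  rw [integral_integral_swap hprod, ← integral_neg]
  congr 1
  ext y
  rw [integral_mul_const, ← neg_mul]
  congr 1
  have hpt2 : ∀ x, cv (gauss1 l j) g x * gauss1 l i (x - y) =
      ∫ z, (gauss1 l i (x - y) * gauss1 l j (x - z)) * g z := by
    intro x
    rw [cv, mul_comm, ← integral_const_mul]
    simp only [mul_assoc]
  have hprod2 : Integrable (Function.uncurry fun x z => (gauss1 l i (x - y) * gauss1 l j (x - z)) * g z)
      ((volume : Measure E3).prod volume) := by
    have h1 : Integrable (fun p : E3 × E3 => gauss1 l j (p.1 - p.2) * g p.2)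
        ((volume : Measure E3).prod volume) := by
      have := (hg.convolution_integrand (ContinuousLinearMap.mul ℝ ℝ) (integrable_gauss1 hl j))
      refine this.congr (Eventually.of_forall fun p => ?_)
      simp [mul_comm]
    have h2 := h1.bdd_mul (c := C) (f := fun p : E3 × E3 => gauss1 l i (p.1 - y))
      (by
        have := continuous_gauss1 l i
        exact Continuous.aestronglyMeasurable (by fun_prop)) (Eventually.of_forall fun p => hb i _)
    refine h2.congr (Eventually.of_forall fun p => ?_)
    simp [Function.uncurry, mul_assoc]
  simp only [hpt2]
  rw [integral_integral_swap hprod2, cv, ← integral_neg]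
  congr 1
  ext z
  rw [integral_mul_const, integral_gauss1_mul_gauss1 hl, neg_mul]

end

end NSCyl

namespace NSCyl

noncomputable section

/-! ### The heat flow of nonnegative data with compact support -/

/-- `f` is nonnegative, integrable, nontrivial and supported in the ball of radius `R`. -/
structure HeatDatum (f : E3 → ℝ) (R : ℝ) : Prop where
  integrable : Integrable f
  nonneg : ∀ y, 0 ≤ f y
  radius_nonneg : 0 ≤ R
  norm_le : ∀ y, f y ≠ 0 → ‖y‖ ≤ R
  pos : 0 < ∫ y, f y

namespace HeatDatum

variable {f : E3 → ℝ} {R : ℝ} (hf : HeatDatum f R)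
include hf

theorem heat_integrable {l : ℝ} (hl : 0 < l) (x : E3) : Integrable fun y => gauss l (x - y) * f y :=
  integrable_cv (continuous_gauss l).measurable (bounded_of_gauss_bound hl zero_le_one (gauss_le_weight hl))
    hf.integrable x

/-- The Bellman function is controlled only on the open quadrant. Strict positivity of the flow
keeps its values there, and is the reason for excluding trivial data. -/
theorem heat_pos {l : ℝ} (hl : 0 < l) (x : E3) : 0 < cv (gauss l) f x := by
  have h0 : ∀ y, 0 ≤ gauss l (x - y) * f y := fun y => mul_nonneg (gauss_pos hl _).le (hf.nonneg y)
  rw [cv, integral_pos_iff_support_of_nonneg h0 (hf.heat_integrable hl x)]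
  have h1 := hf.pos
  rw [integral_pos_iff_support_of_nonneg hf.nonneg hf.integrable] at h1
  convert h1 using 2
  ext y
  simp [(gauss_pos hl (x - y)).ne']

theorem one_add_norm_sub_le {x y : E3} (hy : f y ≠ 0) : 1 + ‖x - y‖ ≤ (1 + R) * (1 + ‖x‖) := by
  have h1 := hf.norm_le y hy
  have h2 := norm_sub_le x y
  nlinarith [norm_nonneg x, hf.radius_nonneg]

theorem one_add_norm_le {x y : E3} (hy : f y ≠ 0) : 1 + ‖x‖ ≤ (1 + R) * (1 + ‖x - y‖) := by
  have h1 := hf.norm_le y hy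
  have h2 : ‖x‖ ≤ ‖x - y‖ + ‖y‖ := by simpa using norm_add_le (x - y) y
  nlinarith [norm_nonneg (x - y), hf.radius_nonneg]

/-- Since f lives in a ball, 1 + |x - y| ≤ (1 + R)(1 + |x|) on its support. Derivatives of the flow
are thus bounded by a polynomial weight times the flow itself, the form that matches the scaled size
bounds of the Bellman function. -/
theorem abs_cv_le_heat {l : ℝ} (hl : 0 < l) {k : E3 → ℝ} {c : ℝ} (hc : 0 ≤ c) (n : ℕ)
    (h : ∀ x, |k x| ≤ c * (1 + ‖x‖) ^ n * gauss l x) (x : E3) :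
    |cv k f x| ≤ c * (1 + R) ^ n * (1 + ‖x‖) ^ n * cv (gauss l) f x := by
  have h1 : cv (fun z => c * (1 + R) ^ n * (1 + ‖x‖) ^ n * gauss l z) f x =
      c * (1 + R) ^ n * (1 + ‖x‖) ^ n * cv (gauss l) f x := by
    simp only [cv, mul_assoc, integral_const_mul]
  rw [← h1]
  refine abs_cv_le ?_ hf.nonneg fun y hy => ?_
  · simpa only [mul_assoc] using
      (hf.heat_integrable hl x).const_mul (c * (1 + R) ^ n * (1 + ‖x‖) ^ n)
  · refine (h _).trans ?_
    have := (gauss_pos hl (x - y)).le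
    have h2 := hf.one_add_norm_sub_le (x := x) hy
    calc c * (1 + ‖x - y‖) ^ n * gauss l (x - y)
        ≤ c * ((1 + R) * (1 + ‖x‖)) ^ n * gauss l (x - y) := by gcongr
      _ = _ := by rw [mul_pow]; ring

theorem heat_decay {l₀ l₁ l : ℝ} (h0 : 0 < l₀) (hl : l ∈ Icc l₀ l₁) (x : E3) :
    cv (gauss l) f x * (1 + ‖x‖) ^ 6 ≤
      8 * (1 + 3 / l₀) ^ 3 * (l₁ / Real.pi) ^ (3 / 2 : ℝ) * (1 + R) ^ 6 * ∫ y, f y := by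
  have hl0 : 0 < l := h0.trans_le hl.1
  rw [cv, ← integral_mul_const, ← integral_const_mul]
  refine integral_mono ((hf.heat_integrable hl0 x).mul_const _) (hf.integrable.const_mul _) fun y => ?_
  by_cases hy : f y = 0
  · simp [hy]
  have h1 := hf.one_add_norm_le (x := x) hy
  have h2 := gauss_decay h0 hl (x - y)
  have h3 := hf.nonneg y
  have h4 := (gauss_pos hl0 (x - y)).le
  have h5 := hf.radius_nonneg
  calc gauss l (x - y) * f y * (1 + ‖x‖) ^ 6
      ≤ gauss l (x - y) * f y * ((1 + R) * (1 + ‖x - y‖)) ^ 6 := by gcongr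
    _ = (gauss l (x - y) * (1 + ‖x - y‖) ^ 6) * ((1 + R) ^ 6 * f y) := by ring
    _ ≤ (8 * (1 + 3 / l₀) ^ 3 * (l₁ / Real.pi) ^ (3 / 2 : ℝ)) * ((1 + R) ^ 6 * f y) := by gcongr
    _ = _ := by ring

theorem heat_rpow_decay {l₀ l₁ : ℝ} (h0 : 0 < l₀) {p : ℝ} (hp : 1 ≤ p) : ∃ D : ℝ, 0 ≤ D ∧
    ∀ l ∈ Icc l₀ l₁, ∀ x, cv (gauss l) f x ^ p ≤ D * ((1 + ‖x‖) ^ 6)⁻¹ := by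
  set D := 8 * (1 + 3 / l₀) ^ 3 * (l₁ / Real.pi) ^ (3 / 2 : ℝ) * (1 + R) ^ 6 * ∫ y, f y
  refine ⟨|D| ^ p, by positivity, fun l hl x => ?_⟩
  have h1 := (hf.heat_decay h0 hl x).trans (le_abs_self D)
  have hF := (hf.heat_pos (h0.trans_le hl.1) x).le
  have hx : 1 ≤ (1 + ‖x‖) ^ 6 := one_le_pow₀ (by linarith [norm_nonneg x])
  rw [← div_eq_mul_inv, le_div_iff₀ (by positivity)]
  calc cv (gauss l) f x ^ p * (1 + ‖x‖) ^ 6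
      ≤ cv (gauss l) f x ^ p * ((1 + ‖x‖) ^ 6) ^ p := by
        gcongr
        exact Real.self_le_rpow_of_one_le hx hp
    _ = (cv (gauss l) f x * (1 + ‖x‖) ^ 6) ^ p := by rw [Real.mul_rpow hF (by positivity)]
    _ ≤ |D| ^ p := by gcongr

theorem lineDeriv_heat {l : ℝ} (hl : 0 < l) (i : Fin 3) (x : E3) :
    HasLineDerivAt ℝ (cv (gauss l) f) (cv (gauss1 l i) f x) x (bv i) :=
  hasLineDerivAt_cv (continuous_gauss l) (continuous_gauss1 l i)
    (bounded_of_gauss_bound hl zero_le_one (gauss_le_weight hl))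
    (bounded_of_gauss_bound hl (by positivity) (gauss1_le_weight hl i)) (hasLineDerivAt_gauss l i)
    hf.integrable x

theorem lineDeriv_heat1 {l : ℝ} (hl : 0 < l) (i : Fin 3) (x : E3) :
    HasLineDerivAt ℝ (cv (gauss1 l i) f) (cv (gauss2 l i i) f x) x (bv i) :=
  hasLineDerivAt_cv (continuous_gauss1 l i) (continuous_gauss2 l i i)
    (bounded_of_gauss_bound hl (by positivity) (gauss1_le_weight hl i))
    (bounded_of_gauss_bound hl (by positivity) (abs_gauss2_le hl i i)) (hasLineDerivAt_gauss1 l i i)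
    hf.integrable x

theorem cv_gaussl_eq {l : ℝ} (hl : 0 < l) (x : E3) :
    cv (gaussl l) f x = -(1 / (4 * l ^ 2)) * ∑ i, cv (gauss2 l i i) f x := by
  have h : ∀ i, Integrable fun y => gauss2 l i i (x - y) * f y := fun i =>
    integrable_cv (continuous_gauss2 l i i).measurable
      (bounded_of_gauss_bound hl (by positivity) (abs_gauss2_le hl i i)) hf.integrable x
  simp only [cv]
  rw [← integral_finsetSum _ fun i _ => h i, ← integral_const_mul]
  congr 1
  ext y
  rw [gaussl_eq hl, mul_assoc, Finset.sum_mul]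

theorem hasDerivAt_heat {l : ℝ} (hl : 0 < l) (x : E3) :
    HasDerivAt (fun r => cv (gauss r) f x) (cv (gaussl l) f x) l := by
  have hs : Ioo (l / 2) (2 * l) ∈ 𝓝 l := Ioo_mem_nhds (by linarith) (by linarith)
  have hl2 : 0 < l / 2 := by linarith
  set C := (3 / l + 1) * (8 * (1 + 3 / (l / 2)) ^ 3 * (2 * l / Real.pi) ^ (3 / 2 : ℝ))
  have hpi := Real.pi_pos
  have key := hasDerivAt_integral_of_dominated_loc_of_deriv_le (𝕜 := ℝ) (μ := (volume : Measure E3))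
    (F := fun (r : ℝ) y => gauss r (x - y) * f y) (F' := fun (r : ℝ) y => gaussl r (x - y) * f y)
    (x₀ := l) (bound := fun y => C * ‖f y‖) hs
    ?_ (hf.heat_integrable hl x) ?_ ?_ (hf.integrable.norm.const_mul C) ?_
  · exact key.2
  · filter_upwards [hs] with r hr
    exact (hf.heat_integrable (hl2.trans hr.1) x).aestronglyMeasurable
  · have := continuous_gaussl l
    exact (Continuous.aestronglyMeasurable (by fun_prop)).mul hf.integrable.aestronglyMeasurable
  · refine Eventually.of_forall fun y r hr => ?_
    have hr0 := hl2.trans hr.1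
    rw [norm_mul]
    refine mul_le_mul_of_nonneg_right ?_ (norm_nonneg _)
    refine (abs_gaussl_le hr0 _).trans ?_
    have h1 := gauss_decay hl2 (Ioo_subset_Icc_self hr) (x - y)
    have h2 : 1 ≤ 1 + ‖x - y‖ := by linarith [norm_nonneg (x - y)]
    have h3 := gauss_pos hr0 (x - y)
    calc (3 / (2 * r) + 1) * (1 + ‖x - y‖) ^ 2 * gauss r (x - y)
        = (3 / (2 * r) + 1) * (gauss r (x - y) * (1 + ‖x - y‖) ^ 2) := by ring
      _ ≤ (3 / l + 1) * (gauss r (x - y) * (1 + ‖x - y‖) ^ 6) := by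
        gcongr
        · linarith [hr.1]
        · norm_num
      _ ≤ _ := mul_le_mul_of_nonneg_left h1 (by positivity)
  · refine Eventually.of_forall fun y r hr => ?_
    exact (hasDerivAt_gauss (hl2.trans hr.1) _).mul_const _

theorem measurable_heat (l : ℝ) : Measurable (cv (gauss l) f) :=
  measurable_cv (continuous_gauss l).measurable hf.integrable

theorem measurable_heat1 (l : ℝ) (i : Fin 3) : Measurable (cv (gauss1 l i) f) :=
  measurable_cv (continuous_gauss1 l i).measurable hf.integrable

theorem measurable_heat2 (l : ℝ) (i j : Fin 3) : Measurable (cv (gauss2 l i j) f) :=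
  measurable_cv (continuous_gauss2 l i j).measurable hf.integrable

theorem measurable_heatl (l : ℝ) : Measurable (cv (gaussl l) f) :=
  measurable_cv (continuous_gaussl l).measurable hf.integrable

end HeatDatum

/-! ### Monotonicity of the Bellman functional along the heat flow -/

namespace BellmanFn

variable {p q R : ℝ} {f g : E3 → ℝ}

/-- The Bellman functional along the flow. -/
def flow (β : BellmanFn p q) (f g : E3 → ℝ) (l : ℝ) : ℝ :=
  ∫ x, β.B (cv (gauss l) f x) (cv (gauss l) g x)

/-- The Hessian of the Bellman function evaluated on the gradients of the two flows. -/
def hess (β : BellmanFn p q) (f g : E3 → ℝ) (l : ℝ) (i : Fin 3) (x : E3) : ℝ :=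
  (β.Buu (cv (gauss l) f x) (cv (gauss l) g x) * cv (gauss1 l i) f x +
    β.Buv (cv (gauss l) f x) (cv (gauss l) g x) * cv (gauss1 l i) g x) * cv (gauss1 l i) f x +
  (β.Buv (cv (gauss l) f x) (cv (gauss l) g x) * cv (gauss1 l i) f x +
    β.Bvv (cv (gauss l) f x) (cv (gauss l) g x) * cv (gauss1 l i) g x) * cv (gauss1 l i) g x

/-- A dominating function valid for a whole interval of l, as differentiation under the integral
requires: sixth-order decay against a quadratic weight leaves (1 + |x|)⁻⁴. -/
theorem exists_dominating (hp : 1 ≤ p) (hq : 1 ≤ q) (hf : HeatDatum f R) (hg : HeatDatum g R)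
    {l₀ l₁ : ℝ} (h0 : 0 < l₀) (c : ℝ) (hc : 0 ≤ c) : ∃ Φ : E3 → ℝ, Integrable Φ ∧
    ∀ l ∈ Icc l₀ l₁, ∀ x, c * (1 + ‖x‖) ^ 2 * (cv (gauss l) f x ^ p + cv (gauss l) g x ^ q) ≤ Φ x := by
  obtain ⟨D, hD0, hD⟩ := hf.heat_rpow_decay (l₁ := l₁) h0 hp
  obtain ⟨D', hD0', hD'⟩ := hg.heat_rpow_decay (l₁ := l₁) h0 hq
  refine ⟨_, integrable_one_add_norm_four.const_mul (c * (D + D')), fun l hl x => ?_⟩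
  have h1 := hD l hl x
  have h2 := hD' l hl x
  have hx : (1 + ‖x‖) ≠ 0 := by positivity
  calc c * (1 + ‖x‖) ^ 2 * (cv (gauss l) f x ^ p + cv (gauss l) g x ^ q)
      ≤ c * (1 + ‖x‖) ^ 2 * (D * ((1 + ‖x‖) ^ 6)⁻¹ + D' * ((1 + ‖x‖) ^ 6)⁻¹) := by gcongr
    _ = _ := by field_simp

theorem integrable_of_le (hp : 1 ≤ p) (hq : 1 ≤ q) (hf : HeatDatum f R) (hg : HeatDatum g R)
    {l : ℝ} (hl : 0 < l) {φ : E3 → ℝ} (hφ : Measurable φ) {c : ℝ} (hc : 0 ≤ c)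
    (h : ∀ x, |φ x| ≤ c * (1 + ‖x‖) ^ 2 * (cv (gauss l) f x ^ p + cv (gauss l) g x ^ q)) :
    Integrable φ := by
  obtain ⟨Φ, hΦ, hle⟩ := exists_dominating hp hq hf hg (l₁ := l) hl c hc
  exact hΦ.mono' hφ.aestronglyMeasurable (Eventually.of_forall fun x =>
    (h x).trans (hle l ⟨le_rfl, le_rfl⟩ x))

/-- Homogeneity bookkeeping: a derivative A of the flow costs at most a weight times the flow value
U, and this U is exactly the factor present in the size bound for the Bellman derivative X.
`second_order_le` does the same with two factors. -/
theorem first_order_le {W X A U c b C : ℝ} (hb : |X| * U ≤ C * W)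
    (hA : |A| ≤ c * b * U) (hc : 0 ≤ c) (hb0 : 0 ≤ b) : |X * A| ≤ (c * C) * b * W := by
  rw [abs_mul]
  calc |X| * |A| ≤ |X| * (c * b * U) := by gcongr
    _ = c * b * (|X| * U) := by ring
    _ ≤ c * b * (C * W) := by gcongr
    _ = _ := by ring

theorem second_order_le {W X A A' U V c b C : ℝ} (hU : 0 < U)
    (hb : |X| * (U * V) ≤ C * W) (hA : |A| ≤ c * b * U) (hA' : |A'| ≤ c * b * V) (hc : 0 ≤ c)
    (hb0 : 0 ≤ b) : |X * A * A'| ≤ (c ^ 2 * C) * b ^ 2 * W := by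
  rw [abs_mul, abs_mul]
  calc |X| * |A| * |A'| ≤ |X| * (c * b * U) * (c * b * V) := by gcongr
    _ = (c * b) ^ 2 * (|X| * (U * V)) := by ring
    _ ≤ (c * b) ^ 2 * (C * W) := by gcongr
    _ = _ := by ring

end BellmanFn

end

end NSCyl

/-! ### Differentiating the Bellman functional; the bilinear embedding. -/

namespace NSCyl

noncomputable section

namespace BellmanFn

variable {p q R : ℝ} {f g : E3 → ℝ}

theorem measurable_comp {φ : ℝ → ℝ → ℝ} (hφ : Measurable (Function.uncurry φ)) {u v : E3 → ℝ}
    (hu : Measurable u) (hv : Measurable v) : Measurable fun x => φ (u x) (v x) :=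
  hφ.comp (hu.prodMk hv)

theorem hasDerivAt_flow (β : BellmanFn p q) (hp : 1 ≤ p) (hq : 1 ≤ q) (hf : HeatDatum f R)
    (hg : HeatDatum g R) {l : ℝ} (hl : 0 < l) :
    HasDerivAt (β.flow f g)
      (∫ x, (β.Bu (cv (gauss l) f x) (cv (gauss l) g x) * cv (gaussl l) f x +
        β.Bv (cv (gauss l) f x) (cv (gauss l) g x) * cv (gaussl l) g x)) l := by
  have hs : Ioo (l / 2) (2 * l) ∈ 𝓝 l := Ioo_mem_nhds (by linarith) (by linarith)
  have hl2 : 0 < l / 2 := by linarith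
  have hR := hf.radius_nonneg
  set c := (3 / l + 1) * (1 + R) ^ 2
  have hc : 0 ≤ c := by positivity
  have hC := β.C_nonneg
  obtain ⟨Φ, hΦ, hle⟩ := exists_dominating hp hq hf hg (l₁ := 2 * l) hl2 (c * β.C + c * β.C)
    (by positivity)
  have hFl : ∀ {h : E3 → ℝ}, HeatDatum h R → ∀ r ∈ Ioo (l / 2) (2 * l), ∀ x,
      |cv (gaussl r) h x| ≤ c * (1 + ‖x‖) ^ 2 * cv (gauss r) h x := by
    intro h hh r hr x
    have hr0 := hl2.trans hr.1
    refine (hh.abs_cv_le_heat hr0 (by positivity) 2 (abs_gaussl_le hr0) x).trans ?_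
    have := (hh.heat_pos hr0 x).le
    have h2r : 3 / (2 * r) + 1 ≤ 3 / l + 1 := by
      have := hr.1
      gcongr
      linarith
    have h3 : (3 / (2 * r) + 1) * (1 + R) ^ 2 ≤ c := mul_le_mul_of_nonneg_right h2r (by positivity)
    gcongr
  exact (hasDerivAt_integral_of_dominated_loc_of_deriv_le (𝕜 := ℝ) (μ := (volume : Measure E3))
    (F := fun (r : ℝ) x => β.B (cv (gauss r) f x) (cv (gauss r) g x))
    (F' := fun (r : ℝ) x => β.Bu (cv (gauss r) f x) (cv (gauss r) g x) * cv (gaussl r) f x +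
        β.Bv (cv (gauss r) f x) (cv (gauss r) g x) * cv (gaussl r) g x)
    (x₀ := l) (bound := Φ) hs
    (Eventually.of_forall fun r => (measurable_comp β.measB (hf.measurable_heat r)
      (hg.measurable_heat r)).aestronglyMeasurable)
    (integrable_of_le hp hq hf hg hl (c := β.C) (measurable_comp β.measB (hf.measurable_heat l)
      (hg.measurable_heat l)) hC fun x => by
        have h1 := hf.heat_pos hl x
        have h2 := hg.heat_pos hl x
        rw [abs_of_nonneg (β.B_nonneg h1 h2)]
        refine (β.B_le h1 h2).trans ?_
        have : 1 ≤ (1 + ‖x‖) ^ 2 := one_le_pow₀ (by linarith [norm_nonneg x])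
        gcongr
        nlinarith)
    (((measurable_comp β.measBu (hf.measurable_heat l) (hg.measurable_heat l)).mul
      (hf.measurable_heatl l)).add
      ((measurable_comp β.measBv (hf.measurable_heat l) (hg.measurable_heat l)).mul
      (hg.measurable_heatl l))).aestronglyMeasurable
    (Eventually.of_forall fun x r hr => by
      refine le_trans ?_ (hle r (Ioo_subset_Icc_self hr) x)
      have hr0 := hl2.trans hr.1
      have h1 := hf.heat_pos hr0 x
      have h2 := hg.heat_pos hr0 x
      refine (norm_add_le _ _).trans ?_
      have e1 := first_order_le (β.Bu_le h1 h2) (hFl hf r hr x) hc (by positivity)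
      have e2 := first_order_le (β.Bv_le h1 h2) (hFl hg r hr x) hc (by positivity)
      rw [add_mul, add_mul]
      exact add_le_add e1 e2) hΦ
    (Eventually.of_forall fun x r hr => by
      have hr0 := hl2.trans hr.1
      exact β.hasDerivAt_B (hf.heat_pos hr0 x) (hg.heat_pos hr0 x) (hf.hasDerivAt_heat hr0 x)
        (hg.hasDerivAt_heat hr0 x))).2

theorem heat1_le {h : E3 → ℝ} (hh : HeatDatum h R) {l : ℝ} (hl : 0 < l) (i : Fin 3) (x : E3) :
    |cv (gauss1 l i) h x| ≤ 2 * l * (1 + R) * (1 + ‖x‖) * cv (gauss l) h x := by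
  have := hh.abs_cv_le_heat hl (c := 2 * l) (by positivity) 1 (by simpa using abs_gauss1_le hl i) x
  simpa using this

theorem heat2_le {h : E3 → ℝ} (hh : HeatDatum h R) {l : ℝ} (hl : 0 < l) (i j : Fin 3) (x : E3) :
    |cv (gauss2 l i j) h x| ≤
      (4 * l ^ 2 + 2 * l) * (1 + R) ^ 2 * (1 + ‖x‖) ^ 2 * cv (gauss l) h x :=
  hh.abs_cv_le_heat hl (by positivity) 2 (abs_gauss2_le hl i j) x

/-- The two terms of the derivative of the flow, in divergence form. -/
theorem integral_parts (hp : 1 ≤ p) (hq : 1 ≤ q) (hf : HeatDatum f R)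
    (hg : HeatDatum g R) {h : E3 → ℝ} (hh : HeatDatum h R) {l : ℝ} (hl : 0 < l) (i : Fin 3) {C : ℝ}
    (hC : 0 ≤ C) {X X₁ X₂ : ℝ → ℝ → ℝ} (mX : Measurable (Function.uncurry X))
    (mX₁ : Measurable (Function.uncurry X₁)) (mX₂ : Measurable (Function.uncurry X₂))
    (hX : ∀ x, |X (cv (gauss l) f x) (cv (gauss l) g x)| * cv (gauss l) h x ≤
      C * (cv (gauss l) f x ^ p + cv (gauss l) g x ^ q))
    (hX₁ : ∀ x, |X₁ (cv (gauss l) f x) (cv (gauss l) g x)| * (cv (gauss l) f x * cv (gauss l) h x) ≤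
      C * (cv (gauss l) f x ^ p + cv (gauss l) g x ^ q))
    (hX₂ : ∀ x, |X₂ (cv (gauss l) f x) (cv (gauss l) g x)| * (cv (gauss l) g x * cv (gauss l) h x) ≤
      C * (cv (gauss l) f x ^ p + cv (gauss l) g x ^ q))
    (hd : ∀ {U V : ℝ → ℝ} {U' V' s : ℝ}, 0 < U s → 0 < V s → HasDerivAt U U' s →
      HasDerivAt V V' s →
      HasDerivAt (fun r => X (U r) (V r)) (X₁ (U s) (V s) * U' + X₂ (U s) (V s) * V') s) :
    Integrable (fun x => X (cv (gauss l) f x) (cv (gauss l) g x) * cv (gauss2 l i i) h x) ∧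
    Integrable (fun x => (X₁ (cv (gauss l) f x) (cv (gauss l) g x) * cv (gauss1 l i) f x +
      X₂ (cv (gauss l) f x) (cv (gauss l) g x) * cv (gauss1 l i) g x) * cv (gauss1 l i) h x) ∧
    ∫ x, X (cv (gauss l) f x) (cv (gauss l) g x) * cv (gauss2 l i i) h x =
      -∫ x, (X₁ (cv (gauss l) f x) (cv (gauss l) g x) * cv (gauss1 l i) f x +
        X₂ (cv (gauss l) f x) (cv (gauss l) g x) * cv (gauss1 l i) g x) * cv (gauss1 l i) h x := by
  have hR := hf.radius_nonneg
  have mf := hf.measurable_heat l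
  have mg := hg.measurable_heat l
  have mf1 := hf.measurable_heat1 l i
  have mg1 := hg.measurable_heat1 l i
  have mh1 := hh.measurable_heat1 l i
  have i1 : Integrable (fun x => X (cv (gauss l) f x) (cv (gauss l) g x) * cv (gauss2 l i i) h x) := by
    refine integrable_of_le hp hq hf hg hl
      ((measurable_comp mX mf mg).mul (hh.measurable_heat2 l i i))
      (c := ((4 * l ^ 2 + 2 * l) * (1 + R) ^ 2) * C) (by positivity) fun x => ?_
    exact first_order_le (hX x) (heat2_le hh hl i i x) (by positivity) (by positivity)
  have i0 : Integrable (fun x => X (cv (gauss l) f x) (cv (gauss l) g x) * cv (gauss1 l i) h x) := by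
    refine integrable_of_le hp hq hf hg hl ((measurable_comp mX mf mg).mul mh1)
      (c := (2 * l * (1 + R)) * C) (by positivity) fun x => ?_
    refine first_order_le (hX x) ?_ (by positivity) (by positivity)
    refine (heat1_le hh hl i x).trans ?_
    have h1 : 1 + ‖x‖ ≤ (1 + ‖x‖) ^ 2 := le_self_pow₀ (by linarith [norm_nonneg x]) (by norm_num)
    have := (hh.heat_pos hl x).le
    gcongr
  have i2 : Integrable (fun x => (X₁ (cv (gauss l) f x) (cv (gauss l) g x) * cv (gauss1 l i) f x +
      X₂ (cv (gauss l) f x) (cv (gauss l) g x) * cv (gauss1 l i) g x) * cv (gauss1 l i) h x) := by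
    refine integrable_of_le hp hq hf hg hl
      ((((measurable_comp mX₁ mf mg).mul mf1).add ((measurable_comp mX₂ mf mg).mul mg1)).mul mh1)
      (c := (2 * l * (1 + R)) ^ 2 * C + (2 * l * (1 + R)) ^ 2 * C) (by positivity) fun x => ?_
    rw [add_mul, add_mul, add_mul]
    refine (abs_add_le _ _).trans (add_le_add ?_ ?_)
    · exact second_order_le (hf.heat_pos hl x) (hX₁ x) (heat1_le hf hl i x)
        (heat1_le hh hl i x) (by positivity) (by positivity)
    · exact second_order_le (hg.heat_pos hl x) (hX₂ x) (heat1_le hg hl i x)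
        (heat1_le hh hl i x) (by positivity) (by positivity)
  refine ⟨i1, i2, ?_⟩
  refine integral_bilinear_hasLineDerivAt_right_eq_neg_left_of_integrable
    (μ := (volume : Measure E3)) (v := bv i) (B := ContinuousLinearMap.mul ℝ ℝ)
    (f := fun x => X (cv (gauss l) f x) (cv (gauss l) g x))
    (f' := fun x => X₁ (cv (gauss l) f x) (cv (gauss l) g x) * cv (gauss1 l i) f x +
      X₂ (cv (gauss l) f x) (cv (gauss l) g x) * cv (gauss1 l i) g x)
    (g := cv (gauss1 l i) h) (g' := cv (gauss2 l i i) h) i2 i1 i0 (fun x _ => ?_)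
    (fun x _ => hh.lineDeriv_heat1 hl i x)
  have h1 : HasDerivAt (fun t : ℝ => cv (gauss l) f (x + t • bv i)) (cv (gauss1 l i) f x) 0 :=
    hf.lineDeriv_heat hl i x
  have h2 : HasDerivAt (fun t : ℝ => cv (gauss l) g (x + t • bv i)) (cv (gauss1 l i) g x) 0 :=
    hg.lineDeriv_heat hl i x
  have h3 := hd (by simpa using hf.heat_pos hl x) (by simpa using hg.heat_pos hl x) h1 h2
  simp only [zero_smul, add_zero] at h3
  exact h3

/-- The heat equation replaces ∂_l by -(1/(4l²))Δ, and one integration by parts per coordinate moves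
a derivative onto `Bu` and `Bv`. The two minus signs cancel and the Hessian form remains. -/
theorem hasDerivAt_flow' (β : BellmanFn p q) (hp : 1 ≤ p) (hq : 1 ≤ q) (hf : HeatDatum f R)
    (hg : HeatDatum g R) {l : ℝ} (hl : 0 < l) :
    (∀ i, Integrable (β.hess f g l i)) ∧
    HasDerivAt (β.flow f g) (1 / (4 * l ^ 2) * ∫ x, ∑ i, β.hess f g l i x) l := by
  have pf := fun x => hf.heat_pos hl x
  have pg := fun x => hg.heat_pos hl x
  have A := fun i => integral_parts hp hq hf hg hf hl i β.C_nonneg β.measBu β.measBuu β.measBuv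
    (fun x => β.Bu_le (pf x) (pg x)) (fun x => β.Buu_le (pf x) (pg x))
    (fun x => by rw [mul_comm (cv (gauss l) g x)]; exact β.Buv_le (pf x) (pg x)) β.hasDerivAt_Bu
  have A' := fun i => integral_parts hp hq hf hg hg hl i β.C_nonneg β.measBv β.measBuv β.measBvv
    (fun x => β.Bv_le (pf x) (pg x)) (fun x => β.Buv_le (pf x) (pg x))
    (fun x => β.Bvv_le (pf x) (pg x)) β.hasDerivAt_Bv
  have hInt : ∀ i, Integrable (β.hess f g l i) := fun i => (A i).2.1.add (A' i).2.1
  refine ⟨hInt, ?_⟩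
  refine (β.hasDerivAt_flow hp hq hf hg hl).congr_deriv ?_
  have e : ∀ x, β.Bu (cv (gauss l) f x) (cv (gauss l) g x) * cv (gaussl l) f x +
      β.Bv (cv (gauss l) f x) (cv (gauss l) g x) * cv (gaussl l) g x = -(1 / (4 * l ^ 2)) *
      ∑ i, (β.Bu (cv (gauss l) f x) (cv (gauss l) g x) * cv (gauss2 l i i) f x +
        β.Bv (cv (gauss l) f x) (cv (gauss l) g x) * cv (gauss2 l i i) g x) := by
    intro x
    rw [hf.cv_gaussl_eq hl, hg.cv_gaussl_eq hl, Finset.sum_add_distrib, ← Finset.mul_sum,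
      ← Finset.mul_sum]
    ring
  simp only [e]
  rw [integral_const_mul, integral_finsetSum _ fun i _ => by exact (A i).1.add (A' i).1,
    integral_finsetSum _ fun i _ => hInt i, neg_mul, ← mul_neg, ← Finset.sum_neg_distrib]
  congr 1
  refine Finset.sum_congr rfl fun i _ => ?_
  rw [integral_add (A i).1 (A' i).1, (A i).2.2, (A' i).2.2]
  have : ∫ x, β.hess f g l i x = _ := integral_add (A i).2.1 (A' i).2.1
  rw [this]
  ring

/-- The arithmetic-geometric inequality aX² + bY² ≥ 2√(ab)|XY| with ab ≥ 1. Summing the Hessian over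
all coordinates makes both a(∂ᵢ)² and b(∂ⱼ)² available even when i ≠ j. -/
theorem two_mul_le_hess (β : BellmanFn p q) (hf : HeatDatum f R)
    (hg : HeatDatum g R) {l : ℝ} (hl : 0 < l) (i j : Fin 3) (x : E3) :
    2 * |cv (gauss1 l i) f x * cv (gauss1 l j) g x| ≤ ∑ k, β.hess f g l k x := by
  have pf := hf.heat_pos hl x
  have pg := hg.heat_pos hl x
  set a := β.α (cv (gauss l) f x) (cv (gauss l) g x)
  set b := β.β (cv (gauss l) f x) (cv (gauss l) g x)
  have ha : 0 ≤ a := β.α_nonneg pf pg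
  have hb : 0 ≤ b := β.β_nonneg pf pg
  have hab : 1 ≤ a * b := β.one_le pf pg
  have h1 : ∀ k, a * cv (gauss1 l k) f x ^ 2 + b * cv (gauss1 l k) g x ^ 2 ≤ β.hess f g l k x := by
    intro k
    refine (β.hess_ge pf pg _ _).trans (le_of_eq ?_)
    simp only [hess]; ring
  have h2 : a * cv (gauss1 l i) f x ^ 2 ≤ ∑ k, a * cv (gauss1 l k) f x ^ 2 :=
    Finset.single_le_sum (f := fun k => a * cv (gauss1 l k) f x ^ 2) (fun k _ => by positivity)
      (Finset.mem_univ i)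
  have h3 : b * cv (gauss1 l j) g x ^ 2 ≤ ∑ k, b * cv (gauss1 l k) g x ^ 2 :=
    Finset.single_le_sum (f := fun k => b * cv (gauss1 l k) g x ^ 2) (fun k _ => by positivity)
      (Finset.mem_univ j)
  have h4 := Finset.sum_le_sum fun k (_ : k ∈ Finset.univ) => h1 k
  rw [Finset.sum_add_distrib] at h4
  refine le_trans ?_ ((add_le_add h2 h3).trans h4)
  set X := cv (gauss1 l i) f x
  set Y := cv (gauss1 l j) g x
  refine abs_le_of_sq_le_sq' (a := 2 * |X * Y|) ?_ (by positivity) |>.2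
  have h5 : (2 * |X * Y|) ^ 2 = 4 * (X ^ 2 * Y ^ 2) := by rw [mul_pow, sq_abs]; ring
  have h6 : X ^ 2 * Y ^ 2 ≤ (a * b) * (X ^ 2 * Y ^ 2) := le_mul_of_one_le_left (by positivity) hab
  rw [h5]
  nlinarith [sq_nonneg (a * X ^ 2 - b * Y ^ 2)]

/-- The bilinear embedding along the heat flow. -/
theorem abs_integral_le (β : BellmanFn p q) (hp : 1 ≤ p) (hq : 1 ≤ q) (hf : HeatDatum f R)
    (hg : HeatDatum g R) {l : ℝ} (hl : 0 < l) (i j : Fin 3) :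
    |1 / (2 * l ^ 2) * ∫ y, cv (gauss2 (l / 2) i j) g y * f y| ≤
      1 / (4 * l ^ 2) * ∫ x, ∑ k, β.hess f g l k x := by
  obtain ⟨hInt, -⟩ := β.hasDerivAt_flow' hp hq hf hg hl
  have h0 := integral_cv_gauss1_mul hl i j hf.integrable hg.integrable
  have h1 : |∫ y, cv (gauss2 (l / 2) i j) g y * f y| ≤ ∫ x, (1 / 2) * ∑ k, β.hess f g l k x := by
    rw [← abs_neg, ← h0]
    refine norm_integral_le_of_norm_le (f := fun x => cv (gauss1 l i) f x * cv (gauss1 l j) g x)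
      ((integrable_finsetSum _ fun k _ => hInt k).const_mul _)
      (Eventually.of_forall fun x => ?_)
    have := β.two_mul_le_hess hf hg hl i j x
    rw [Real.norm_eq_abs]
    linarith
  rw [abs_mul, abs_of_pos (by positivity)]
  rw [integral_const_mul] at h1
  calc _ ≤ 1 / (2 * l ^ 2) * (1 / 2 * ∫ x, ∑ k, β.hess f g l k x) := by gcongr
    _ = _ := by field_simp; ring

end BellmanFn

end

end NSCyl

namespace NSCyl

noncomputable section

/-! ### Schur's test -/

/-- Hölder's inequality after the splitting k = k^(1/q) k^(1/p), with q the conjugate exponent. -/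
theorem lintegral_rpow_le {Y : Type*} [MeasurableSpace Y] {ν : Measure Y} {k f : Y → ℝ≥0∞}
    (hk : Measurable k) (hf : Measurable f) {M : ℝ≥0∞} (hM : ∫⁻ y, k y ∂ν ≤ M) {p : ℝ} (hp : 1 < p) :
    (∫⁻ y, k y * f y ∂ν) ^ p ≤ M ^ (p - 1) * ∫⁻ y, k y * f y ^ p ∂ν := by
  have hpq := Real.HolderConjugate.conjExponent hp
  set q := p.conjExponent
  have hp0 : 0 < p := by linarith
  have hq0 : 0 < q := hpq.symm.pos
  have h1 : ∀ y, k y * f y = k y ^ (1 / q) * (k y ^ (1 / p) * f y) := by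
    intro y
    rw [← mul_assoc, ← ENNReal.rpow_add_of_nonneg _ _ (by positivity) (by positivity)]
    have : 1 / q + 1 / p = 1 := by
      have := hpq.inv_add_inv_eq_one
      rw [one_div, one_div]; linarith
    rw [this, ENNReal.rpow_one]
  have h2 := ENNReal.lintegral_mul_le_Lp_mul_Lq ν hpq.symm (f := fun y => k y ^ (1 / q))
    (g := fun y => k y ^ (1 / p) * f y) (by fun_prop) (by fun_prop)
  simp only [Pi.mul_apply, ← h1] at h2
  have h3 : ∀ y, (k y ^ (1 / q)) ^ q = k y := fun y => by
    rw [← ENNReal.rpow_mul, one_div_mul_cancel hq0.ne', ENNReal.rpow_one]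
  have h4 : ∀ y, (k y ^ (1 / p) * f y) ^ p = k y * f y ^ p := fun y => by
    rw [ENNReal.mul_rpow_of_nonneg _ _ hp0.le, ← ENNReal.rpow_mul, one_div_mul_cancel hp0.ne',
      ENNReal.rpow_one]
  simp only [h3, h4] at h2
  calc (∫⁻ y, k y * f y ∂ν) ^ p
      ≤ ((∫⁻ y, k y ∂ν) ^ (1 / q) * (∫⁻ y, k y * f y ^ p ∂ν) ^ (1 / p)) ^ p := by gcongr
    _ = (∫⁻ y, k y ∂ν) ^ (p - 1) * ∫⁻ y, k y * f y ^ p ∂ν := by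
      rw [ENNReal.mul_rpow_of_nonneg _ _ hp0.le, ← ENNReal.rpow_mul, ← ENNReal.rpow_mul,
        one_div_mul_cancel hp0.ne', ENNReal.rpow_one]
      congr 2
      have h5 := hpq.sub_one_mul_conj
      field_simp
      linarith
    _ ≤ _ := by
      gcongr

theorem schur_test {X Y : Type*} [MeasurableSpace X] [MeasurableSpace Y] {μ : Measure X}
    {ν : Measure Y} [SFinite μ] [SFinite ν] {k : X → Y → ℝ≥0∞} (hk : Measurable (Function.uncurry k))
    {f : Y → ℝ≥0∞} (hf : Measurable f) {M : ℝ≥0∞} (hM : ∀ x, ∫⁻ y, k x y ∂ν ≤ M)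
    (hM' : ∀ y, ∫⁻ x, k x y ∂μ ≤ M) {p : ℝ} (hp : 1 < p) :
    ∫⁻ x, (∫⁻ y, k x y * f y ∂ν) ^ p ∂μ ≤ M ^ p * ∫⁻ y, f y ^ p ∂ν := by
  have hky : ∀ x, Measurable (k x) := fun x => hk.comp measurable_prodMk_left
  have hkx : ∀ y, Measurable fun x => k x y := fun y => hk.comp measurable_prodMk_right
  have hm : Measurable (Function.uncurry fun x y => k x y * f y ^ p) :=
    hk.mul ((hf.comp measurable_snd).pow_const p)
  calc ∫⁻ x, (∫⁻ y, k x y * f y ∂ν) ^ p ∂μ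
      ≤ ∫⁻ x, M ^ (p - 1) * ∫⁻ y, k x y * f y ^ p ∂ν ∂μ :=
        lintegral_mono fun x => lintegral_rpow_le (hky x) hf (hM x) hp
    _ = M ^ (p - 1) * ∫⁻ x, ∫⁻ y, k x y * f y ^ p ∂ν ∂μ :=
        lintegral_const_mul _ hm.lintegral_prod_right
    _ = M ^ (p - 1) * ∫⁻ y, ∫⁻ x, k x y * f y ^ p ∂μ ∂ν := by
        rw [lintegral_lintegral_swap hm.aemeasurable]
    _ = M ^ (p - 1) * ∫⁻ y, (∫⁻ x, k x y ∂μ) * f y ^ p ∂ν := by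
        simp only [lintegral_mul_const _ (hkx _)]
    _ ≤ M ^ (p - 1) * ∫⁻ y, M * f y ^ p ∂ν := by
        gcongr with y
        exact hM' y
    _ = M ^ p * ∫⁻ y, f y ^ p ∂ν := by
        rw [lintegral_const_mul _ (by fun_prop), ← mul_assoc]
        congr 1
        nth_rw 2 [← ENNReal.rpow_one M]
        rw [← ENNReal.rpow_add_of_nonneg _ _ (by linarith) zero_le_one]
        congr 1; ring

/-- The Gaussian has mass 1 in either variable, so Schur's test holds with constant 1. The exact
contraction makes the bound on the Bellman functional independent of l. -/
theorem integral_heat_rpow_le {f : E3 → ℝ} {R : ℝ} (hf : HeatDatum f R) {l p : ℝ} (hl : 0 < l)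
    (hp : 1 < p) (hfp : Integrable fun x => f x ^ p) :
    Integrable (fun x => cv (gauss l) f x ^ p) ∧
    ∫ x, cv (gauss l) f x ^ p ≤ ∫ x, f x ^ p := by
  have hp0 : 0 ≤ p := by linarith
  have h1 : ∀ x, ENNReal.ofReal (cv (gauss l) f x) =
      ∫⁻ y, ENNReal.ofReal (gauss l (x - y)) * ENNReal.ofReal (f y) := by
    intro x
    rw [cv, ofReal_integral_eq_lintegral_ofReal (hf.heat_integrable hl x)
      (Eventually.of_forall fun y => mul_nonneg (gauss_pos hl _).le (hf.nonneg y))]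
    simp only [ENNReal.ofReal_mul (gauss_pos hl _).le]
  obtain ⟨g, hg, hfg⟩ := hf.integrable.aestronglyMeasurable.aemeasurable
  have h2 : ∀ x, ENNReal.ofReal (cv (gauss l) f x) =
      ∫⁻ y, ENNReal.ofReal (gauss l (x - y)) * ENNReal.ofReal (g y) := by
    intro x
    rw [h1]
    exact lintegral_congr_ae (hfg.mono fun y hy => by simp only [hy])
  have hone : ∫⁻ x : E3, ENNReal.ofReal (gauss l x) = 1 := by
    rw [← ofReal_integral_eq_lintegral_ofReal (integrable_gauss hl)
      (Eventually.of_forall fun y => (gauss_pos hl _).le), integral_gauss hl, ENNReal.ofReal_one]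
  have hgm := (continuous_gauss l).measurable
  have h3 := schur_test (μ := (volume : Measure E3)) (ν := (volume : Measure E3))
    (k := fun x y => ENNReal.ofReal (gauss l (x - y))) (f := fun y => ENNReal.ofReal (g y)) (M := 1)
    (by simp only [Function.uncurry_def]; fun_prop) (by fun_prop)
    (fun x => by rw [lintegral_sub_left_eq_self (fun z => ENNReal.ofReal (gauss l z)), hone])
    (fun y => by rw [lintegral_sub_right_eq_self (fun z => ENNReal.ofReal (gauss l z)), hone]) hp
  simp only [← h2] at h3
  have h4 : ∫⁻ y, ENNReal.ofReal (g y) ^ p = ENNReal.ofReal (∫ y, f y ^ p) := by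
    rw [ofReal_integral_eq_lintegral_ofReal hfp
      (Eventually.of_forall fun y => Real.rpow_nonneg (hf.nonneg y) p)]
    refine lintegral_congr_ae (hfg.mono fun y hy => ?_)
    simp only [← hy]
    rw [ENNReal.ofReal_rpow_of_nonneg (hf.nonneg y) hp0]
  have h5 : ∀ x, ENNReal.ofReal (cv (gauss l) f x) ^ p = ENNReal.ofReal (cv (gauss l) f x ^ p) :=
    fun x => ENNReal.ofReal_rpow_of_nonneg (hf.heat_pos hl x).le hp0
  simp only [h5, h4, ENNReal.one_rpow, one_mul] at h3
  have hnn : ∀ x, 0 ≤ cv (gauss l) f x ^ p := fun x => Real.rpow_nonneg (hf.heat_pos hl x).le p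
  have hInt : Integrable (fun x => cv (gauss l) f x ^ p) := by
    refine ⟨((hf.measurable_heat l).pow_const p).aestronglyMeasurable, ?_⟩
    rw [hasFiniteIntegral_iff_ofReal (Eventually.of_forall hnn)]
    exact h3.trans_lt ENNReal.ofReal_lt_top
  refine ⟨hInt, ?_⟩
  rw [← ofReal_integral_eq_lintegral_ofReal hInt (Eventually.of_forall hnn)] at h3
  exact (ENNReal.ofReal_le_ofReal_iff
    (integral_nonneg fun y => Real.rpow_nonneg (hf.nonneg y) p)).1 h3

/-! ### The regularized Riesz kernels -/

/-- The integrand of the regularized Riesz kernel. -/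
def rieszDens (i j : Fin 3) (l : ℝ) (x : E3) : ℝ := 1 / (2 * l ^ 2) * gauss2 (l / 2) i j x

/-- The kernel `∂ᵢ ∂ⱼ (-Δ)⁻¹`, regularized by cutting off large and small frequencies. -/
def riesz (l₀ l₁ : ℝ) (i j : Fin 3) (x : E3) : ℝ := ∫ l in Ioc l₀ l₁, rieszDens i j l x

theorem measurable_rieszDens (i j : Fin 3) :
    Measurable (Function.uncurry (rieszDens i j)) := by
  simp only [Function.uncurry_def, rieszDens, gauss2, gauss]
  fun_prop

theorem measurable_riesz (l₀ l₁ : ℝ) (i j : Fin 3) : Measurable (riesz l₀ l₁ i j) := by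
  have h : StronglyMeasurable (Function.uncurry fun x l => rieszDens i j l x) :=
    ((measurable_rieszDens i j).comp measurable_swap).stronglyMeasurable
  exact (h.integral_prod_right (ν := volume.restrict (Ioc l₀ l₁))).measurable

theorem rieszDens_bound {l₀ l₁ : ℝ} (h0 : 0 < l₀) (i j : Fin 3) :
    ∃ C : ℝ, 0 ≤ C ∧ ∀ l ∈ Ioc l₀ l₁, ∀ x, |rieszDens i j l x| ≤ C := by
  have hpi := Real.pi_pos
  refine ⟨|1 / (2 * l₀ ^ 2) * ((4 * (l₁ / 2) ^ 2 + 2 * (l₁ / 2)) *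
    (8 * (1 + 3 / (l₀ / 2)) ^ 3 * (l₁ / 2 / Real.pi) ^ (3 / 2 : ℝ)))|, abs_nonneg _, fun l hl x => ?_⟩
  have hl0 : 0 < l := h0.trans hl.1
  have h1 := abs_gauss2_le (half_pos hl0) i j x
  have h2 := gauss_decay (l₀ := l₀ / 2) (l₁ := l₁ / 2) (l := l / 2) (half_pos h0)
    ⟨by linarith [hl.1], by linarith [hl.2]⟩ x
  have h3 : 1 ≤ 1 + ‖x‖ := by linarith [norm_nonneg x]
  have h4 := gauss_pos (half_pos hl0) x
  have h5 := hl.2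
  have h6 := hl.1.le
  have hl1 : 0 < l₁ := hl0.trans_le h5
  refine le_trans ?_ (le_abs_self _)
  rw [rieszDens, abs_mul, abs_of_pos (by positivity)]
  have h7 : gauss (l / 2) x * (1 + ‖x‖) ^ 2 ≤ gauss (l / 2) x * (1 + ‖x‖) ^ 6 := by
    gcongr; norm_num
  have h8 : |gauss2 (l / 2) i j x| ≤ (4 * (l₁ / 2) ^ 2 + 2 * (l₁ / 2)) *
      (8 * (1 + 3 / (l₀ / 2)) ^ 3 * (l₁ / 2 / Real.pi) ^ (3 / 2 : ℝ)) := by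
    refine h1.trans ?_
    rw [mul_assoc, mul_comm ((1 + ‖x‖) ^ 2)]
    have h9 := h7.trans h2
    have h10 : 4 * (l / 2) ^ 2 + 2 * (l / 2) ≤ 4 * (l₁ / 2) ^ 2 + 2 * (l₁ / 2) := by gcongr
    exact mul_le_mul h10 h9 (by positivity) (by positivity)
  gcongr

theorem riesz_bound {l₀ l₁ : ℝ} (h0 : 0 < l₀) (i j : Fin 3) :
    ∃ C : ℝ, ∀ x, |riesz l₀ l₁ i j x| ≤ C := by
  obtain ⟨C, hC0, hC⟩ := rieszDens_bound (l₁ := l₁) h0 i j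
  refine ⟨C * volume.real (Ioc l₀ l₁), fun x => ?_⟩
  exact norm_setIntegral_le_of_norm_le_const (f := fun l => rieszDens i j l x) measure_Ioc_lt_top
    fun l hl => hC l hl x

/-- Fubini on (l₀, l₁] × ℝ³ × ℝ³. It is legitimate because the cutoffs make the kernel bounded and
f(y)g(z) is integrable. -/
theorem integral_rieszDens {f g : E3 → ℝ} (hf : Integrable f) (hg : Integrable g) {l₀ l₁ : ℝ}
    (h0 : 0 < l₀) (i j : Fin 3) :
    IntegrableOn (fun l => 1 / (2 * l ^ 2) * ∫ y, cv (gauss2 (l / 2) i j) g y * f y) (Ioc l₀ l₁) ∧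
    ∫ l in Ioc l₀ l₁, 1 / (2 * l ^ 2) * ∫ y, cv (gauss2 (l / 2) i j) g y * f y =
      ∫ y, cv (riesz l₀ l₁ i j) g y * f y := by
  obtain ⟨C, hC0, hC⟩ := rieszDens_bound (l₁ := l₁) h0 i j
  have hφ : Integrable (fun z : E3 × E3 => f z.1 * g z.2) := hf.mul_prod hg
  have hsub : Measurable fun z : E3 × E3 => z.1 - z.2 := measurable_fst.sub measurable_snd
  have e1 : ∀ l ∈ Ioc l₀ l₁, 1 / (2 * l ^ 2) * ∫ y, cv (gauss2 (l / 2) i j) g y * f y =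
      ∫ z : E3 × E3, rieszDens i j l (z.1 - z.2) * (f z.1 * g z.2) := by
    intro l hl
    have hi : Integrable (fun z : E3 × E3 => rieszDens i j l (z.1 - z.2) * (f z.1 * g z.2)) :=
      hφ.bdd_mul (c := C) (((measurable_rieszDens i j).comp
        (measurable_const.prodMk hsub)).aestronglyMeasurable)
        (Eventually.of_forall fun z => hC l hl _)
    rw [Measure.volume_eq_prod] at hi ⊢
    rw [integral_prod _ hi, ← integral_const_mul]
    congr 1
    ext y
    rw [cv, ← integral_mul_const, ← integral_const_mul]
    congr 1
    ext z
    simp only [rieszDens]; ring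
  have e2 : ∫ y, cv (riesz l₀ l₁ i j) g y * f y =
      ∫ z : E3 × E3, riesz l₀ l₁ i j (z.1 - z.2) * (f z.1 * g z.2) := by
    obtain ⟨C', hC'⟩ := riesz_bound (l₁ := l₁) h0 i j
    have hi : Integrable (fun z : E3 × E3 => riesz l₀ l₁ i j (z.1 - z.2) * (f z.1 * g z.2)) :=
      hφ.bdd_mul (c := C') (((measurable_riesz l₀ l₁ i j).comp hsub).aestronglyMeasurable)
        (Eventually.of_forall fun z => hC' _)
    rw [Measure.volume_eq_prod] at hi ⊢
    rw [integral_prod _ hi]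
    congr 1
    ext y
    rw [cv, ← integral_mul_const]
    congr 1
    ext z
    ring
  have hI : Integrable (Function.uncurry fun (l : ℝ) (z : E3 × E3) =>
      rieszDens i j l (z.1 - z.2) * (f z.1 * g z.2))
      ((volume.restrict (Ioc l₀ l₁)).prod volume) := by
    have h1 : Integrable (fun w : ℝ × (E3 × E3) => f w.2.1 * g w.2.2)
        ((volume.restrict (Ioc l₀ l₁)).prod volume) := hφ.comp_snd _
    refine h1.bdd_mul (c := C) (f := fun w : ℝ × (E3 × E3) => rieszDens i j w.1 (w.2.1 - w.2.2))
      (((measurable_rieszDens i j).comp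
        (measurable_fst.prodMk (hsub.comp measurable_snd))).aestronglyMeasurable) ?_
    have : ∀ᵐ w ∂((volume.restrict (Ioc l₀ l₁)).prod (volume : Measure (E3 × E3))), w.1 ∈ Ioc l₀ l₁ :=
      Measure.quasiMeasurePreserving_fst.ae (ae_restrict_mem measurableSet_Ioc)
    filter_upwards [this] with w hw using hC _ hw _
  constructor
  · refine (hI.integral_prod_left).congr ?_
    filter_upwards [ae_restrict_mem measurableSet_Ioc] with l hl
    exact (e1 l hl).symm
  · rw [e2, setIntegral_congr_fun measurableSet_Ioc e1, integral_integral_swap hI]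
    congr 1
    ext z
    rw [integral_mul_const]
    rfl

end

end NSCyl

namespace NSCyl

noncomputable section

/-! ### Uniform bounds for the regularized Riesz transforms -/

theorem BellmanFn.flow_nonneg {p q R : ℝ} (β : BellmanFn p q) {f g : E3 → ℝ} (hf : HeatDatum f R)
    (hg : HeatDatum g R) {l : ℝ} (hl : 0 < l) : 0 ≤ β.flow f g l :=
  integral_nonneg fun x => β.B_nonneg (hf.heat_pos hl x) (hg.heat_pos hl x)

theorem BellmanFn.flow_le {p q R : ℝ} (β : BellmanFn p q) (hp : 1 < p) (hq : 1 < q) {f g : E3 → ℝ}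
    (hf : HeatDatum f R) (hg : HeatDatum g R) (hfp : Integrable fun x => f x ^ p)
    (hgq : Integrable fun x => g x ^ q) {l : ℝ} (hl : 0 < l) :
    β.flow f g l ≤ β.C * ((∫ x, f x ^ p) + ∫ x, g x ^ q) := by
  obtain ⟨h1, h1'⟩ := integral_heat_rpow_le hf hl hp hfp
  obtain ⟨h2, h2'⟩ := integral_heat_rpow_le hg hl hq hgq
  have h3 : β.flow f g l ≤ ∫ x, β.C * (cv (gauss l) f x ^ p + cv (gauss l) g x ^ q) :=
    integral_mono_of_nonneg
      (Eventually.of_forall fun x => β.B_nonneg (hf.heat_pos hl x) (hg.heat_pos hl x))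
      ((h1.add h2).const_mul _)
      (Eventually.of_forall fun x => β.B_le (hf.heat_pos hl x) (hg.heat_pos hl x))
  rw [integral_const_mul, integral_add h1 h2] at h3
  have := β.C_nonneg
  refine h3.trans ?_
  gcongr

/-- At each level l the pairing is dominated by the l-derivative of the Bellman functional. Its
integral is the increment of the functional, which is at most the value at l₁ since the value at l₀
is nonnegative; neither cutoff enters the final constant. -/
theorem BellmanFn.abs_integral_riesz_le {p q R : ℝ} (β : BellmanFn p q) (hp : 1 < p) (hq : 1 < q)
    {f g : E3 → ℝ} (hf : HeatDatum f R) (hg : HeatDatum g R) (hfp : Integrable fun x => f x ^ p)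
    (hgq : Integrable fun x => g x ^ q) {l₀ l₁ : ℝ} (h0 : 0 < l₀) (h01 : l₀ ≤ l₁) (i j : Fin 3) :
    |∫ y, cv (riesz l₀ l₁ i j) g y * f y| ≤ β.C * ((∫ x, f x ^ p) + ∫ x, g x ^ q) := by
  obtain ⟨hInt, heq⟩ := integral_rieszDens hf.integrable hg.integrable (l₁ := l₁) h0 i j
  have hd : ∀ l ∈ Icc l₀ l₁, HasDerivAt (β.flow f g) (1 / (4 * l ^ 2) * ∫ x, ∑ i, β.hess f g l i x) l :=
    fun l hl => (β.hasDerivAt_flow' hp.le hq.le hf hg (h0.trans_le hl.1)).2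
  have hle : β.flow f g l₁ - β.flow f g l₀ ≤ β.C * ((∫ x, f x ^ p) + ∫ x, g x ^ q) := by
    have h1 := β.flow_le hp hq hf hg hfp hgq (h0.trans_le h01)
    have h2 := β.flow_nonneg hf hg h0
    linarith
  -- A one-sided form of the fundamental theorem, asking integrability of φ only and not of the
  -- derivative of the functional. It is applied to the pairing and to its negative.
  have key : ∀ φ : ℝ → ℝ, IntegrableOn φ (Ioc l₀ l₁) →
      (∀ l, 0 < l → φ l ≤ 1 / (4 * l ^ 2) * ∫ x, ∑ i, β.hess f g l i x) →
      ∫ l in Ioc l₀ l₁, φ l ≤ β.C * ((∫ x, f x ^ p) + ∫ x, g x ^ q) := by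
    intro φ hφ hφle
    refine le_trans ?_ hle
    rw [← intervalIntegral.integral_of_le h01]
    exact intervalIntegral.integral_le_sub_of_hasDeriv_right_of_le h01
      (fun l hl => (hd l hl).continuousAt.continuousWithinAt)
      (fun l hl => (hd l (Ioo_subset_Icc_self hl)).hasDerivWithinAt)
      ((integrableOn_Icc_iff_integrableOn_Ioc (by simp)).2 hφ)
      (fun l hl => hφle l (h0.trans hl.1))
  have h1 := key _ hInt fun l hl =>
    (le_abs_self _).trans (β.abs_integral_le hp.le hq.le hf hg hl i j)
  have h2 := key _ hInt.neg fun l hl =>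
    (neg_le_abs _).trans (β.abs_integral_le hp.le hq.le hf hg hl i j)
  rw [heq] at h1
  simp only [Pi.neg_apply] at h2
  rw [integral_neg, heq] at h2
  exact abs_le'.2 ⟨h1, h2⟩

theorem gauss2_comm (l : ℝ) (i j : Fin 3) : gauss2 l i j = gauss2 l j i := by
  ext x
  simp only [gauss2, eq_comm (a := i)]
  ring

/-- At each level l both pairings are integrals of products of first derivatives, and exchanging f
with g only exchanges i with j. This symmetry lets the exponents p and q trade places. -/
theorem integral_cv_riesz_comm {f g : E3 → ℝ} (hf : Integrable f) (hg : Integrable g) {l₀ l₁ : ℝ}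
    (h0 : 0 < l₀) (i j : Fin 3) :
    ∫ y, cv (riesz l₀ l₁ i j) g y * f y = ∫ y, cv (riesz l₀ l₁ i j) f y * g y := by
  rw [← (integral_rieszDens hf hg h0 i j).2, ← (integral_rieszDens hg hf h0 i j).2]
  refine setIntegral_congr_fun measurableSet_Ioc fun l hl => ?_
  have hl0 : 0 < l := h0.trans hl.1
  have h1 := integral_cv_gauss1_mul hl0 i j hf hg
  have h2 := integral_cv_gauss1_mul hl0 j i hg hf
  simp only [mul_comm (cv (gauss1 l j) g _)] at h2
  rw [h1, neg_inj, gauss2_comm _ j i] at h2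
  simp only [h2]

/-- The bilinear estimate for nonnegative functions with bounded support. -/
theorem exists_bilinear_bound {p q : ℝ} (hpq : p.HolderConjugate q) : ∃ C : ℝ, 0 ≤ C ∧
    ∀ (R : ℝ) (f g : E3 → ℝ), Integrable f → Integrable g → (∀ y, 0 ≤ f y) → (∀ y, 0 ≤ g y) →
    (∀ y, f y ≠ 0 → ‖y‖ ≤ R) → (∀ y, g y ≠ 0 → ‖y‖ ≤ R) →
    Integrable (fun x => f x ^ p) → Integrable (fun x => g x ^ q) →
    ∀ (l₀ l₁ : ℝ), 0 < l₀ → l₀ ≤ l₁ → ∀ i j,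
    |∫ y, cv (riesz l₀ l₁ i j) f y * g y| ≤ C * ((∫ x, f x ^ p) + ∫ x, g x ^ q) := by
  -- The Bellman function is available only when its first exponent is at least 2. One of p, q
  -- always is, and the other case follows by symmetry.
  have main : ∀ {p q : ℝ}, 2 ≤ p → p.HolderConjugate q → ∃ C : ℝ, 0 ≤ C ∧
    ∀ (R : ℝ) (f g : E3 → ℝ), Integrable f → Integrable g → (∀ y, 0 ≤ f y) → (∀ y, 0 ≤ g y) →
    (∀ y, f y ≠ 0 → ‖y‖ ≤ R) → (∀ y, g y ≠ 0 → ‖y‖ ≤ R) →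
    Integrable (fun x => f x ^ p) → Integrable (fun x => g x ^ q) →
    ∀ (l₀ l₁ : ℝ), 0 < l₀ → l₀ ≤ l₁ → ∀ i j,
    |∫ y, cv (riesz l₀ l₁ i j) g y * f y| ≤ C * ((∫ x, f x ^ p) + ∫ x, g x ^ q) := by
    intro p q hp hpq
    obtain ⟨β⟩ := exists_bellmanFn hp hpq
    refine ⟨β.C, β.C_nonneg, fun R f g hf hg f0 g0 fR gR hfp hgq l₀ l₁ h0 h01 i j => ?_⟩
    have hnn : 0 ≤ β.C * ((∫ x, f x ^ p) + ∫ x, g x ^ q) :=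
      mul_nonneg β.C_nonneg (add_nonneg (integral_nonneg fun x => Real.rpow_nonneg (f0 x) p)
        (integral_nonneg fun x => Real.rpow_nonneg (g0 x) q))
    -- Almost everywhere vanishing data are not a `HeatDatum`; for them the pairing is zero.
    rcases (integral_nonneg (μ := (volume : Measure E3)) (f := f) (fun y => f0 y)).eq_or_lt with hz | hfpos
    · have h1 := (integral_eq_zero_iff_of_nonneg f0 hf).1 hz.symm
      have h2 : ∫ y, cv (riesz l₀ l₁ i j) g y * f y = 0 :=
        integral_eq_zero_of_ae (h1.mono fun y hy => by simp [hy])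
      rwa [h2, abs_zero]
    rcases (integral_nonneg (μ := (volume : Measure E3)) (f := g) (fun y => g0 y)).eq_or_lt with hz | hgpos
    · have h1 := (integral_eq_zero_iff_of_nonneg g0 hg).1 hz.symm
      have h2 : ∫ y, cv (riesz l₀ l₁ i j) g y * f y = 0 := by
        rw [integral_cv_riesz_comm hf hg h0]
        exact integral_eq_zero_of_ae (h1.mono fun y hy => by simp [hy])
      rwa [h2, abs_zero]
    have df : HeatDatum f (max R 0) := ⟨hf, f0, le_max_right _ _,
      fun y hy => (fR y hy).trans (le_max_left _ _), hfpos⟩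
    have dg : HeatDatum g (max R 0) := ⟨hg, g0, le_max_right _ _,
      fun y hy => (gR y hy).trans (le_max_left _ _), hgpos⟩
    exact β.abs_integral_riesz_le hpq.lt hpq.symm.lt df dg hfp hgq h0 h01 i j
  rcases le_total 2 p with hp | hp
  · obtain ⟨C, hC, h⟩ := main hp hpq
    refine ⟨C, hC, fun R f g hf hg f0 g0 fR gR hfp hgq l₀ l₁ h0 h01 i j => ?_⟩
    rw [← integral_cv_riesz_comm hf hg h0]
    exact h R f g hf hg f0 g0 fR gR hfp hgq l₀ l₁ h0 h01 i j
  · have hq : 2 ≤ q := by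
      have h1 := hpq.mul_eq_add
      have h2 := hpq.lt
      nlinarith
    obtain ⟨C, hC, h⟩ := main hq hpq.symm
    refine ⟨C, hC, fun R f g hf hg f0 g0 fR gR hfp hgq l₀ l₁ h0 h01 i j => ?_⟩
    rw [add_comm]
    exact h R g f hg hf g0 f0 gR fR hgq hfp l₀ l₁ h0 h01 i j

theorem abs_cv_riesz_bounded {l₀ l₁ : ℝ} (h0 : 0 < l₀) (i j : Fin 3) {f : E3 → ℝ} (hf : Integrable f) :
    ∃ C : ℝ, ∀ x, |cv (riesz l₀ l₁ i j) f x| ≤ C := by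
  obtain ⟨C, hC⟩ := riesz_bound (l₁ := l₁) h0 i j
  refine ⟨∫ y, C * |f y|, fun x => ?_⟩
  refine norm_integral_le_of_norm_le (f := fun y => riesz l₀ l₁ i j (x - y) * f y)
    (hf.norm.const_mul C) (Eventually.of_forall fun y => ?_)
  rw [norm_mul]
  exact mul_le_mul_of_nonneg_right (hC _) (norm_nonneg _)

/-- The test function is g = δP^(p-1) with P the positive part of T on S, so that Tg = δP^p and g^q
= δ^q P^p. The hypothesis bounds a pairing by a sum rather than a product of norms, and a small δ
lets the g-term be absorbed. The absorption is meaningful because T is bounded above and S has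
finite measure, so ∫P^p is finite. -/
theorem integral_rpow_duality {p q C D : ℝ} (hpq : p.HolderConjugate q) (hC : 0 ≤ C)
    {S : Set E3} (hS : MeasurableSet S) (hSv : volume S < ⊤) {T : E3 → ℝ} (hT : Measurable T)
    {b : ℝ} (hb : ∀ x, T x ≤ b)
    (h : ∀ g : E3 → ℝ, Integrable g → (∀ y, 0 ≤ g y) → (∀ y, g y ≠ 0 → y ∈ S) →
      Integrable (fun x => g x ^ q) → ∫ y, T y * g y ≤ C * (D + ∫ x, g x ^ q)) :
    ∫ x in S, max (T x) 0 ^ p ≤ 2 * C * (2 * C + 2) ^ (1 / (q - 1)) * D := by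
  have hp := hpq.lt
  have hp0 := hpq.pos
  have hq := hpq.symm.lt
  have hb0 : ∀ x, max (T x) 0 ≤ max b 0 := fun x => max_le_max (hb x) le_rfl
  set P : E3 → ℝ := S.indicator fun x => max (T x) 0
  have hP0 : ∀ x, 0 ≤ P x := fun x => indicator_nonneg (fun y _ => le_max_right _ _) x
  have hPm : Measurable P := (hT.max measurable_const).indicator hS
  have hPint : ∀ r : ℝ, 0 < r → Integrable fun x => P x ^ r := by
    intro r hr
    have : (fun x => P x ^ r) = S.indicator fun x => max (T x) 0 ^ r := by
      ext x
      by_cases hx : x ∈ S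
      · simp [P, hx]
      · simp [P, hx, Real.zero_rpow hr.ne']
    rw [this, integrable_indicator_iff hS]
    refine Measure.integrableOn_of_bounded (M := max b 0 ^ r) hSv.ne
      ((hT.max measurable_const).pow_const r).aestronglyMeasurable (Eventually.of_forall fun x => ?_)
    rw [Real.norm_of_nonneg (Real.rpow_nonneg (le_max_right _ _) _)]
    exact Real.rpow_le_rpow (le_max_right _ _) (hb0 x) hr.le
  set X := ∫ x, P x ^ p
  have hX : ∫ x in S, max (T x) 0 ^ p = X := by
    rw [← integral_indicator hS]
    congr 1
    ext x
    by_cases hx : x ∈ S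
    · simp [P, hx]
    · simp [P, hx, Real.zero_rpow hp0.ne']
  have hX0 : 0 ≤ X := integral_nonneg fun x => Real.rpow_nonneg (hP0 x) p
  -- Chosen so that δ^(q-1) = 1/(2C + 2), hence Cδ^q ≤ δ/2; the summand 2 avoids division by zero
  -- when C = 0.
  set δ : ℝ := (1 / (2 * C + 2)) ^ (1 / (q - 1))
  have hδ0 : 0 < δ := by positivity
  have hq1 : q - 1 ≠ 0 := by linarith
  have hδ : δ ^ (q - 1) = 1 / (2 * C + 2) := by
    rw [← Real.rpow_mul (by positivity), one_div_mul_cancel hq1, Real.rpow_one]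
  have hδq : δ ^ q = δ * (1 / (2 * C + 2)) := by
    rw [← hδ]
    nth_rw 2 [← Real.rpow_one δ]
    rw [← Real.rpow_add hδ0]; congr 1; ring
  have hpow : ∀ x, (δ * P x ^ (p - 1)) ^ q = δ ^ q * P x ^ p := fun x => by
    rw [Real.mul_rpow hδ0.le (Real.rpow_nonneg (hP0 x) _), ← Real.rpow_mul (hP0 x),
      hpq.sub_one_mul_conj]
  have h1 := h (fun x => δ * P x ^ (p - 1)) ((hPint _ (by linarith)).const_mul δ)
    (fun y => mul_nonneg hδ0.le (Real.rpow_nonneg (hP0 y) _))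
    (fun y hy => by
      by_contra hyS
      exact hy (by simp [P, hyS, Real.zero_rpow (by linarith : p - 1 ≠ 0)]))
    (by simp only [hpow]; exact (hPint p hp0).const_mul _)
  have h2 : ∀ y, T y * (δ * P y ^ (p - 1)) = δ * P y ^ p := by
    intro y
    have e : P y ^ p = P y * P y ^ (p - 1) := by
      rcases (hP0 y).eq_or_lt with h0 | h0
      · rw [← h0, Real.zero_rpow hp0.ne', zero_mul]
      · nth_rw 2 [← Real.rpow_one (P y)]
        rw [← Real.rpow_add h0]; congr 1; ring
    by_cases hz : P y = 0
    · rw [hz, Real.zero_rpow hp0.ne', Real.zero_rpow (by linarith)]; ring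
    · have : T y = P y := by
        by_cases hyS : y ∈ S
        · simp only [P, indicator_of_mem hyS] at hz ⊢
          rw [max_eq_left]
          by_contra hneg
          exact hz (max_eq_right (not_le.1 hneg).le)
        · exact absurd (by simp [P, hyS]) hz
      rw [this, e]; ring
  simp only [h2, hpow, integral_const_mul] at h1
  rw [hX]
  have h3 : C * (δ ^ q * X) ≤ δ * X / 2 := by
    rw [hδq]
    have : C * (1 / (2 * C + 2)) ≤ 1 / 2 := by
      rw [mul_one_div, div_le_div_iff₀ (by positivity) (by norm_num)]; linarith
    nlinarith [mul_nonneg hδ0.le hX0]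
  have h4 : δ * X ≤ 2 * C * D := by
    have : δ * X ≤ C * D + C * (δ ^ q * X) := by rw [← mul_add]; exact h1
    linarith
  have h5 : (2 * C + 2) ^ (1 / (q - 1)) * δ = 1 := by
    rw [← Real.mul_rpow (by positivity) (by positivity), mul_one_div_cancel (by positivity),
      Real.one_rpow]
  calc X = (2 * C + 2) ^ (1 / (q - 1)) * (δ * X) := by rw [← mul_assoc, h5, one_mul]
    _ ≤ (2 * C + 2) ^ (1 / (q - 1)) * (2 * C * D) := by gcongr
    _ = _ := by ring

/-- The regularized Riesz transforms are bounded on `L ^ p`, uniformly in the regularization. -/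
theorem exists_eLpNorm_riesz_le {p : ℝ} (hp : 1 < p) : ∃ A : ℝ≥0, ∀ (l₀ l₁ : ℝ), 0 < l₀ → l₀ ≤ l₁ →
    ∀ (i j : Fin 3) (f : E3 → ℝ) (R : ℝ), Integrable f → (∀ y, f y ≠ 0 → ‖y‖ ≤ R) →
    MemLp f (ENNReal.ofReal p) → ∀ S : Set E3, MeasurableSet S → S ⊆ Metric.closedBall 0 R →
    eLpNorm (cv (riesz l₀ l₁ i j) f) (ENNReal.ofReal p) (volume.restrict S) ≤
      A * eLpNorm f (ENNReal.ofReal p) := by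
  have hp0 : 0 < p := by linarith
  have hpE : ENNReal.ofReal p ≠ 0 := by simpa using hp0
  have hpT : ENNReal.ofReal p ≠ ⊤ := ENNReal.ofReal_ne_top
  have hpR : (ENNReal.ofReal p).toReal = p := ENNReal.toReal_ofReal hp0.le
  have hpq := Real.HolderConjugate.conjExponent hp
  set q := p.conjExponent
  obtain ⟨C, hC, hbil⟩ := exists_bilinear_bound hpq
  set K := 2 * C * (2 * C + 2) ^ (1 / (q - 1))
  have hK : 0 ≤ K := by positivity
  have pos : ∀ (l₀ l₁ : ℝ), 0 < l₀ → l₀ ≤ l₁ →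
    ∀ (i j : Fin 3) (f : E3 → ℝ) (R : ℝ), Integrable f → (∀ y, f y ≠ 0 → ‖y‖ ≤ R) → (∀ y, 0 ≤ f y) →
    MemLp f (ENNReal.ofReal p) → ∀ S : Set E3, MeasurableSet S → S ⊆ Metric.closedBall 0 R →
    eLpNorm (cv (riesz l₀ l₁ i j) f) (ENNReal.ofReal p) (volume.restrict S) ≤
      ENNReal.ofReal ((2 * K) ^ (1 / p)) * eLpNorm f (ENNReal.ofReal p) := by
    intro l₀ l₁ h0 h01 i j f R hf hR f0 hfp S hS hSR
    have hfp' : Integrable fun x => f x ^ p := by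
      have := hfp.integrable_norm_rpow hpE hpT
      simpa only [hpR, Real.norm_of_nonneg (f0 _)] using this
    set T := cv (riesz l₀ l₁ i j) f
    have hT : Measurable T := measurable_cv (measurable_riesz _ _ _ _) hf
    obtain ⟨b, hb⟩ := abs_cv_riesz_bounded (l₁ := l₁) h0 i j hf
    have hSv : volume S < ⊤ := (measure_mono hSR).trans_lt measure_closedBall_lt_top
    have h1 : ∫ x in S, max (T x) 0 ^ p ≤ K * ∫ x, f x ^ p :=
      integral_rpow_duality hpq hC hS hSv hT (fun x => (le_abs_self _).trans (hb x))
        fun g hg g0 gS hgq => (le_abs_self _).trans (hbil R f g hf hg f0 g0 hR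
          (fun y hy => by simpa using hSR (gS y hy)) hfp' hgq l₀ l₁ h0 h01 i j)
    have h2 : ∫ x in S, max (-T x) 0 ^ p ≤ K * ∫ x, f x ^ p :=
      integral_rpow_duality hpq hC hS hSv hT.neg (fun x => (neg_le_abs _).trans (hb x))
        fun g hg g0 gS hgq => by
          simp only [neg_mul, integral_neg]
          exact (neg_le_abs _).trans (hbil R f g hf hg f0 g0 hR
            (fun y hy => by simpa using hSR (gS y hy)) hfp' hgq l₀ l₁ h0 h01 i j)
    have hInt : ∀ T : E3 → ℝ, Measurable T → (∀ x, T x ≤ b) →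
        IntegrableOn (fun x => max (T x) 0 ^ p) S := by
      intro T hT hb
      refine Measure.integrableOn_of_bounded (M := max b 0 ^ p) hSv.ne
        ((hT.max measurable_const).pow_const p).aestronglyMeasurable (Eventually.of_forall fun x => ?_)
      rw [Real.norm_of_nonneg (Real.rpow_nonneg (le_max_right _ _) _)]
      exact Real.rpow_le_rpow (le_max_right _ _) (max_le_max (hb x) le_rfl) hp0.le
    have h3 : ∫ x in S, ‖T x‖ ^ p ≤ 2 * K * ∫ x, f x ^ p := by
      have e : ∀ x, ‖T x‖ ^ p = max (T x) 0 ^ p + max (-T x) 0 ^ p := by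
        intro x
        rcases le_total 0 (T x) with h | h
        · rw [max_eq_left h, max_eq_right (by linarith), Real.norm_of_nonneg h,
            Real.zero_rpow hp0.ne', add_zero]
        · rw [max_eq_right h, max_eq_left (by linarith), Real.norm_of_nonpos h,
            Real.zero_rpow hp0.ne', zero_add]
      simp only [e]
      rw [integral_add (hInt T hT fun x => (le_abs_self _).trans (hb x))
        (hInt (fun x => -T x) hT.neg fun x => (neg_le_abs _).trans (hb x))]
      linarith
    have hTm : MemLp T (ENNReal.ofReal p) (volume.restrict S) :=
      have : IsFiniteMeasure (volume.restrict S) := ⟨by simpa using hSv⟩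
      MemLp.of_bound hT.aestronglyMeasurable b (Eventually.of_forall hb)
    rw [hTm.eLpNorm_eq_integral_rpow_norm hpE hpT, hfp.eLpNorm_eq_integral_rpow_norm hpE hpT,
      ← ENNReal.ofReal_mul (by positivity), hpR, ← one_div,
      ← Real.mul_rpow (by positivity) (integral_nonneg fun x => by positivity)]
    refine ENNReal.ofReal_le_ofReal (Real.rpow_le_rpow (integral_nonneg fun x => by positivity) ?_
      (by positivity))
    simpa only [Real.norm_of_nonneg (f0 _)] using h3
  -- The outer 2 comes from splitting f into its positive and negative parts, the inner one from
  -- splitting the transform of a nonnegative function in the same way.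
  refine ⟨2 * Real.toNNReal ((2 * K) ^ (1 / p)), fun l₀ l₁ h0 h01 i j f R hf hR hfp S hS hSR => ?_⟩
  set T := cv (riesz l₀ l₁ i j)
  obtain ⟨b, hb⟩ := riesz_bound (l₁ := l₁) h0 i j
  have hparts : ∀ x, T f x = T (fun y => max (f y) 0) x - T (fun y => max (-f y) 0) x := by
    intro x
    simp only [T, cv]
    rw [← integral_sub (integrable_cv (measurable_riesz _ _ _ _) hb hf.pos_part x)
      (integrable_cv (measurable_riesz _ _ _ _) hb hf.neg_part x)]
    congr 1
    ext y
    rw [← mul_sub]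
    congr 1
    rcases le_total 0 (f y) with h | h
    · rw [max_eq_left h, max_eq_right (by linarith), sub_zero]
    · rw [max_eq_right h, max_eq_left (by linarith)]; ring
  have hT : T f = (T fun y => max (f y) 0) - T fun y => max (-f y) 0 := funext hparts
  have m1 : Measurable (T fun y => max (f y) 0) := measurable_cv (measurable_riesz _ _ _ _) hf.pos_part
  have m2 : Measurable (T fun y => max (-f y) 0) := measurable_cv (measurable_riesz _ _ _ _) hf.neg_part
  have hle : ∀ g : E3 → ℝ, Integrable g → (∀ y, 0 ≤ g y) → (∀ y, |g y| ≤ |f y|) →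
      eLpNorm (T g) (ENNReal.ofReal p) (volume.restrict S) ≤
      ENNReal.ofReal ((2 * K) ^ (1 / p)) * eLpNorm f (ENNReal.ofReal p) := by
    intro g hg g0 hgf
    refine (pos l₀ l₁ h0 h01 i j g R hg (fun y hy => hR y fun h => hy ?_) g0
      (hfp.mono hg.aestronglyMeasurable (Eventually.of_forall hgf)) S hS hSR).trans ?_
    · have := hgf y
      rw [h, abs_zero] at this
      exact abs_nonpos_iff.1 this
    · gcongr
      exact eLpNorm_mono hgf
  rw [hT]
  refine (eLpNorm_sub_le m1.aestronglyMeasurable m2.aestronglyMeasurable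
    (by rw [← ENNReal.ofReal_one]; exact ENNReal.ofReal_le_ofReal hp.le)).trans ?_
  refine (add_le_add (hle _ hf.pos_part (fun y => le_max_right _ _) fun y => ?_)
    (hle _ hf.neg_part (fun y => le_max_right _ _) fun y => ?_)).trans (le_of_eq ?_)
  · rw [abs_of_nonneg (le_max_right _ _)]
    exact max_le (le_abs_self _) (abs_nonneg _)
  · rw [abs_of_nonneg (le_max_right _ _)]
    exact max_le (neg_le_abs _) (abs_nonneg _)
  · rw [← two_mul, ENNReal.coe_mul, ENNReal.coe_ofNat, mul_assoc]
    rfl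

end

end NSCyl

namespace NSCyl

noncomputable section

/-! ### The truncated Riesz kernels -/

/-- The kernel `∂ᵢ ∂ⱼ (1 / (4π|x|))`. -/
def rieszK (i j : Fin 3) (x : E3) : ℝ :=
  (3 * x i * x j / ‖x‖ ^ 5 - (if i = j then 1 else 0) / ‖x‖ ^ 3) / (4 * Real.pi)

/-- The kernel `rieszK`, truncated to `|x| ≥ ε`. -/
def rieszT (ε : ℝ) (i j : Fin 3) (x : E3) : ℝ := if ε ≤ ‖x‖ then rieszK i j x else 0

theorem measurable_rieszK (i j : Fin 3) : Measurable (rieszK i j) := by unfold rieszK; fun_prop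

theorem measurable_rieszT (ε : ℝ) (i j : Fin 3) : Measurable (rieszT ε i j) :=
  Measurable.ite (measurableSet_le measurable_const measurable_norm) (measurable_rieszK i j)
    measurable_const

theorem abs_rieszK_le (i j : Fin 3) (x : E3) : |rieszK i j x| ≤ 1 / ‖x‖ ^ 3 := by
  have hpi := Real.pi_gt_three
  rcases eq_or_ne x 0 with rfl | hx
  · simp [rieszK]
  have hr : 0 < ‖x‖ := norm_pos_iff.2 hx
  have h1 : |3 * x i * x j / ‖x‖ ^ 5| ≤ 3 / ‖x‖ ^ 3 := by
    rw [abs_div, abs_of_pos (by positivity : 0 < ‖x‖ ^ 5), div_le_div_iff₀ (by positivity) (by positivity),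
      abs_mul, abs_mul]
    have := mul_le_mul (abs_coord_le x i) (abs_coord_le x j) (abs_nonneg _) hr.le
    have h3 : |(3 : ℝ)| = 3 := by norm_num
    rw [h3]
    calc 3 * |x i| * |x j| * ‖x‖ ^ 3 = 3 * (|x i| * |x j|) * ‖x‖ ^ 3 := by ring
      _ ≤ 3 * (‖x‖ * ‖x‖) * ‖x‖ ^ 3 := by gcongr
      _ = _ := by ring
  have h2 : |(if i = j then (1 : ℝ) else 0) / ‖x‖ ^ 3| ≤ 1 / ‖x‖ ^ 3 := by
    rw [abs_div, abs_of_pos (by positivity : 0 < ‖x‖ ^ 3)]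
    gcongr
    split_ifs <;> simp
  rw [rieszK, abs_div, abs_of_pos (by positivity : 0 < 4 * Real.pi), div_le_iff₀ (by positivity)]
  refine (abs_sub _ _).trans ((add_le_add h1 h2).trans ?_)
  rw [← add_div, div_mul_eq_mul_div]
  gcongr
  linarith

theorem rieszDens_eq {l : ℝ} (hl : 0 < l) (i j : Fin 3) (x : E3) :
    rieszDens i j l x = (2 * (2 * Real.pi) ^ (3 / 2 : ℝ))⁻¹ *
      (x i * x j * (l ^ ((5 / 2 : ℝ) - 1) * Real.exp (-(‖x‖ ^ 2 / 2 * l))) -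
        (if i = j then 1 else 0) * (l ^ ((3 / 2 : ℝ) - 1) * Real.exp (-(‖x‖ ^ 2 / 2 * l)))) := by
  have hpi := Real.pi_pos
  have h1 : l / 2 / Real.pi = l / (2 * Real.pi) := by rw [div_div]
  have h2 : l ^ ((5 / 2 : ℝ) - 1) = l ^ (3 / 2 : ℝ) := by norm_num
  have h3 : l ^ ((3 / 2 : ℝ) - 1) = l ^ (3 / 2 : ℝ) / l := Real.rpow_sub_one hl.ne' _
  have h4 : -(l / 2) * ‖x‖ ^ 2 = -(‖x‖ ^ 2 / 2 * l) := by ring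
  simp only [rieszDens, gauss2, gauss]
  rw [h1, h2, h3, h4, Real.div_rpow hl.le (by positivity)]
  field_simp
  ring

/-- A nonintegrable function would have integral 0 by convention, whereas the Gamma formula gives a
positive value. -/
theorem integrable_rieszDens_aux {a c : ℝ} (ha : 0 < a) (hc : 0 < c) :
    IntegrableOn (fun l : ℝ => l ^ (a - 1) * Real.exp (-(c * l))) (Ioi 0) := by
  by_contra h
  have h1 := Real.integral_rpow_mul_exp_neg_mul_Ioi ha hc
  rw [integral_undef h] at h1
  have := Real.Gamma_pos_of_pos ha
  have h2 : 0 < (1 / c) ^ a * Real.Gamma a := by positivity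
  linarith

/-- Justifies the weight 1/(2l²) and the parameter l/2: gauss_{l/2} is the heat kernel at time t =
1/(2l), and |dt| = dl/(2l²), so this is ∂ᵢ∂ⱼ of ∫ e^{tΔ} dt = (-Δ)⁻¹. It is computed by Gamma
integrals at 5/2 and 3/2. -/
theorem integral_rieszDens_Ioi (i j : Fin 3) {x : E3} (hx : x ≠ 0) :
    IntegrableOn (fun l => rieszDens i j l x) (Ioi 0) ∧
    ∫ l in Ioi 0, rieszDens i j l x = rieszK i j x := by
  have hpi := Real.pi_pos
  have hr : 0 < ‖x‖ := norm_pos_iff.2 hx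
  have hc : 0 < ‖x‖ ^ 2 / 2 := by positivity
  have i5 := integrable_rieszDens_aux (a := 5 / 2) (by norm_num) hc
  have i3 := integrable_rieszDens_aux (a := 3 / 2) (by norm_num) hc
  have e5 := Real.integral_rpow_mul_exp_neg_mul_Ioi (a := 5 / 2) (by norm_num) hc
  have e3 := Real.integral_rpow_mul_exp_neg_mul_Ioi (a := 3 / 2) (by norm_num) hc
  have g3 : Real.Gamma (3 / 2) = 1 / 2 * √Real.pi := by
    rw [show (3 / 2 : ℝ) = 1 / 2 + 1 by norm_num, Real.Gamma_add_one (by norm_num),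
      Real.Gamma_one_half_eq]
  have g5 : Real.Gamma (5 / 2) = 3 / 2 * (1 / 2 * √Real.pi) := by
    rw [show (5 / 2 : ℝ) = 3 / 2 + 1 by norm_num, Real.Gamma_add_one (by norm_num), g3]
  have hInt := ((i5.const_mul (x i * x j)).sub (i3.const_mul (if i = j then 1 else 0))).const_mul
    (2 * (2 * Real.pi) ^ (3 / 2 : ℝ))⁻¹
  have hcongr : ∀ l ∈ Ioi (0 : ℝ), rieszDens i j l x = _ := fun l hl => rieszDens_eq hl i j x
  refine ⟨IntegrableOn.congr_fun hInt (fun l hl => (hcongr l hl).symm) measurableSet_Ioi, ?_⟩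
  rw [setIntegral_congr_fun measurableSet_Ioi hcongr, integral_const_mul,
    integral_sub (i5.const_mul _) (i3.const_mul _), integral_const_mul, integral_const_mul, e5, e3,
    g3, g5]
  have hq : ∀ n : ℕ, ∀ y : ℝ, 0 < y → y ^ ((n : ℝ) / 2) = √y ^ n := fun n y hy => by
    rw [Real.sqrt_eq_rpow, ← Real.rpow_natCast, ← Real.rpow_mul hy.le]
    congr 1; ring
  have h5 := hq 5 (1 / (‖x‖ ^ 2 / 2)) (by positivity)
  have h3 := hq 3 (1 / (‖x‖ ^ 2 / 2)) (by positivity)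
  have h3' := hq 3 (2 * Real.pi) (by positivity)
  push_cast at h5 h3 h3'
  rw [h5, h3, h3']
  have s1 : √(1 / (‖x‖ ^ 2 / 2)) = √2 / ‖x‖ := by
    rw [show 1 / (‖x‖ ^ 2 / 2) = 2 / ‖x‖ ^ 2 by field_simp, Real.sqrt_div (by norm_num),
      Real.sqrt_sq hr.le]
  have s2 : √(2 * Real.pi) = √2 * √Real.pi := Real.sqrt_mul (by norm_num) _
  rw [s1, s2, rieszK]
  have t2 : √2 ^ 2 = 2 := Real.sq_sqrt (by norm_num)
  have tp : √Real.pi ^ 2 = Real.pi := Real.sq_sqrt hpi.le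
  have n2 : √2 ≠ 0 := by positivity
  have np : √Real.pi ≠ 0 := by positivity
  generalize √Real.pi = s at *
  rw [← tp]
  field_simp
  linear_combination (12 * x i * x j) * t2

/-- The density is l^(1/2) times a profile in l|x|². Bounding the profile by 1 serves for low
frequencies and for small x; its rapid decay serves for high frequencies away from the origin. -/
theorem abs_rieszDens_le {l : ℝ} (hl : 0 < l) (i j : Fin 3) (x : E3) :
    |rieszDens i j l x| ≤ l ^ (1 / 2 : ℝ) *
      ((l * ‖x‖ ^ 2 + 1) * Real.exp (-(l * ‖x‖ ^ 2 / 2)) / 2) := by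
  have hpi := Real.pi_gt_three
  have h4 : -(l / 2) * ‖x‖ ^ 2 = -(l * ‖x‖ ^ 2 / 2) := by ring
  have hc : (l / 2 / Real.pi) ^ (3 / 2 : ℝ) ≤ l * l ^ (1 / 2 : ℝ) := by
    calc (l / 2 / Real.pi) ^ (3 / 2 : ℝ) ≤ l ^ (3 / 2 : ℝ) := by
          apply Real.rpow_le_rpow (by positivity) _ (by norm_num)
          rw [div_div]
          exact div_le_self hl.le (by linarith)
      _ = l * l ^ (1 / 2 : ℝ) := by
          nth_rw 2 [← Real.rpow_one l]
          rw [← Real.rpow_add hl]; norm_num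
  have h1 : |4 * (l / 2) ^ 2 * x i * x j - 2 * (l / 2) * (if i = j then (1 : ℝ) else 0)| ≤
      l * (l * ‖x‖ ^ 2 + 1) := by
    have h2 : |4 * (l / 2) ^ 2 * x i * x j| ≤ l ^ 2 * (‖x‖ * ‖x‖) := by
      have e : 4 * (l / 2) ^ 2 * x i * x j = l ^ 2 * (x i * x j) := by ring
      rw [e, abs_mul, abs_mul, abs_of_pos (by positivity : 0 < l ^ 2)]
      have := abs_coord_le x i
      have := abs_coord_le x j
      gcongr
    have h3 : |2 * (l / 2) * (if i = j then (1 : ℝ) else 0)| ≤ l := by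
      split_ifs <;> simp [hl.le]
      rw [abs_of_pos (by linarith)]; linarith
    refine (abs_sub _ _).trans ((add_le_add h2 h3).trans (le_of_eq ?_))
    ring
  have he := Real.exp_pos (-(l * ‖x‖ ^ 2 / 2))
  simp only [rieszDens, gauss2, gauss]
  rw [abs_mul, abs_mul, abs_mul, abs_of_pos (by positivity : 0 < 1 / (2 * l ^ 2)), h4, Real.abs_exp,
    abs_of_pos (by positivity : 0 < (l / 2 / Real.pi) ^ (3 / 2 : ℝ))]
  calc _ ≤ 1 / (2 * l ^ 2) * ((l * (l * ‖x‖ ^ 2 + 1)) * ((l * l ^ (1 / 2 : ℝ)) *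
        Real.exp (-(l * ‖x‖ ^ 2 / 2)))) := by gcongr
    _ = _ := by field_simp

theorem abs_rieszDens_le_sqrt {l : ℝ} (hl : 0 < l) (i j : Fin 3) (x : E3) :
    |rieszDens i j l x| ≤ l ^ (1 / 2 : ℝ) := by
  refine (abs_rieszDens_le hl i j x).trans ?_
  set y := l * ‖x‖ ^ 2
  have hy : 0 ≤ y := by positivity
  have h1 : y + 1 ≤ 2 * Real.exp (y / 2) := by linarith [Real.add_one_le_exp (y / 2)]
  have h2 : Real.exp (-(y / 2)) * Real.exp (y / 2) = 1 := by rw [← Real.exp_add]; simp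
  have h3 := Real.exp_pos (-(y / 2))
  have h4 : (y + 1) * Real.exp (-(y / 2)) / 2 ≤ 1 := by nlinarith
  have h5 : 0 ≤ l ^ (1 / 2 : ℝ) := by positivity
  nlinarith

/-- The profile in y = l|x|² is bounded by 108/y², using (y + 1)³ ≤ 6³ exp(y/2). The resulting power
l^(-3/2) is integrable at infinity. -/
theorem abs_rieszDens_le_decay {l : ℝ} (hl : 0 < l) (i j : Fin 3) {x : E3} (hx : x ≠ 0) :
    |rieszDens i j l x| ≤ 108 * l ^ (-(3 / 2) : ℝ) / ‖x‖ ^ 4 := by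
  refine (abs_rieszDens_le hl i j x).trans ?_
  have hr : 0 < ‖x‖ := norm_pos_iff.2 hx
  have e : l ^ (-(3 / 2) : ℝ) = l ^ (1 / 2 : ℝ) / l ^ 2 := by
    rw [← Real.rpow_natCast l 2, ← Real.rpow_sub hl]; norm_num
  have e2 : 108 * (l ^ (1 / 2 : ℝ) / l ^ 2) / ‖x‖ ^ 4 =
      l ^ (1 / 2 : ℝ) * (108 / (l * ‖x‖ ^ 2) ^ 2) := by
    field_simp
  rw [e, e2]
  set y := l * ‖x‖ ^ 2
  have hy : 0 < y := by positivity
  have h1 : (y + 1) ^ 3 ≤ 216 * Real.exp (y / 2) := by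
    have h0 : y + 1 ≤ 6 * Real.exp (y / 6) := by linarith [Real.add_one_le_exp (y / 6)]
    calc (y + 1) ^ 3 ≤ (6 * Real.exp (y / 6)) ^ 3 := by gcongr
      _ = 216 * Real.exp (y / 2) := by
        rw [mul_pow, ← Real.exp_nat_mul]; norm_num
        ring
  have h2 : Real.exp (-(y / 2)) * Real.exp (y / 2) = 1 := by rw [← Real.exp_add]; simp
  have h3 := Real.exp_pos (-(y / 2))
  refine mul_le_mul_of_nonneg_left ?_ (by positivity)
  rw [div_le_div_iff₀ (by norm_num) (by positivity)]
  calc (y + 1) * Real.exp (-(y / 2)) * y ^ 2 ≤ (y + 1) * Real.exp (-(y / 2)) * (y + 1) ^ 2 := by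
        gcongr; linarith
    _ = Real.exp (-(y / 2)) * (y + 1) ^ 3 := by ring
    _ ≤ Real.exp (-(y / 2)) * (216 * Real.exp (y / 2)) := by gcongr
    _ = 216 * (Real.exp (-(y / 2)) * Real.exp (y / 2)) := by ring
    _ = _ := by rw [h2]; norm_num

/-- The integrable bump of size `ε ^ (-3)` and width `ε`. -/
def bump (ε : ℝ) (x : E3) : ℝ := (ε ^ 3)⁻¹ * ((1 + ‖ε⁻¹ • x‖) ^ 4)⁻¹

/-- A Gaussian of parameter l has width l^(-1/2), so truncation at |x| = ε corresponds to the cutoff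
l₁ = ε⁻². For |x| < ε the regularized kernel is at most ε⁻³, a multiple of the bump. For |x| ≥ ε the
missing range l ≤ 1 contributes at most 1 and the missing range l > ε⁻² at most 216ε/|x|⁴, where
ε/|x|⁴ is at most 16 bumps; 3456 = 216 · 16. -/
theorem abs_rieszT_sub_riesz_le {ε : ℝ} (hε : 0 < ε) (hε1 : ε ≤ 1) (i j : Fin 3) (x : E3) :
    |rieszT ε i j x - riesz 1 (ε ^ 2)⁻¹ i j x| ≤ 3456 * (bump ε x + 1) := by
  have hl1 : 1 ≤ (ε ^ 2)⁻¹ := (one_le_inv₀ (by positivity)).2 (pow_le_one₀ hε.le hε1)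
  have hb : 0 ≤ bump ε x := by unfold bump; positivity
  have hnorm : ‖ε⁻¹ • x‖ = ‖x‖ / ε := by
    rw [norm_smul, norm_inv, Real.norm_of_nonneg hε.le]; field_simp
  have hsq : ((ε ^ 2)⁻¹) ^ (1 / 2 : ℝ) = ε⁻¹ := by
    rw [← inv_pow, ← Real.sqrt_eq_rpow, Real.sqrt_sq (by positivity)]
  have hm : ∀ s : Set ℝ, AEStronglyMeasurable (fun l => rieszDens i j l x) (volume.restrict s) :=
    fun s => ((measurable_rieszDens i j).comp
      (measurable_id.prodMk measurable_const)).aestronglyMeasurable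
  rcases lt_or_ge ‖x‖ ε with h | h
  · rw [rieszT, if_neg (not_le.2 h), zero_sub, abs_neg]
    have h1 : |riesz 1 (ε ^ 2)⁻¹ i j x| ≤ ε⁻¹ * volume.real (Ioc 1 (ε ^ 2)⁻¹) := by
      refine norm_setIntegral_le_of_norm_le_const (f := fun l => rieszDens i j l x) measure_Ioc_lt_top
        fun l hl => ?_
      have hl0 : 0 < l := zero_lt_one.trans hl.1
      refine (abs_rieszDens_le_sqrt hl0 i j x).trans ?_
      rw [← hsq]
      exact Real.rpow_le_rpow hl0.le hl.2 (by norm_num)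
    have h2 : volume.real (Ioc 1 (ε ^ 2)⁻¹) ≤ (ε ^ 2)⁻¹ := by
      rw [Real.volume_real_Ioc_of_le hl1]; linarith
    have h3 : |riesz 1 (ε ^ 2)⁻¹ i j x| ≤ (ε ^ 3)⁻¹ := by
      refine h1.trans ((mul_le_mul_of_nonneg_left h2 (by positivity)).trans (le_of_eq ?_))
      field_simp
    have h4 : (ε ^ 3)⁻¹ ≤ 16 * bump ε x := by
      rw [bump, hnorm]
      have h5 : ‖x‖ / ε ≤ 1 := (div_le_one hε).2 h.le
      have h6 : (1 + ‖x‖ / ε) ^ 4 ≤ 16 := by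
        calc (1 + ‖x‖ / ε) ^ 4 ≤ (1 + 1) ^ 4 := by gcongr
          _ = 16 := by norm_num
      have h7 : 1 ≤ 16 * ((1 + ‖x‖ / ε) ^ 4)⁻¹ := by
        rw [← div_eq_mul_inv, le_div_iff₀ (by positivity)]; linarith
      calc (ε ^ 3)⁻¹ = (ε ^ 3)⁻¹ * 1 := by ring
        _ ≤ (ε ^ 3)⁻¹ * (16 * ((1 + ‖x‖ / ε) ^ 4)⁻¹) := by gcongr
        _ = _ := by ring
    linarith
  · have hr : 0 < ‖x‖ := hε.trans_le h
    have hx : x ≠ 0 := norm_pos_iff.1 hr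
    obtain ⟨hI, hK⟩ := integral_rieszDens_Ioi i j hx
    have hI1 : IntegrableOn (fun l => rieszDens i j l x) (Ioi 1) :=
      hI.mono_set (Ioi_subset_Ioi zero_le_one)
    have hI2 : IntegrableOn (fun l => rieszDens i j l x) (Ioi (ε ^ 2)⁻¹) :=
      hI1.mono_set (Ioi_subset_Ioi hl1)
    have hI0 : IntegrableOn (fun l => rieszDens i j l x) (Ioc 0 1) := hI.mono_set Ioc_subset_Ioi_self
    have hI3 : IntegrableOn (fun l => rieszDens i j l x) (Ioc 1 (ε ^ 2)⁻¹) :=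
      hI1.mono_set Ioc_subset_Ioi_self
    have hsplit : rieszK i j x = (∫ l in Ioc 0 1, rieszDens i j l x) +
        (riesz 1 (ε ^ 2)⁻¹ i j x + ∫ l in Ioi (ε ^ 2)⁻¹, rieszDens i j l x) := by
      rw [← hK, ← Ioc_union_Ioi_eq_Ioi zero_le_one,
        setIntegral_union Ioc_disjoint_Ioi_same measurableSet_Ioi hI0 hI1,
        ← Ioc_union_Ioi_eq_Ioi hl1,
        setIntegral_union Ioc_disjoint_Ioi_same measurableSet_Ioi hI3 hI2]
      rfl
    have h1 : |∫ l in Ioc 0 1, rieszDens i j l x| ≤ 1 := by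
      have := norm_setIntegral_le_of_norm_le_const (f := fun l => rieszDens i j l x) (C := 1)
        (s := Ioc (0 : ℝ) 1) (μ := volume) measure_Ioc_lt_top fun l hl =>
          (abs_rieszDens_le_sqrt hl.1 i j x).trans (Real.rpow_le_one hl.1.le hl.2 (by norm_num))
      simpa using this
    have h2 : |∫ l in Ioi (ε ^ 2)⁻¹, rieszDens i j l x| ≤ 216 * ε / ‖x‖ ^ 4 := by
      have hpos : 0 < (ε ^ 2)⁻¹ := by positivity
      have hi := integrableOn_Ioi_rpow_of_lt (a := -(3 / 2)) (by norm_num) hpos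
      have he := integral_Ioi_rpow_of_lt (a := -(3 / 2)) (by norm_num) hpos
      have hle := norm_integral_le_of_norm_le (f := fun l => rieszDens i j l x)
        ((hi.const_mul 108).div_const (‖x‖ ^ 4)) ((ae_restrict_mem measurableSet_Ioi).mono
          fun l hl => abs_rieszDens_le_decay (hpos.trans hl) i j hx)
      rw [integral_div, integral_const_mul, he] at hle
      refine hle.trans (le_of_eq ?_)
      have e1 : (-(3 / 2) + 1 : ℝ) = -(1 / 2) := by norm_num
      rw [e1, Real.rpow_neg hpos.le, hsq]
      field_simp
      norm_num
    have h3 : ε / ‖x‖ ^ 4 ≤ 16 * bump ε x := by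
      have h4 : 1 ≤ ‖x‖ / ε := (one_le_div hε).2 h
      have h5 : (1 + ‖x‖ / ε) ^ 4 ≤ (2 * (‖x‖ / ε)) ^ 4 := by
        gcongr; linarith
      have h6 : (((2 * (‖x‖ / ε)) ^ 4)⁻¹) ≤ ((1 + ‖x‖ / ε) ^ 4)⁻¹ := by gcongr
      rw [bump, hnorm]
      calc ε / ‖x‖ ^ 4 = 16 * ((ε ^ 3)⁻¹ * ((2 * (‖x‖ / ε)) ^ 4)⁻¹) := by
            field_simp; norm_num
        _ ≤ _ := by gcongr
    rw [rieszT, if_pos h]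
    have h7 : rieszK i j x - riesz 1 (ε ^ 2)⁻¹ i j x = (∫ l in Ioc 0 1, rieszDens i j l x) +
        ∫ l in Ioi (ε ^ 2)⁻¹, rieszDens i j l x := by rw [hsplit]; ring
    rw [h7]
    refine (abs_add_le _ _).trans ((add_le_add h1 h2).trans ?_)
    have : 216 * ε / ‖x‖ ^ 4 = 216 * (ε / ‖x‖ ^ 4) := by ring
    linarith

/-- The prefactor ε⁻³ is the L¹ normalization in dimension three; the mass does not depend on ε, so
neither does the Schur constant. -/
theorem lintegral_bump {ε : ℝ} (hε : 0 < ε) :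
    ∫⁻ x, ENNReal.ofReal (bump ε x) = ENNReal.ofReal (∫ x : E3, ((1 + ‖x‖) ^ 4)⁻¹) := by
  have hi : Integrable (bump ε) :=
    ((integrable_one_add_norm_four.comp_smul (inv_ne_zero hε.ne')).const_mul _)
  rw [← ofReal_integral_eq_lintegral_ofReal hi (Eventually.of_forall fun x => by
    simp only [bump, Pi.zero_apply]; positivity)]
  congr 1
  simp only [bump]
  rw [integral_const_mul, Measure.integral_comp_inv_smul volume (fun x : E3 => ((1 + ‖x‖) ^ 4)⁻¹) ε,
    finrank_euclideanSpace_fin, abs_of_pos (by positivity), smul_eq_mul]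
  field_simp

end

end NSCyl

/-! ### Uniform bounds for the truncated Riesz transforms. -/

namespace NSCyl

noncomputable section

theorem abs_rieszT_le {ε : ℝ} (hε : 0 < ε) (i j : Fin 3) (x : E3) : |rieszT ε i j x| ≤ 1 / ε ^ 3 := by
  unfold rieszT
  split_ifs with h
  · refine (abs_rieszK_le i j x).trans ?_
    gcongr
  · rw [abs_zero]; positivity

/-- Schur's test for a pointwise bound, as an estimate between `L ^ p` norms. -/
theorem eLpNorm_le_of_schur {X Y : Type*} [MeasurableSpace X] [MeasurableSpace Y] {μ : Measure X}
    {ν : Measure Y} [SFinite μ] [SFinite ν] {k : X → Y → ℝ≥0∞} (hk : Measurable (Function.uncurry k))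
    {f : Y → ℝ} (hf : AEStronglyMeasurable f ν) {M : ℝ≥0∞} (hM : ∀ x, ∫⁻ y, k x y ∂ν ≤ M)
    (hM' : ∀ y, ∫⁻ x, k x y ∂μ ≤ M) {p : ℝ} (hp : 1 < p) {g : X → ℝ}
    (hg : ∀ x, ‖g x‖ₑ ≤ ∫⁻ y, k x y * ‖f y‖ₑ ∂ν) :
    eLpNorm g (ENNReal.ofReal p) μ ≤ M * eLpNorm f (ENNReal.ofReal p) ν := by
  have hp0 : 0 < p := by linarith
  have hpE : ENNReal.ofReal p ≠ 0 := by simpa using hp0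
  have hpT : ENNReal.ofReal p ≠ ⊤ := ENNReal.ofReal_ne_top
  have hpR : (ENNReal.ofReal p).toReal = p := ENNReal.toReal_ofReal hp0.le
  rw [eLpNorm_eq_lintegral_rpow_enorm_toReal hpE hpT, eLpNorm_eq_lintegral_rpow_enorm_toReal hpE hpT, hpR]
  have h1 := schur_test hk (f := fun y => ‖hf.mk f y‖ₑ) hf.stronglyMeasurable_mk.enorm hM hM' hp
  have e1 : ∫⁻ y, ‖hf.mk f y‖ₑ ^ p ∂ν = ∫⁻ y, ‖f y‖ₑ ^ p ∂ν :=
    lintegral_congr_ae (hf.ae_eq_mk.mono fun y hy => by simp only [hy])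
  have e2 : ∀ x, ∫⁻ y, k x y * ‖hf.mk f y‖ₑ ∂ν = ∫⁻ y, k x y * ‖f y‖ₑ ∂ν := fun x =>
    lintegral_congr_ae (hf.ae_eq_mk.mono fun y hy => by simp only [hy])
  simp only [e1, e2] at h1
  calc (∫⁻ x, ‖g x‖ₑ ^ p ∂μ) ^ (1 / p) ≤ (M ^ p * ∫⁻ y, ‖f y‖ₑ ^ p ∂ν) ^ (1 / p) := by
        gcongr
        refine le_trans (lintegral_mono fun x => ?_) h1
        exact ENNReal.rpow_le_rpow (hg x) hp0.le
    _ = _ := by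
        rw [ENNReal.mul_rpow_of_nonneg _ _ (by positivity), ← ENNReal.rpow_mul,
          mul_one_div_cancel hp0.ne', ENNReal.rpow_one]

/-- The truncated Riesz transforms are bounded on `L ^ p` of a ball, uniformly in the truncation. -/
theorem exists_eLpNorm_rieszT_le {p : ℝ} (hp : 1 < p) (R : ℝ) : ∃ A : ℝ≥0, ∀ ε : ℝ, 0 < ε → ε ≤ 1 →
    ∀ (i j : Fin 3) (f : E3 → ℝ), Integrable f → (∀ y, f y ≠ 0 → ‖y‖ ≤ R) →
    MemLp f (ENNReal.ofReal p) →
    eLpNorm (cv (rieszT ε i j) f) (ENNReal.ofReal p) (volume.restrict (Metric.closedBall 0 R)) ≤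
      A * eLpNorm f (ENNReal.ofReal p) := by
  obtain ⟨A, hA⟩ := exists_eLpNorm_riesz_le hp
  set S := Metric.closedBall (0 : E3) R
  have hS : MeasurableSet S := Metric.isClosed_closedBall.measurableSet
  -- The constant left by the low frequencies is not integrable on ℝ³; on the ball it costs the
  -- volume of S. This is why the estimate is local and its constant depends on R.
  set M : ℝ≥0 := 3456 * (Real.toNNReal (∫ x : E3, ((1 + ‖x‖) ^ 4)⁻¹) + (volume S).toNNReal)
  refine ⟨M + A, fun ε hε hε1 i j f hf hR hfp => ?_⟩
  have hl1 : 1 ≤ (ε ^ 2)⁻¹ := (one_le_inv₀ (by positivity)).2 (pow_le_one₀ hε.le hε1)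
  obtain ⟨b, hb⟩ := riesz_bound (l₁ := (ε ^ 2)⁻¹) one_pos i j
  have hbm : Measurable (bump ε) := by unfold bump; fun_prop
  have hb0 : ∀ x, 0 ≤ bump ε x := fun x => by unfold bump; positivity
  set k : E3 → E3 → ℝ≥0∞ := fun x y => ENNReal.ofReal (3456 * (bump ε (x - y) + 1)) with hk
  have hSv : volume S < ⊤ := measure_closedBall_lt_top
  have hbound : ∀ φ : E3 → E3, (∫⁻ y, ENNReal.ofReal (bump ε (φ y)) =
      ENNReal.ofReal (∫ x : E3, ((1 + ‖x‖) ^ 4)⁻¹)) → Measurable φ →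
      ∫⁻ y in S, ENNReal.ofReal (3456 * (bump ε (φ y) + 1)) ≤ M := by
    intro φ hφ hφm
    simp only [ENNReal.ofReal_mul (by norm_num : (0 : ℝ) ≤ 3456),
      ENNReal.ofReal_add (hb0 _) zero_le_one, ENNReal.ofReal_one]
    rw [lintegral_const_mul _ (by fun_prop), lintegral_add_right _ measurable_const]
    simp only [lintegral_const, one_mul, Measure.restrict_apply_univ, M, ENNReal.coe_mul,
      ENNReal.coe_add, ENNReal.coe_toNNReal hSv.ne]
    have h3456 : ENNReal.ofReal 3456 = ((3456 : ℝ≥0) : ℝ≥0∞) := by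
      rw [ENNReal.ofReal, Real.toNNReal_ofNat]
    rw [h3456]
    gcongr
    exact (setLIntegral_le_lintegral _ _).trans hφ.le
  have h1 : eLpNorm (fun x => cv (rieszT ε i j) f x - cv (riesz 1 (ε ^ 2)⁻¹ i j) f x)
      (ENNReal.ofReal p) (volume.restrict S) ≤ M * eLpNorm f (ENNReal.ofReal p) (volume.restrict S) := by
    refine eLpNorm_le_of_schur (k := k) ?_ hf.aestronglyMeasurable.restrict (fun x => ?_) (fun y => ?_)
      hp fun x => ?_
    · simp only [hk, Function.uncurry_def]
      fun_prop
    · exact hbound (fun y => x - y)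
        (by rw [lintegral_sub_left_eq_self (fun z => ENNReal.ofReal (bump ε z)), lintegral_bump hε])
        (by fun_prop)
    · exact hbound (fun x => x - y)
        (by rw [lintegral_sub_right_eq_self (fun z => ENNReal.ofReal (bump ε z)), lintegral_bump hε])
        (by fun_prop)
    · have e1 : cv (rieszT ε i j) f x - cv (riesz 1 (ε ^ 2)⁻¹ i j) f x =
          ∫ y in S, (rieszT ε i j (x - y) - riesz 1 (ε ^ 2)⁻¹ i j (x - y)) * f y := by
        rw [setIntegral_eq_integral_of_forall_compl_eq_zero]
        · simp only [cv, sub_mul]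
          rw [integral_sub (integrable_cv (measurable_rieszT ε i j) (abs_rieszT_le hε i j) hf x)
            (integrable_cv (measurable_riesz _ _ _ _) hb hf x)]
        · intro y hy
          have : f y = 0 := by
            by_contra h0
            exact hy (by simpa [S] using hR y h0)
          rw [this, mul_zero]
      rw [e1]
      refine (enorm_integral_le_lintegral_enorm _).trans (lintegral_mono fun y => ?_)
      rw [enorm_mul]
      gcongr
      rw [hk, Real.enorm_eq_ofReal_abs]
      exact ENNReal.ofReal_le_ofReal (abs_rieszT_sub_riesz_le hε hε1 i j _)
  have h2 := hA 1 (ε ^ 2)⁻¹ one_pos hl1 i j f R hf hR hfp S hS subset_rfl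
  have e : cv (rieszT ε i j) f = (fun x => cv (rieszT ε i j) f x - cv (riesz 1 (ε ^ 2)⁻¹ i j) f x) +
      cv (riesz 1 (ε ^ 2)⁻¹ i j) f := by ext x; simp
  have m1 := measurable_cv (measurable_rieszT ε i j) hf
  have m2 := measurable_cv (measurable_riesz 1 (ε ^ 2)⁻¹ i j) hf
  rw [e]
  refine (eLpNorm_add_le (m1.sub m2).aestronglyMeasurable m2.aestronglyMeasurable
    (by rw [← ENNReal.ofReal_one]; exact ENNReal.ofReal_le_ofReal hp.le)).trans ?_
  rw [ENNReal.coe_add, add_mul]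
  refine add_le_add (h1.trans ?_) h2
  gcongr
  exact Measure.restrict_le_self

end

end NSCyl

namespace NSCyl

noncomputable section

/-! ### The second derivatives of the Newtonian potential as a periodized Riesz kernel -/

theorem proj_add (v w : E3) : proj (v + w) = proj v + proj w := by
  refine Prod.ext ?_ ?_
  · ext i
    fin_cases i <;> simp [proj]
  · simp [proj]

theorem proj_zero : proj 0 = 0 := by
  refine Prod.ext ?_ ?_
  · ext i
    fin_cases i <;> simp [proj]
  · simp [proj]

theorem proj_neg (v : E3) : proj (-v) = -proj v := by
  rw [eq_neg_iff_add_eq_zero, ← proj_add, neg_add_cancel, proj_zero]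

theorem proj_sub (v w : E3) : proj (v - w) = proj v - proj w := by
  rw [sub_eq_add_neg, proj_add, proj_neg, sub_eq_add_neg]

theorem norm_sq_eq_horizontal (v : E3) : ‖v‖ ^ 2 = ‖(proj v).1‖ ^ 2 + v 2 ^ 2 := by
  rw [EuclideanSpace.norm_sq_eq, EuclideanSpace.norm_sq_eq, Fin.sum_univ_three, Fin.sum_univ_two]
  simp [proj]

/-- The translate of `v` by `k` periods. -/
def shift (k : ℤ) (v : E3) : E3 := v + (2 * Real.pi * k) • bv 2

theorem shift_apply_two (k : ℤ) (v : E3) : shift k v 2 = v 2 + 2 * Real.pi * k := by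
  simp [shift]

theorem shift_zero (v : E3) : shift 0 v = v := by simp [shift]

theorem shift_shift (m n : ℤ) (v : E3) : shift m (shift n v) = shift (m + n) v := by
  simp only [shift]
  push_cast
  module

theorem shift_add (k : ℤ) (v w : E3) : shift k (v + w) = shift k v + w := by
  simp only [shift]; abel

theorem shift_sub_shift (k : ℤ) (v w : E3) : shift k v - shift k w = v - w := by
  simp only [shift]; abel

theorem proj_shift (k : ℤ) (v : E3) : proj (shift k v) = proj v := by
  have h : proj ((2 * Real.pi * k) • bv 2) = 0 := by
    refine Prod.ext ?_ ?_
    · ext i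
      fin_cases i <;> simp [proj]
    · simp only [proj, PiLp.smul_apply, smul_eq_mul]
      have : (((k : ℤ) • (2 * Real.pi) : ℝ) : AddCircle (2 * Real.pi)) = 0 := by
        rw [AddCircle.coe_zsmul, AddCircle.coe_period, smul_zero]
      simpa [mul_comm] using this
  rw [shift, proj_add, h, add_zero]

theorem measurable_shift (k : ℤ) : Measurable (shift k) := by
  unfold shift; fun_prop

theorem norm_shift_sq (k : ℤ) (v : E3) :
    ‖shift k v‖ ^ 2 = ‖(proj v).1‖ ^ 2 + (v 2 + 2 * Real.pi * k) ^ 2 := by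
  rw [norm_sq_eq_horizontal, proj_shift, shift_apply_two]

theorem horizontal_le_norm_shift (k : ℤ) (v : E3) : ‖(proj v).1‖ ≤ ‖shift k v‖ := by
  refine abs_le_of_sq_le_sq' ?_ (norm_nonneg _) |>.2
  rw [norm_shift_sq]
  nlinarith [sq_nonneg (v 2 + 2 * Real.pi * k)]

theorem le_norm_shift {m : ℝ} {v : E3} (hv : |v 2| ≤ m) (k : ℤ) :
    2 * Real.pi * |(k : ℝ)| - m ≤ ‖shift k v‖ := by
  have hpi := Real.pi_pos
  have h1 := abs_coord_le (shift k v) 2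
  rw [shift_apply_two] at h1
  have h2 : 2 * Real.pi * |(k : ℝ)| = |2 * Real.pi * k| := by
    rw [abs_mul, abs_of_pos Real.two_pi_pos]
  have h3 : |2 * Real.pi * (k : ℝ)| ≤ |v 2 + 2 * Real.pi * k| + |v 2| := by
    have := abs_sub (v 2 + 2 * Real.pi * k) (v 2)
    rwa [add_sub_cancel_left] at this
  linarith

theorem pi_mul_le_norm_shift {v : E3} (hv : |v 2| ≤ Real.pi) {k : ℤ} (hk : k ≠ 0) :
    Real.pi * |(k : ℝ)| ≤ ‖shift k v‖ := by
  have hpi := Real.pi_pos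
  have h1 := le_norm_shift hv k
  have h2 : 1 ≤ |(k : ℝ)| := by exact_mod_cast Int.one_le_abs hk
  nlinarith

/-- The derivative `∂ⱼ (1 / |x|)`. -/
def rieszD (j : Fin 3) (x : E3) : ℝ := -(x j) / ‖x‖ ^ 3

theorem hasDerivAt_norm_line {x : E3} (hx : x ≠ 0) (i : Fin 3) :
    HasDerivAt (fun s : ℝ => ‖x + s • bv i‖) (x i / ‖x‖) 0 := by
  have hr : 0 < ‖x‖ := norm_pos_iff.2 hx
  have h := (hasDerivAt_norm_sq_line x i).sqrt (by simpa using hx)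
  simp only [Real.sqrt_sq (norm_nonneg _), zero_smul, add_zero] at h
  refine h.congr_deriv ?_
  field_simp

theorem hasLineDerivAt_inv_norm {x : E3} (hx : x ≠ 0) (i : Fin 3) :
    HasLineDerivAt ℝ (fun x : E3 => 1 / ‖x‖) (rieszD i x) x (bv i) := by
  have hr : 0 < ‖x‖ := norm_pos_iff.2 hx
  have h := (hasDerivAt_norm_line hx i).inv (by simpa using hx)
  simp only [zero_smul, add_zero] at h
  have h2 : HasDerivAt (fun s : ℝ => 1 / ‖x + s • bv i‖) (rieszD i x) 0 := by
    simp only [one_div]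
    refine h.congr_deriv ?_
    simp only [rieszD]
    field_simp
  exact h2

theorem hasLineDerivAt_rieszD {x : E3} (hx : x ≠ 0) (i j : Fin 3) :
    HasLineDerivAt ℝ (rieszD j) (4 * Real.pi * rieszK i j x) x (bv i) := by
  have hpi := Real.pi_pos
  have hr : 0 < ‖x‖ := norm_pos_iff.2 hx
  have h := (hasDerivAt_coord_line x i j).neg.div ((hasDerivAt_norm_line hx i).pow 3)
    (by simpa using hx)
  refine HasDerivAt.congr_deriv h ?_
  simp only [rieszK, zero_smul, add_zero, Pi.neg_apply, Pi.pow_apply]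
  field_simp
  ring

theorem abs_rieszD_le (j : Fin 3) (x : E3) : |rieszD j x| ≤ 1 / ‖x‖ ^ 2 := by
  rcases eq_or_ne x 0 with rfl | hx
  · simp [rieszD]
  have hr : 0 < ‖x‖ := norm_pos_iff.2 hx
  rw [rieszD, abs_div, abs_neg, abs_of_pos (by positivity : 0 < ‖x‖ ^ 3),
    div_le_div_iff₀ (by positivity) (by positivity)]
  nlinarith [abs_coord_le x j, sq_nonneg ‖x‖, mul_le_mul_of_nonneg_right (abs_coord_le x j) (sq_nonneg ‖x‖)]

/-- The renormalizing constants of the Newtonian potential. -/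
def renorm (k : ℤ) : ℝ := if k = 0 then 0 else 1 / (2 * Real.pi * |(k : ℝ)|)

/-- A summable majorant. -/
def majorant (C δ : ℝ) (k : ℤ) : ℝ := C * (1 / |(k : ℝ)| ^ 2) + if k = 0 then δ else 0

theorem summable_majorant (C δ : ℝ) : Summable (majorant C δ) := by
  have h1 : Summable fun k : ℤ => 1 / |(k : ℝ)| ^ 2 := by
    simpa using Real.summable_one_div_int_pow.2 (by norm_num : 1 < 2)
  refine (h1.mul_left C).add ?_
  exact summable_of_ne_finset_zero (s := {0}) fun k hk => by simp at hk; simp [hk]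

theorem le_majorant {C δ x : ℝ} {k : ℤ} (hC : 0 ≤ C) (h0 : k = 0 → x ≤ δ)
    (h : k ≠ 0 → x ≤ C * (1 / |(k : ℝ)| ^ 2)) : x ≤ majorant C δ k := by
  unfold majorant
  by_cases hk : k = 0
  · have := h0 hk
    rw [if_pos hk]
    have : 0 ≤ C * (1 / |(k : ℝ)| ^ 2) := by positivity
    linarith
  · rw [if_neg hk, add_zero]
    exact h hk

/-- Moving by v changes the distance 2π|k| by at most |v|, so each renormalized term is O(|v|/k²).
The estimate is made for |k| > |v|, that is for all but finitely many k. -/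
theorem summable_newton_terms (v : E3) :
    Summable fun k : ℤ => 1 / ‖shift k v‖ - renorm k := by
  have hpi := Real.pi_pos
  refine Summable.of_norm_bounded_eventually (g := fun k : ℤ => ‖v‖ * (1 / |(k : ℝ)| ^ 2)) ?_ ?_
  · have h1 : Summable fun k : ℤ => 1 / |(k : ℝ)| ^ 2 := by
      simpa using Real.summable_one_div_int_pow.2 (by norm_num : 1 < 2)
    exact h1.mul_left _
  · have hfin : {k : ℤ | |(k : ℝ)| ≤ ‖v‖}.Finite := by
      refine (Set.finite_Icc (-⌈‖v‖⌉) ⌈‖v‖⌉).subset fun k hk => ?_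
      have hk' : |(k : ℝ)| ≤ ‖v‖ := hk
      have h1 := abs_le.1 (hk'.trans (Int.le_ceil _))
      exact ⟨by exact_mod_cast h1.1, by exact_mod_cast h1.2⟩
    refine (hfin.eventually_cofinite_notMem).mono fun k hk => ?_
    simp only [mem_ofPred_eq, not_le] at hk
    have hk0 : 0 < |(k : ℝ)| := (norm_nonneg v).trans_lt hk
    have hkne : k ≠ 0 := by rintro rfl; simp at hk0
    have h1 : |‖shift k v‖ - 2 * Real.pi * (|(k : ℝ)|)| ≤ ‖v‖ := by
      have h2 : ‖(2 * Real.pi * k) • bv 2‖ = 2 * Real.pi * |(k : ℝ)| := by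
        rw [norm_smul, Real.norm_eq_abs, abs_mul, abs_of_pos Real.two_pi_pos]
        simp
      rw [← h2]
      refine (abs_norm_sub_norm_le _ _).trans ?_
      simp [shift]
    have hs : |(k : ℝ)| ≤ ‖shift k v‖ := by
      have := (abs_le.1 h1).1
      nlinarith [Real.pi_gt_three]
    have hs0 := hk0.trans_le hs
    rw [renorm, if_neg hkne, Real.norm_eq_abs, div_sub_div _ _ hs0.ne' (by positivity), abs_div,
      one_mul, mul_one, abs_sub_comm, abs_of_pos (by positivity : 0 < ‖shift k v‖ * (2 * Real.pi * |(k : ℝ)|))]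
    have h3 : |(k : ℝ)| ^ 2 ≤ ‖shift k v‖ * (2 * Real.pi * |(k : ℝ)|) := by
      have : |(k : ℝ)| ≤ 2 * Real.pi * |(k : ℝ)| := by nlinarith [Real.pi_gt_three]
      rw [sq]; gcongr
    have h4 : 1 / (‖shift k v‖ * (2 * Real.pi * |(k : ℝ)|)) ≤ 1 / |(k : ℝ)| ^ 2 :=
      one_div_le_one_div_of_le (by positivity) h3
    rw [div_eq_mul_one_div]
    exact mul_le_mul h1 h4 (by positivity) (norm_nonneg _)

/-- Room for termwise differentiation: along short coordinate segments the k = 0 image stays away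
from the pole, and the height stays in the open strip, where all other images are at distance at
least π|k|. -/
theorem exists_safe_radius {v : E3} (hv : v ≠ 0) (hv2 : |v 2| < Real.pi) : ∃ δ : ℝ, 0 < δ ∧
    ∀ (i : Fin 3) (s : ℝ), s ∈ Metric.ball (0 : ℝ) δ → δ ≤ ‖v + s • bv i‖ ∧ |(v + s • bv i) 2| < Real.pi := by
  have hr : 0 < ‖v‖ := norm_pos_iff.2 hv
  refine ⟨min (‖v‖ / 2) (Real.pi - |v 2|), lt_min (by linarith) (by linarith), fun i s hs => ?_⟩
  rw [mem_ball_zero_iff, Real.norm_eq_abs, lt_min_iff] at hs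
  have hn : ‖s • bv i‖ = |s| := by rw [norm_smul]; simp
  constructor
  · refine (min_le_left _ _).trans ?_
    have := norm_sub_norm_le v (-(s • bv i))
    rw [norm_neg, hn, sub_neg_eq_add] at this
    linarith [hs.1]
  · have h1 := abs_coord_le (s • bv i) 2
    rw [hn] at h1
    rw [PiLp.add_apply]
    refine (abs_add_le _ _).trans_lt ?_
    linarith [hs.2]

/-- Termwise differentiation of a periodized function. -/
theorem hasLineDerivAt_periodize {φ φ' : E3 → ℝ} {c : ℤ → ℝ} {C : ℝ} (hC : 0 ≤ C) (n : ℕ) (hn : 2 ≤ n)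
    {i : Fin 3} (hφ : ∀ x, x ≠ 0 → HasLineDerivAt ℝ φ (φ' x) x (bv i))
    (hφ' : ∀ x, |φ' x| ≤ C / ‖x‖ ^ n) {v : E3} (hv : v ≠ 0) (hv2 : |v 2| < Real.pi)
    (hs : Summable fun k => φ (shift k v) - c k) :
    HasLineDerivAt ℝ (fun v => ∑' k : ℤ, (φ (shift k v) - c k)) (∑' k : ℤ, φ' (shift k v)) v (bv i) := by
  have hpi := Real.pi_gt_three
  obtain ⟨δ, hδ, hsafe⟩ := exists_safe_radius hv hv2
  have hne : ∀ s ∈ Metric.ball (0 : ℝ) δ, ∀ k : ℤ, shift k (v + s • bv i) ≠ 0 := by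
    intro s hs k h0
    obtain ⟨h1, h2⟩ := hsafe i s hs
    by_cases hk : k = 0
    · rw [hk, shift_zero] at h0
      rw [h0, norm_zero] at h1
      linarith
    · have h3 := pi_mul_le_norm_shift h2.le hk
      rw [h0, norm_zero] at h3
      have : 0 < |(k : ℝ)| := by positivity
      nlinarith
  have key := hasDerivAt_tsum_of_isPreconnected (𝕜 := ℝ) (u := majorant C (C / δ ^ n))
    (g := fun (k : ℤ) (s : ℝ) => φ (shift k (v + s • bv i)) - c k)
    (g' := fun (k : ℤ) (s : ℝ) => φ' (shift k (v + s • bv i))) (y₀ := 0) (y := 0)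
    (summable_majorant _ _) Metric.isOpen_ball (convex_ball (0 : ℝ) δ).isPreconnected ?_ ?_
    (Metric.mem_ball_self hδ) (by simpa using hs) (Metric.mem_ball_self hδ)
  · simp only [zero_smul, add_zero] at key
    exact key
  · intro k s hs
    have h1 : HasDerivAt (fun r : ℝ => φ (shift k (v + s • bv i) + r • bv i))
        (φ' (shift k (v + s • bv i))) (s - s) := by
      rw [sub_self]
      exact hφ _ (hne s hs k)
    have h2 := h1.comp_sub_const s s
    refine HasDerivAt.sub_const (c k) (h2.congr_of_eventuallyEq (Eventually.of_forall fun r => ?_))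
    simp only [shift_add]
    congr 1
    module
  · intro k s hs
    obtain ⟨h1, h2⟩ := hsafe i s hs
    refine (hφ' _).trans (le_majorant hC (fun hk => ?_) fun hk => ?_)
    · rw [hk, shift_zero]
      gcongr
    · have h3 := pi_mul_le_norm_shift h2.le hk
      have hk1 : 1 ≤ |(k : ℝ)| := by exact_mod_cast Int.one_le_abs hk
      rw [← div_eq_mul_one_div]
      refine div_le_div_of_nonneg_left hC (by positivity) ?_
      have h4 : |(k : ℝ)| ≤ ‖shift k (v + s • bv i)‖ := by nlinarith
      calc |(k : ℝ)| ^ 2 ≤ |(k : ℝ)| ^ n := pow_le_pow_right₀ hk1 hn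
        _ ≤ _ := by gcongr

/-- The periodization of the Riesz kernel. -/
def perK (i j : Fin 3) (v : E3) : ℝ := ∑' k : ℤ, rieszK i j (shift k v)

theorem rep_coe {t : ℝ} (ht : t ∈ Ioc (-Real.pi) Real.pi) : rep (t : AddCircle (2 * Real.pi)) = t := by
  have h : t ∈ Ioc (-Real.pi) (-Real.pi + 2 * Real.pi) := ⟨ht.1, by linarith [ht.2]⟩
  exact AddCircle.equivIoc_coe_of_mem h

theorem rep_mem (s : AddCircle (2 * Real.pi)) : rep s ∈ Ioc (-Real.pi) Real.pi := by
  have h := (AddCircle.equivIoc (2 * Real.pi) (-Real.pi) s).2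
  exact ⟨h.1, by have := h.2; unfold rep; linarith⟩

theorem coe_rep (s : AddCircle (2 * Real.pi)) : ((rep s : ℝ) : AddCircle (2 * Real.pi)) = s :=
  AddCircle.coe_equivIoc

theorem newton_proj {v : E3} (hv : |v 2| < Real.pi) :
    newton (proj v) = 1 / (4 * Real.pi) * ∑' k : ℤ, (1 / ‖shift k v‖ - renorm k) := by
  have h1 : rep (proj v).2 = v 2 := rep_coe ⟨(abs_lt.1 hv).1, (abs_lt.1 hv).2.le⟩
  simp only [newton, h1, renorm]
  congr 1
  refine tsum_congr fun k => ?_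
  rw [← norm_shift_sq, Real.sqrt_sq (norm_nonneg _)]

theorem pd_proj {F : Type*} [NormedAddCommGroup F] [NormedSpace ℝ F] (i : Fin 3) (f : Dom → F) (v : E3) :
    pd i f (proj v) = deriv (fun s : ℝ => f (proj (v + s • bv i))) 0 := by
  simp only [pd, proj_add]
  congr 1
  ext s
  congr 3
  ext j
  simp

theorem eventually_safe {v : E3} (hv : v ≠ 0) (hv2 : |v 2| < Real.pi) (i : Fin 3) :
    ∀ᶠ s : ℝ in 𝓝 0, v + s • bv i ≠ 0 ∧ |(v + s • bv i) 2| < Real.pi := by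
  obtain ⟨δ, hδ, hsafe⟩ := exists_safe_radius hv hv2
  filter_upwards [Metric.ball_mem_nhds (0 : ℝ) hδ] with s hs
  refine ⟨fun h0 => ?_, (hsafe i s hs).2⟩
  have := (hsafe i s hs).1
  rw [h0, norm_zero] at this
  linarith

/-- The renormalizing constants disappear with the first derivative. The trivial constant `- 0` is
kept so that `hasLineDerivAt_periodize` applies a second time. -/
theorem pd_newton_proj {v : E3} (hv : v ≠ 0) (hv2 : |v 2| < Real.pi) (j : Fin 3) :
    pd j newton (proj v) = 1 / (4 * Real.pi) * ∑' k : ℤ, (rieszD j (shift k v) - 0) := by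
  have h1 := (hasLineDerivAt_periodize (φ := fun x => 1 / ‖x‖) (φ' := rieszD j) (c := renorm)
    zero_le_one 2 le_rfl (fun x hx => hasLineDerivAt_inv_norm hx j) (abs_rieszD_le j) hv hv2
    (summable_newton_terms v) : HasDerivAt _ _ _).const_mul (1 / (4 * Real.pi))
  rw [pd_proj]
  simp only [sub_zero]
  refine (h1.congr_of_eventuallyEq ?_).deriv
  filter_upwards [eventually_safe hv hv2 j] with s hs
  exact newton_proj hs.2

theorem summable_of_decay {φ : E3 → ℝ} {C : ℝ} (hC : 0 ≤ C) (n : ℕ) (hn : 2 ≤ n)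
    (hφ : ∀ x, |φ x| ≤ C / ‖x‖ ^ n) {v : E3} (hv2 : |v 2| ≤ Real.pi) :
    Summable fun k => φ (shift k v) := by
  have hpi := Real.pi_gt_three
  refine Summable.of_norm_bounded (summable_majorant C |φ v|) fun k => le_majorant hC (fun hk => ?_) fun hk => ?_
  · rw [hk, shift_zero]; rfl
  · have h3 := pi_mul_le_norm_shift hv2 hk
    have hk1 : 1 ≤ |(k : ℝ)| := by exact_mod_cast Int.one_le_abs hk
    refine (hφ _).trans ?_
    rw [← div_eq_mul_one_div]
    refine div_le_div_of_nonneg_left hC (by positivity) ?_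
    have h4 : |(k : ℝ)| ≤ ‖shift k v‖ := by nlinarith
    calc |(k : ℝ)| ^ 2 ≤ |(k : ℝ)| ^ n := pow_le_pow_right₀ hk1 hn
      _ ≤ _ := by gcongr

/-- The first-derivative formula holds on a neighbourhood of v along the line, so it can be
differentiated again; the terms now decay like |k|⁻³. -/
theorem newtonD2_proj {v : E3} (hv : v ≠ 0) (hv2 : |v 2| < Real.pi) (i j : Fin 3) :
    newtonD2 i j (proj v) = perK i j v := by
  have hpi := Real.pi_pos
  have h1 := (hasLineDerivAt_periodize (φ := rieszD j) (φ' := fun x => 4 * Real.pi * rieszK i j x)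
    (c := fun _ => 0) (C := 4 * Real.pi)
    (by positivity) 3 (by norm_num) (fun x hx => hasLineDerivAt_rieszD hx i j)
    (fun x => by
      rw [abs_mul, abs_of_pos (by positivity : 0 < 4 * Real.pi), div_eq_mul_one_div]
      gcongr
      exact abs_rieszK_le i j x) hv hv2
    (by simpa using summable_of_decay zero_le_one 2 le_rfl (abs_rieszD_le j) hv2.le)
    : HasDerivAt _ _ _).const_mul (1 / (4 * Real.pi))
  rw [newtonD2, pd_proj]
  refine (h1.congr_of_eventuallyEq ?_).deriv.trans ?_
  · filter_upwards [eventually_safe hv hv2 i] with s hs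
    exact pd_newton_proj hs.1 hs.2 j
  · rw [tsum_mul_left, perK]
    field_simp

end

end NSCyl

/-! ### The kernel as a function on the domain, and its differences. -/

namespace NSCyl

noncomputable section

/-- The lift of a point of the domain to `ℝ² × (-π, π]`. -/
def lift (z : Dom) : E3 := !₂[z.1 0, z.1 1, rep z.2]

theorem lift_two (z : Dom) : lift z 2 = rep z.2 := rfl

theorem proj_lift (z : Dom) : proj (lift z) = z := by
  refine Prod.ext ?_ (coe_rep z.2)
  ext i
  fin_cases i <;> simp [proj, lift]

theorem abs_lift_two_le (z : Dom) : |lift z 2| ≤ Real.pi := by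
  have := rep_mem z.2
  rw [lift_two]
  exact abs_le.2 ⟨this.1.le, this.2⟩

theorem measurable_rep : Measurable rep :=
  measurable_subtype_coe.comp (AddCircle.measurableEquivIoc (2 * Real.pi) (-Real.pi)).measurable

theorem measurable_lift : Measurable lift := by
  have h := measurable_rep
  refine (WithLp.measurable_toLp 2 (Fin 3 → ℝ)).comp (measurable_pi_lambda _ fun i => ?_)
  fin_cases i <;> simp <;> fun_prop

theorem exists_shift_of_proj_eq {v w : E3} (h : proj v = proj w) : ∃ n : ℤ, v = shift n w := by
  have h1 : (((v 2 - w 2 : ℝ)) : AddCircle (2 * Real.pi)) = 0 := by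
    have := congrArg Prod.snd h
    simp only [proj] at this
    rw [AddCircle.coe_sub, this, sub_self]
  obtain ⟨n, hn⟩ := (AddCircle.coe_eq_zero_iff _).1 h1
  have h2 := congrArg Prod.fst h
  refine ⟨n, ?_⟩
  ext i
  fin_cases i
  · simpa [proj, shift] using congrFun (congrArg WithLp.ofLp h2) 0
  · simpa [proj, shift] using congrFun (congrArg WithLp.ofLp h2) 1
  · simp only [Fin.reduceFinMk, shift_apply_two]
    rw [zsmul_eq_mul] at hn
    linarith

theorem perK_shift (i j : Fin 3) (n : ℤ) (v : E3) : perK i j (shift n v) = perK i j v := by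
  simp only [perK, shift_shift]
  exact (Equiv.addRight n).tsum_eq fun k => rieszK i j (shift k v)

theorem perK_congr (i j : Fin 3) {v w : E3} (h : proj v = proj w) : perK i j v = perK i j w := by
  obtain ⟨n, rfl⟩ := exists_shift_of_proj_eq h
  exact perK_shift i j n w

/-- The second derivatives of the Newtonian potential, off a null set. -/
def perD (i j : Fin 3) (z : Dom) : ℝ := perK i j (lift z)

theorem perD_proj (i j : Fin 3) (v : E3) : perD i j (proj v) = perK i j v :=
  perK_congr i j (proj_lift _)

theorem summable_perK (i j : Fin 3) {v : E3} (hv : |v 2| ≤ Real.pi) :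
    Summable fun k => rieszK i j (shift k v) :=
  summable_of_decay zero_le_one 3 (by norm_num) (abs_rieszK_le i j) hv

theorem measurable_perD (i j : Fin 3) : Measurable (perD i j) := by
  refine measurable_of_tendsto_metrizable' (u := (atTop : Filter (Finset ℤ)))
    (f := fun (s : Finset ℤ) z => ∑ k ∈ s, rieszK i j (shift k (lift z))) (fun s => ?_)
    (tendsto_pi_nhds.2 fun z => (summable_perK i j (abs_lift_two_le z)).hasSum)
  exact Finset.measurable_fun_sum s fun k _ =>
    (measurable_rieszK i j).comp ((measurable_shift k).comp measurable_lift)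

/-- The height π is excluded because `rep` jumps there, the height 0 because it contains the pole.
Both are null sets, so integrals are unaffected. -/
theorem newtonD2_eq_perD {z : Dom} (h1 : z.2 ≠ 0) (h2 : z.2 ≠ (Real.pi : AddCircle (2 * Real.pi)))
    (i j : Fin 3) : newtonD2 i j z = perD i j z := by
  have hr := rep_mem z.2
  have hne : rep z.2 ≠ Real.pi := fun h => h2 (by rw [← coe_rep z.2, h])
  have hv2 : |lift z 2| < Real.pi := by
    rw [lift_two]
    exact abs_lt.2 ⟨hr.1, lt_of_le_of_ne hr.2 hne⟩
  have hv : lift z ≠ 0 := by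
    intro h0
    apply h1
    rw [← proj_lift z, h0, proj_zero]
    rfl
  have := newtonD2_proj hv hv2 i j
  rwa [proj_lift] at this

instance isAddHaarMeasure_dom : (volume : Measure Dom).IsAddHaarMeasure :=
  inferInstanceAs ((volume : Measure E2).prod
    (volume : Measure (AddCircle (2 * Real.pi)))).IsAddHaarMeasure

theorem ae_snd_ne (s : AddCircle (2 * Real.pi)) : ∀ᵐ z : Dom, z.2 ≠ s := by
  have : ∀ᵐ t : AddCircle (2 * Real.pi), t ≠ s := by
    rw [ae_iff]
    simp only [not_not, ofPred_eq_eq_singleton]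
    refine le_antisymm (ENNReal.le_of_forall_pos_le_add fun δ hδ _ => ?_) zero_le
    calc volume {s} ≤ volume (Metric.closedBall s ((δ : ℝ) / 2)) :=
          measure_mono (singleton_subset_iff.2 (Metric.mem_closedBall_self (by positivity)))
      _ ≤ ENNReal.ofReal δ := by
          rw [AddCircle.volume_closedBall]
          exact ENNReal.ofReal_le_ofReal ((min_le_right _ _).trans (by linarith))
      _ = _ := by rw [ENNReal.ofReal_coe_nnreal, zero_add]
  exact Measure.quasiMeasurePreserving_snd.ae this

theorem ae_newtonD2_eq : ∀ᵐ z : Dom, ∀ i j, newtonD2 i j z = perD i j z := by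
  filter_upwards [ae_snd_ne 0, ae_snd_ne (Real.pi : AddCircle (2 * Real.pi))] with z h1 h2 i j
  exact newtonD2_eq_perD h1 h2 i j

/-- The quadratic form with coefficients `perD`. -/
def perQuad (z : Dom) (w : E3) : ℝ := ∑ i : Fin 3, ∑ j : Fin 3, perD i j z * (w i * w j)

theorem ae_kerQuad_eq (x : Dom) : ∀ᵐ y : Dom, ∀ w, kerQuad (x - y) w = perQuad (x - y) w := by
  have h := (quasiMeasurePreserving_sub_left (volume : Measure Dom) x).ae ae_newtonD2_eq
  filter_upwards [h] with y hy w
  simp only [kerQuad, perQuad, hy]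

/-- In the fundamental strip the images k ≠ 0 lie at distance at least π|k|, so their kernels sum to
a bounded quantity. -/
theorem exists_perK_sub_le : ∃ C : ℝ, 0 ≤ C ∧ ∀ (i j : Fin 3) (v : E3), |v 2| ≤ Real.pi →
    |perK i j v - rieszK i j v| ≤ C := by
  refine ⟨∑' k, majorant 1 0 k, tsum_nonneg fun k => ?_, fun i j v hv => ?_⟩
  · unfold majorant; split_ifs <;> positivity
  · have h1 := (summable_perK i j hv).hasSum.sub (hasSum_ite_eq (0 : ℤ) (rieszK i j v))
    refine (h1.tsum_eq ▸ tsum_of_norm_bounded (summable_majorant 1 0).hasSum fun k => ?_ :)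
    refine le_majorant zero_le_one (fun hk => ?_) fun hk => ?_
    · simp [hk, shift_zero]
    · rw [if_neg hk, sub_zero]
      have h3 := pi_mul_le_norm_shift hv hk
      have hk1 : 1 ≤ |(k : ℝ)| := by exact_mod_cast Int.one_le_abs hk
      refine (abs_rieszK_le i j _).trans ?_
      rw [one_mul]
      refine div_le_div_of_nonneg_left zero_le_one (by positivity) ?_
      have h4 : |(k : ℝ)| ≤ ‖shift k v‖ := by nlinarith [Real.pi_gt_three]
      calc |(k : ℝ)| ^ 2 ≤ |(k : ℝ)| ^ 3 := pow_le_pow_right₀ hk1 (by norm_num)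
        _ ≤ _ := by gcongr

/-- A mean value estimate done by algebra, since the segment from a to b may pass through the pole.
The difference is split so that only one of the factors xᵢ, xⱼ, |x|⁻⁵, |x|⁻³ changes at a time. -/
theorem abs_rieszK_sub_le (i j : Fin 3) {a b : E3} {m : ℝ} (hm : 0 < m) (ha : m ≤ ‖a‖) (hb : m ≤ ‖b‖) :
    |rieszK i j a - rieszK i j b| ≤ 3 * ‖a - b‖ / m ^ 4 := by
  wlog hba : ‖b‖ ≤ ‖a‖ generalizing a b
  · rw [abs_sub_comm, norm_sub_rev]
    exact this hb ha (not_le.1 hba).le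
  have hpi := Real.pi_gt_three
  set r := ‖a‖
  set s := ‖b‖
  set d := ‖a - b‖
  have hs : 0 < s := hm.trans_le hb
  have hr : 0 < r := hm.trans_le ha
  have hd0 : 0 ≤ d := norm_nonneg _
  have hd : r - s ≤ d := norm_sub_norm_le a b
  have hm4 : 1 / s ^ 4 ≤ 1 / m ^ 4 := by gcongr
  have hq : ∀ n : ℕ, r ^ (n + 1) - s ^ (n + 1) ≤ (n + 1) * r ^ n * d := by
    intro n
    induction n with
    | zero => simpa using hd
    | succ n ih =>
      have e : r ^ (n + 1 + 1) - s ^ (n + 1 + 1) = r * (r ^ (n + 1) - s ^ (n + 1)) + s ^ (n + 1) * (r - s) := by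
        ring
      rw [e]
      have h1 : s ^ (n + 1) ≤ r ^ (n + 1) := by gcongr
      have h2 : r * (r ^ (n + 1) - s ^ (n + 1)) ≤ r * ((n + 1) * r ^ n * d) := by gcongr
      have h3 : s ^ (n + 1) * (r - s) ≤ r ^ (n + 1) * d := by
        have : 0 ≤ r - s := by linarith
        gcongr
      push_cast
      calc _ ≤ r * ((n + 1) * r ^ n * d) + r ^ (n + 1) * d := add_le_add h2 h3
        _ = _ := by ring
  have h3 : |1 / r ^ 3 - 1 / s ^ 3| ≤ 3 * d / s ^ 4 := by
    have e : 1 / s ^ 3 - 1 / r ^ 3 = (r ^ 3 - s ^ 3) / (r ^ 3 * s ^ 3) := by field_simp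
    have hp : s ^ 3 ≤ r ^ 3 := by gcongr
    rw [abs_sub_comm, e, abs_of_nonneg (div_nonneg (by linarith) (by positivity))]
    have hqn := hq 2
    push_cast at hqn
    calc (r ^ 3 - s ^ 3) / (r ^ 3 * s ^ 3) ≤ (3 * r ^ 2 * d) / (r ^ 3 * s ^ 3) := by
          gcongr; linarith
      _ = 3 * d / (r * s ^ 3) := by field_simp
      _ ≤ 3 * d / (s * s ^ 3) := by gcongr
      _ = _ := by ring
  have h5 : |1 / r ^ 5 - 1 / s ^ 5| ≤ 5 * d / s ^ 6 := by
    have e : 1 / s ^ 5 - 1 / r ^ 5 = (r ^ 5 - s ^ 5) / (r ^ 5 * s ^ 5) := by field_simp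
    have hp : s ^ 5 ≤ r ^ 5 := by gcongr
    rw [abs_sub_comm, e, abs_of_nonneg (div_nonneg (by linarith) (by positivity))]
    have hqn := hq 4
    push_cast at hqn
    calc (r ^ 5 - s ^ 5) / (r ^ 5 * s ^ 5) ≤ (5 * r ^ 4 * d) / (r ^ 5 * s ^ 5) := by
          gcongr; linarith
      _ = 5 * d / (r * s ^ 5) := by field_simp
      _ ≤ 5 * d / (s * s ^ 5) := by gcongr
      _ = _ := by ring
  have hci : ∀ k, |a k - b k| ≤ d := fun k => abs_coord_le (a - b) k
  have t1 : |(a i - b i) * a j * (1 / r ^ 5)| ≤ d / s ^ 4 := by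
    rw [abs_mul, abs_mul, abs_of_pos (by positivity : 0 < 1 / r ^ 5)]
    calc |a i - b i| * |a j| * (1 / r ^ 5) ≤ d * r * (1 / r ^ 5) := by
          gcongr
          · exact hci i
          · exact abs_coord_le a j
      _ = d / r ^ 4 := by field_simp
      _ ≤ _ := by gcongr
  have t2 : |b i * (a j - b j) * (1 / r ^ 5)| ≤ d / s ^ 4 := by
    rw [abs_mul, abs_mul, abs_of_pos (by positivity : 0 < 1 / r ^ 5)]
    calc |b i| * |a j - b j| * (1 / r ^ 5) ≤ r * d * (1 / r ^ 5) := by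
          gcongr
          · exact (abs_coord_le b i).trans hba
          · exact hci j
      _ = d / r ^ 4 := by field_simp
      _ ≤ _ := by gcongr
  have t3 : |b i * b j * (1 / r ^ 5 - 1 / s ^ 5)| ≤ 5 * d / s ^ 4 := by
    rw [abs_mul, abs_mul]
    calc |b i| * |b j| * |1 / r ^ 5 - 1 / s ^ 5| ≤ s * s * (5 * d / s ^ 6) := by
          gcongr
          · exact abs_coord_le b i
          · exact abs_coord_le b j
      _ = _ := by field_simp
  have t4 : |(if i = j then (1 : ℝ) else 0) * (1 / r ^ 3 - 1 / s ^ 3)| ≤ 3 * d / s ^ 4 := by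
    rw [abs_mul]
    refine le_trans ?_ h3
    have : |(if i = j then (1 : ℝ) else 0)| ≤ 1 := by split_ifs <;> simp
    exact mul_le_of_le_one_left (abs_nonneg _) this
  have e : rieszK i j a - rieszK i j b = (3 * ((a i - b i) * a j * (1 / r ^ 5) +
      b i * (a j - b j) * (1 / r ^ 5) + b i * b j * (1 / r ^ 5 - 1 / s ^ 5)) -
      (if i = j then (1 : ℝ) else 0) * (1 / r ^ 3 - 1 / s ^ 3)) / (4 * Real.pi) := by
    simp only [rieszK]
    ring
  have hfin : 3 * d / s ^ 4 ≤ 3 * d / m ^ 4 := by gcongr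
  refine le_trans ?_ hfin
  -- The pieces add up to 3(1 + 1 + 5) + 3 = 24, below 3 · 4π.
  rw [e, abs_div, abs_of_pos (by positivity : 0 < 4 * Real.pi), div_le_iff₀ (by positivity)]
  have hX : 0 ≤ d / s ^ 4 := by positivity
  have e3 : ∀ c : ℝ, c * d / s ^ 4 = c * (d / s ^ 4) := fun c => by ring
  rw [e3] at t3 t4 ⊢
  set X := d / s ^ 4
  refine (abs_sub _ _).trans ?_
  rw [abs_mul, abs_of_pos (by norm_num : (0 : ℝ) < 3)]
  have t123 := (abs_add_three ((a i - b i) * a j * (1 / r ^ 5)) (b i * (a j - b j) * (1 / r ^ 5))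
    (b i * b j * (1 / r ^ 5 - 1 / s ^ 5)))
  nlinarith

theorem summable_far : Summable fun k : ℤ => 1 / |(k : ℝ) + 1 / 2| ^ (3 / 2 : ℝ) :=
  (Real.summable_one_div_int_add_rpow (1 / 2) (3 / 2)).2 (by norm_num)

/-- The four powers of m are shared: 3/2 > 1 go to the summation over k, and 5/2 > 2 go to the
horizontal decay needed for integrability on ℝ². The shift k + 1/2 keeps the denominators nonzero.
-/
theorem far_term_le {ρ m : ℝ} (hρ : 1 / 2 ≤ ρ) {k : ℤ} (h1 : ρ ≤ m)
    (h2 : 2 * Real.pi * (|(k : ℝ)| - 1) ≤ m) :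
    1 / m ^ 4 ≤ 8 * (ρ ^ (5 / 2 : ℝ))⁻¹ * (1 / |(k : ℝ) + 1 / 2| ^ (3 / 2 : ℝ)) := by
  have hpi := Real.pi_gt_three
  have hρ0 : 0 < ρ := by linarith
  have hm : 0 < m := hρ0.trans_le h1
  set c := |(k : ℝ) + 1 / 2|
  have hc0 : 0 < c := by
    refine abs_pos.2 fun h => ?_
    have : (2 * k + 1 : ℤ) = 0 := by
      have h3 : (2 * (k : ℝ) + 1) = 0 := by linarith
      exact_mod_cast h3
    omega
  have hc : c ≤ 4 * m := by
    have h3 : c ≤ |(k : ℝ)| + 1 / 2 := by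
      refine (abs_add_le _ _).trans ?_
      norm_num
    rcases le_or_gt |k| 1 with hk | hk
    · have : |(k : ℝ)| ≤ 1 := by exact_mod_cast hk
      linarith
    · have : (2 : ℝ) ≤ |(k : ℝ)| := by
        have : (2 : ℤ) ≤ |k| := hk
        exact_mod_cast this
      nlinarith
  have h4 : ρ ^ (5 / 2 : ℝ) * (c / 4) ^ (3 / 2 : ℝ) ≤ m ^ 4 := by
    calc ρ ^ (5 / 2 : ℝ) * (c / 4) ^ (3 / 2 : ℝ) ≤ m ^ (5 / 2 : ℝ) * m ^ (3 / 2 : ℝ) := by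
          gcongr
          linarith
      _ = m ^ 4 := by
          rw [← Real.rpow_add hm, ← Real.rpow_natCast]; norm_num
  have h5 : (4 : ℝ) ^ (3 / 2 : ℝ) = 8 := by
    rw [show (4 : ℝ) = 2 ^ (2 : ℝ) by norm_num, ← Real.rpow_mul (by norm_num)]; norm_num
  rw [Real.div_rpow hc0.le (by norm_num), h5] at h4
  have hA : 0 < ρ ^ (5 / 2 : ℝ) := by positivity
  have hB : 0 < c ^ (3 / 2 : ℝ) := by positivity
  rw [div_le_iff₀ (by positivity)]
  calc (1 : ℝ) = 8 * (ρ ^ (5 / 2 : ℝ))⁻¹ * (1 / c ^ (3 / 2 : ℝ)) *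
        (ρ ^ (5 / 2 : ℝ) * (c ^ (3 / 2 : ℝ) / 8)) := by field_simp
    _ ≤ _ := by gcongr

theorem exists_perK_sub_far_le : ∃ C : ℝ, 0 ≤ C ∧ ∀ (i j : Fin 3) (a b : E3) (ρ : ℝ), 1 / 2 ≤ ρ →
    ρ ≤ ‖(proj a).1‖ → ρ ≤ ‖(proj b).1‖ → |b 2| ≤ Real.pi → |a 2| ≤ 2 * Real.pi →
    |perK i j a - perK i j b| ≤ C * ‖a - b‖ * (ρ ^ (5 / 2 : ℝ))⁻¹ := by
  have hpi := Real.pi_pos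
  set S := ∑' k : ℤ, 1 / |(k : ℝ) + 1 / 2| ^ (3 / 2 : ℝ)
  refine ⟨24 * S, mul_nonneg (by norm_num) (tsum_nonneg fun k => by positivity),
    fun i j a b ρ hρ ha hb hb2 ha2 => ?_⟩
  have hterm : ∀ k : ℤ, |rieszK i j (shift k a) - rieszK i j (shift k b)| ≤
      24 * ‖a - b‖ * (ρ ^ (5 / 2 : ℝ))⁻¹ * (1 / |(k : ℝ) + 1 / 2| ^ (3 / 2 : ℝ)) := by
    intro k
    -- Both images are at least this far from the pole: horizontally by ρ, and vertically because
    -- the heights of a and b are at most 2π.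
    set m := max ρ (2 * Real.pi * (|(k : ℝ)| - 1))
    have hm : 0 < m := (by linarith : 0 < ρ).trans_le (le_max_left _ _)
    have h1 : m ≤ ‖shift k a‖ := by
      refine max_le (ha.trans (horizontal_le_norm_shift k a)) ?_
      have := le_norm_shift ha2 k
      linarith
    have h2 : m ≤ ‖shift k b‖ := by
      refine max_le (hb.trans (horizontal_le_norm_shift k b)) ?_
      have := le_norm_shift hb2 k
      linarith
    refine (abs_rieszK_sub_le i j hm h1 h2).trans ?_
    rw [shift_sub_shift]
    have h3 := far_term_le (k := k) hρ (le_max_left ρ _) (le_max_right _ _)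
    calc 3 * ‖a - b‖ / m ^ 4 = 3 * ‖a - b‖ * (1 / m ^ 4) := by ring
      _ ≤ 3 * ‖a - b‖ * (8 * (ρ ^ (5 / 2 : ℝ))⁻¹ * (1 / |(k : ℝ) + 1 / 2| ^ (3 / 2 : ℝ))) := by gcongr
      _ = _ := by ring
  have hsum := summable_far.mul_left (24 * ‖a - b‖ * (ρ ^ (5 / 2 : ℝ))⁻¹)
  have hd : Summable fun k : ℤ => rieszK i j (shift k a) - rieszK i j (shift k b) :=
    Summable.of_norm_bounded hsum hterm
  have hb' := summable_perK i j hb2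
  -- The height of a may exceed π, so `summable_perK` does not cover it; summability is inherited
  -- from b through the difference.
  have ha' : Summable fun k : ℤ => rieszK i j (shift k a) := by
    simpa using hd.add hb'
  have h1 : |∑' k : ℤ, (rieszK i j (shift k a) - rieszK i j (shift k b))| ≤
      24 * ‖a - b‖ * (ρ ^ (5 / 2 : ℝ))⁻¹ * S :=
    tsum_of_norm_bounded (f := fun k : ℤ => rieszK i j (shift k a) - rieszK i j (shift k b))
      (summable_far.hasSum.mul_left _) hterm
  rw [ha'.tsum_sub hb'] at h1
  refine h1.trans (le_of_eq ?_)
  ring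

end

end NSCyl

namespace NSCyl

noncomputable section

/-! ### Balls, cylinders and uniformly local averages -/

theorem continuous_len : Continuous len := by unfold len; fun_prop

theorem measurableSet_ball (x : Dom) (r : ℝ) : MeasurableSet (ball x r) :=
  (isOpen_lt (continuous_len.comp (continuous_id.sub continuous_const)) continuous_const).measurableSet

theorem measurableSet_cyl (x : Dom) (r : ℝ) : MeasurableSet (cyl x r) :=
  (isOpen_lt (by fun_prop : Continuous fun y : Dom => ‖y.1 - x.1‖) continuous_const).measurableSet

theorem len_sub_comm (y z : Dom) : len (y - z) = len (z - y) := by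
  simp only [len, Prod.fst_sub, Prod.snd_sub, norm_sub_rev]

theorem norm_fst_le_len (z : Dom) : ‖z.1‖ ≤ len z :=
  Real.le_sqrt_of_sq_le (by nlinarith [sq_nonneg ‖z.2‖])

theorem norm_fst_sub_lt_of_mem_ball {y z : Dom} {r : ℝ} (h : y ∈ ball z r) : ‖y.1 - z.1‖ < r :=
  (norm_fst_le_len (y - z)).trans_lt h

theorem volume_ball_eq (x : Dom) (r : ℝ) : volume (ball x r) = volume (ball 0 r) := by
  have : ball x r = (fun y => y - x) ⁻¹' ball 0 r := by
    ext y
    simp [ball]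
  simp_rw [this, sub_eq_add_neg]
  rw [measure_preimage_add_right]

theorem volume_cyl_lt_top (x : Dom) (r : ℝ) : volume (cyl x r) < ⊤ := by
  have h : cyl x r = Metric.ball x.1 r ×ˢ univ := by
    ext y
    simp [cyl, dist_eq_norm]
  rw [h, Measure.volume_eq_prod, Measure.prod_prod]
  exact ENNReal.mul_lt_top Metric.isBounded_ball.measure_lt_top (measure_lt_top _ _)

theorem ball_subset_cyl (x : Dom) (r : ℝ) : ball x r ⊆ cyl x r := fun _ h =>
  norm_fst_sub_lt_of_mem_ball h

theorem volume_unit_ball_lt_top : volume (ball 0 1) < ⊤ :=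
  (measure_mono (ball_subset_cyl 0 1)).trans_lt (volume_cyl_lt_top 0 1)

theorem volume_unit_ball_ne_zero : volume (ball 0 1) ≠ 0 := by
  refine ((isOpen_lt (continuous_len.comp (continuous_id.sub continuous_const))
    continuous_const).measure_pos volume ⟨0, ?_⟩).ne'
  simp [len]

/-- Averaging over the centre replaces a covering by balls: the integral of wF is inflated to pairs
(y, z) with y in B(z, 1), and Tonelli's theorem integrates in y first, with w(y) replaced by w'(z).
-/
theorem lintegral_mul_le_uloc {w w' F : Dom → ℝ≥0∞} (hw : Measurable w) (hw' : Measurable w') (hF : AEMeasurable F)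
    (h : ∀ y z, y ∈ ball z 1 → w y ≤ w' z) :
    (∫⁻ y, w y * F y) * volume (ball 0 1) ≤ (∫⁻ z, w' z) * ⨆ z, ∫⁻ y in ball z 1, F y := by
  set S := ⨆ z, ∫⁻ y in ball z 1, F y
  have hset : MeasurableSet {p : Dom × Dom | p.1 ∈ ball p.2 1} :=
    (isOpen_lt (continuous_len.comp (continuous_fst.sub continuous_snd)) continuous_const).measurableSet
  have e1 : ∀ y, w y * F y * volume (ball 0 1) =
      ∫⁻ z, {p : Dom × Dom | p.1 ∈ ball p.2 1}.indicator (fun p => w p.1 * F p.1) (y, z) := by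
    intro y
    have : ∀ z, {p : Dom × Dom | p.1 ∈ ball p.2 1}.indicator (fun p => w p.1 * F p.1) (y, z) =
        (ball y 1).indicator (fun _ => w y * F y) z := by
      intro z
      have hyz : (y, z) ∈ {p : Dom × Dom | p.1 ∈ ball p.2 1} ↔ z ∈ ball y 1 := by
        simp only [ball, mem_ofPred_eq, len_sub_comm y z]
      by_cases hz : z ∈ ball y 1
      · rw [indicator_of_mem hz, indicator_of_mem (hyz.2 hz)]
      · rw [indicator_of_notMem hz, indicator_of_notMem (mt hyz.1 hz)]
    simp_rw [this]
    rw [lintegral_indicator (measurableSet_ball y 1), setLIntegral_const, volume_ball_eq y]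
  calc (∫⁻ y, w y * F y) * volume (ball 0 1) = ∫⁻ y, w y * F y * volume (ball 0 1) :=
        (lintegral_mul_const' _ _ volume_unit_ball_lt_top.ne).symm
    _ = ∫⁻ y, ∫⁻ z, {p : Dom × Dom | p.1 ∈ ball p.2 1}.indicator (fun p => w p.1 * F p.1) (y, z) := by
        simp_rw [e1]
    _ = ∫⁻ z, ∫⁻ y, {p : Dom × Dom | p.1 ∈ ball p.2 1}.indicator (fun p => w p.1 * F p.1) (y, z) := by
        refine lintegral_lintegral_swap (AEMeasurable.indicator ?_ hset)
        exact (hw.comp measurable_fst).aemeasurable.mul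
          (hF.comp_quasiMeasurePreserving Measure.quasiMeasurePreserving_fst)
    _ ≤ ∫⁻ z, w' z * S := by
        refine lintegral_mono fun z => ?_
        calc ∫⁻ y, {p : Dom × Dom | p.1 ∈ ball p.2 1}.indicator (fun p => w p.1 * F p.1) (y, z)
            ≤ ∫⁻ y, (ball z 1).indicator (fun y => w' z * F y) y := by
              refine lintegral_mono fun y => ?_
              by_cases hy : y ∈ ball z 1
              · have hy' : (y, z) ∈ {p : Dom × Dom | p.1 ∈ ball p.2 1} := hy
                rw [indicator_of_mem hy, indicator_of_mem hy']
                exact mul_le_mul_left (h y z hy) _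
              · have hy' : (y, z) ∉ {p : Dom × Dom | p.1 ∈ ball p.2 1} := hy
                rw [indicator_of_notMem hy']
                exact zero_le
          _ = w' z * ∫⁻ y in ball z 1, F y := by
              rw [lintegral_indicator (measurableSet_ball z 1), lintegral_const_mul'' _ hF.restrict]
          _ ≤ w' z * S := mul_le_mul_right (le_iSup (fun z => ∫⁻ y in ball z 1, F y) z) _
    _ = (∫⁻ z, w' z) * S := lintegral_mul_const _ hw'

theorem lintegral_rpow_ball_le {F : Type*} [NormedAddCommGroup F] (v : Dom → F) {r : ℝ} (hr : 0 < r) :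
    ⨆ z, ∫⁻ y in ball z 1, ‖v y‖ₑ ^ r ≤ ulocNorm v (ENNReal.ofReal r) ^ r := by
  refine iSup_le fun z => ?_
  have h : ∫⁻ y in ball z 1, ‖v y‖ₑ ^ r =
      eLpNorm v (ENNReal.ofReal r) (volume.restrict (ball z 1)) ^ r := by
    rw [eLpNorm_eq_lintegral_rpow_enorm_toReal (by simpa using hr) ENNReal.ofReal_ne_top,
      ENNReal.toReal_ofReal hr.le, one_div, ENNReal.rpow_inv_rpow hr.ne']
  rw [h]
  exact ENNReal.rpow_le_rpow (le_iSup (fun z => eLpNorm v (ENNReal.ofReal r) (volume.restrict (ball z 1))) z) hr.le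

/-- Integrals over cylinders of radius `2` are bounded by uniformly local norms. -/
theorem exists_lintegral_cyl_le : ∃ C : ℝ≥0, ∀ (x₀ : Dom) (v : Dom → E3) (r : ℝ), 0 < r →
    AEStronglyMeasurable v → ∫⁻ y in cyl x₀ 2, ‖v y‖ₑ ^ r ≤ C * ulocNorm v (ENNReal.ofReal r) ^ r := by
  have h0 := volume_unit_ball_ne_zero
  have h1 := volume_unit_ball_lt_top.ne
  have h3 : volume (cyl 0 3) ≠ ⊤ := (volume_cyl_lt_top 0 3).ne
  refine ⟨(volume (cyl 0 3) / volume (ball 0 1)).toNNReal, fun x₀ v r hr hv => ?_⟩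
  rw [ENNReal.coe_toNNReal (ENNReal.div_ne_top h3 h0)]
  have h := lintegral_mul_le_uloc (w := (cyl x₀ 2).indicator 1) (w' := (cyl x₀ 3).indicator 1)
    (F := fun y => ‖v y‖ₑ ^ r) (measurable_one.indicator (measurableSet_cyl x₀ 2))
    (measurable_one.indicator (measurableSet_cyl x₀ 3)) (hv.enorm.pow_const r)
    fun y z hy => by
      by_cases hy2 : y ∈ cyl x₀ 2
      · have hz : z ∈ cyl x₀ 3 := by
          have h4 := norm_fst_sub_lt_of_mem_ball hy
          have h5 : ‖y.1 - x₀.1‖ < 2 := hy2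
          have h6 : z.1 - x₀.1 = (y.1 - x₀.1) - (y.1 - z.1) := by abel
          change ‖z.1 - x₀.1‖ < 3
          rw [h6]
          exact (norm_sub_le _ _).trans_lt (by linarith)
        simp [hy2, hz]
      · simp [hy2]
  have e1 : ∫⁻ y, (cyl x₀ 2).indicator 1 y * ‖v y‖ₑ ^ r = ∫⁻ y in cyl x₀ 2, ‖v y‖ₑ ^ r := by
    rw [← lintegral_indicator (measurableSet_cyl x₀ 2)]
    refine lintegral_congr fun y => ?_
    by_cases hy2 : y ∈ cyl x₀ 2 <;> simp [hy2]
  have e2 : volume (cyl x₀ 3) = volume (cyl 0 3) := by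
    have : cyl x₀ 3 = (fun y => y - x₀) ⁻¹' cyl 0 3 := by
      ext y
      simp [cyl]
    simp_rw [this, sub_eq_add_neg]
    rw [measure_preimage_add_right]
  rw [e1, lintegral_indicator_one (measurableSet_cyl x₀ 3), e2,
    ← ENNReal.le_div_iff_mul_le (Or.inl h0) (Or.inl h1)] at h
  refine h.trans ?_
  rw [ENNReal.mul_div_right_comm]
  exact mul_le_mul_right (lintegral_rpow_ball_le v hr) _

/-! ### The far field -/

theorem norm_lift_le {z : Dom} (hz : ‖z.1‖ < 3 / 2) : ‖lift z‖ ≤ 5 := by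
  have h1 := norm_sq_eq_horizontal (lift z)
  rw [proj_lift] at h1
  have h2 := abs_lift_two_le z
  have h3 := Real.pi_lt_d2
  have h4 : (lift z 2) ^ 2 ≤ 3.15 ^ 2 := by
    rw [← sq_abs]
    exact pow_le_pow_left₀ (abs_nonneg _) (by linarith) 2
  nlinarith [norm_nonneg z.1, norm_nonneg (lift z)]

/-- The decay of the far-field integrand. -/
def farWeight (x₀ y : Dom) : ℝ := (1 + ‖(y - x₀).1‖) ^ (-(5 / 2) : ℝ)

theorem farWeight_nonneg (x₀ y : Dom) : 0 ≤ farWeight x₀ y := by unfold farWeight; positivity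

/-- The gap between the radii 3/2 and 2 keeps x - y and x₀ - y horizontally away from the pole, at a
distance comparable to that of y from x₀. The displacement |x - x₀| is bounded and goes into the
constant. -/
theorem exists_abs_perQuad_sub_le : ∃ C : ℝ, 0 ≤ C ∧ ∀ (x₀ x y : Dom) (w : E3),
    x ∈ cyl x₀ (3 / 2) → y ∉ cyl x₀ 2 →
    |perQuad (x - y) w - perQuad (x₀ - y) w| ≤ C * (farWeight x₀ y * ‖w‖ ^ 2) := by
  obtain ⟨C, hC, h⟩ := exists_perK_sub_far_le
  set c := C * 5 * (8 : ℝ) ^ (5 / 2 : ℝ)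
  refine ⟨9 * c, by positivity, fun x₀ x y w hx hy => ?_⟩
  have hx' : ‖(x - x₀).1‖ < 3 / 2 := hx
  have hy' : 2 ≤ ‖(y - x₀).1‖ := not_lt.1 hy
  set ξ := lift (x - x₀)
  set η := lift (y - x₀)
  set R := ‖(y - x₀).1‖ with hR
  have ea : x - y = proj (ξ - η) := by
    rw [proj_sub, proj_lift, proj_lift]; abel
  have eb : x₀ - y = proj (-η) := by
    rw [proj_neg, proj_lift]; abel
  have hD : ∀ i j, |perD i j (x - y) - perD i j (x₀ - y)| ≤ c * farWeight x₀ y := by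
    intro i j
    rw [ea, eb, perD_proj, perD_proj]
    -- For R ≥ 2 one has R - 3/2 ≥ R/4 ≥ 1/2, so ρ = R/4 is admissible for both arguments. The
    -- height of ξ - η, a difference of two lifts, can reach 2π.
    refine (h i j (ξ - η) (-η) (R / 4) (by linarith) ?_ ?_ ?_ ?_).trans ?_
    · have h1 : (proj (ξ - η)).1 = (x - x₀).1 - (y - x₀).1 := by
        rw [proj_sub, proj_lift, proj_lift]; rfl
      rw [h1, norm_sub_rev]
      have := norm_sub_norm_le (y - x₀).1 (x - x₀).1
      linarith
    · have h1 : (proj (-η)).1 = -(y - x₀).1 := by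
        rw [proj_neg, proj_lift]; rfl
      rw [h1, norm_neg]
      linarith
    · rw [PiLp.neg_apply, abs_neg]
      exact abs_lift_two_le _
    · rw [PiLp.sub_apply]
      have h1 := abs_lift_two_le (x - x₀)
      have h2 := abs_lift_two_le (y - x₀)
      exact (abs_sub _ _).trans (by linarith)
    · have e : ξ - η - -η = ξ := by abel
      rw [e]
      have h5 : ((R / 4) ^ (5 / 2 : ℝ))⁻¹ ≤ (8 : ℝ) ^ (5 / 2 : ℝ) * farWeight x₀ y := by
        have h6 : (1 + R) / 8 ≤ R / 4 := by linarith
        calc ((R / 4) ^ (5 / 2 : ℝ))⁻¹ ≤ (((1 + R) / 8) ^ (5 / 2 : ℝ))⁻¹ := by gcongr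
          _ = _ := by
            rw [farWeight, Real.rpow_neg (by positivity), Real.div_rpow (by positivity) (by norm_num)]
            rw [inv_div]; rfl
      calc C * ‖ξ‖ * ((R / 4) ^ (5 / 2 : ℝ))⁻¹ ≤ C * 5 * ((8 : ℝ) ^ (5 / 2 : ℝ) * farWeight x₀ y) := by
            gcongr
            exact norm_lift_le hx'
        _ = _ := by ring
  have e : perQuad (x - y) w - perQuad (x₀ - y) w =
      ∑ i : Fin 3, ∑ j : Fin 3, (perD i j (x - y) - perD i j (x₀ - y)) * (w i * w j) := by
    simp only [perQuad, sub_mul, Finset.sum_sub_distrib]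
  rw [e]
  have hW := farWeight_nonneg x₀ y
  calc _ ≤ ∑ i : Fin 3, ∑ j : Fin 3, c * farWeight x₀ y * (‖w‖ * ‖w‖) := by
        refine (Finset.abs_sum_le_sum_abs _ _).trans (Finset.sum_le_sum fun i _ => ?_)
        refine (Finset.abs_sum_le_sum_abs _ _).trans (Finset.sum_le_sum fun j _ => ?_)
        rw [abs_mul, abs_mul]
        gcongr
        · exact hD i j
        · exact abs_coord_le w i
        · exact abs_coord_le w j
    _ = _ := by
        simp only [Finset.sum_const, Finset.card_univ, Fintype.card_fin, nsmul_eq_mul]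
        push_cast; ring

theorem lintegral_farWeight_lt_top : ∫⁻ y, ENNReal.ofReal (farWeight 0 y) < ⊤ := by
  have h1 : Integrable (fun x : E2 => (1 + ‖x‖) ^ (-(5 / 2) : ℝ)) :=
    integrable_one_add_norm (by simp; norm_num)
  have h2 := h1.comp_fst (volume : Measure (AddCircle (2 * Real.pi)))
  have h3 : Integrable (farWeight 0) := by
    refine h2.congr (Eventually.of_forall fun y => ?_)
    simp [farWeight]
  exact h3.lintegral_lt_top

theorem measurable_farWeight (x₀ : Dom) : Measurable (farWeight x₀) := by
  unfold farWeight; fun_prop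

/-- The weight varies by a factor of at most 2^(5/2) on a unit ball, so it can be moved from y to
the centre z. Translation invariance makes the constant independent of x₀. -/
theorem exists_lintegral_farWeight_le : ∃ C : ℝ≥0, ∀ (x₀ : Dom) (v : Dom → E3), AEStronglyMeasurable v →
    ∫⁻ y, ENNReal.ofReal (farWeight x₀ y) * ‖v y‖ₑ ^ (2 : ℝ) ≤ C * ulocNorm v 2 ^ 2 := by
  have h0 := volume_unit_ball_ne_zero
  have h1 := volume_unit_ball_lt_top.ne
  set c : ℝ := (2 : ℝ) ^ (5 / 2 : ℝ)
  set I := ENNReal.ofReal c * ∫⁻ y, ENNReal.ofReal (farWeight 0 y)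
  have hI : I ≠ ⊤ := (ENNReal.mul_lt_top ENNReal.ofReal_lt_top lintegral_farWeight_lt_top).ne
  refine ⟨(I / volume (ball 0 1)).toNNReal, fun x₀ v hv => ?_⟩
  rw [ENNReal.coe_toNNReal (ENNReal.div_ne_top hI h0)]
  have h := lintegral_mul_le_uloc (w := fun y => ENNReal.ofReal (farWeight x₀ y))
    (w' := fun y => ENNReal.ofReal c * ENNReal.ofReal (farWeight x₀ y))
    (F := fun y => ‖v y‖ₑ ^ (2 : ℝ)) (measurable_farWeight x₀).ennreal_ofReal
    ((measurable_farWeight x₀).ennreal_ofReal.const_mul _) (hv.enorm.pow_const _)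
    fun y z hy => by
      rw [← ENNReal.ofReal_mul (by positivity)]
      refine ENNReal.ofReal_le_ofReal ?_
      have h4 := norm_fst_sub_lt_of_mem_ball hy
      have h6 : (z - x₀).1 = (y - x₀).1 - (y.1 - z.1) := by
        simp only [Prod.fst_sub]; abel
      have h7 : (1 + ‖(z - x₀).1‖) / 2 ≤ 1 + ‖(y - x₀).1‖ := by
        have : ‖(z - x₀).1‖ ≤ ‖(y - x₀).1‖ + 1 := by
          rw [h6]
          exact (norm_sub_le _ _).trans (by linarith)
        linarith [norm_nonneg (y - x₀).1]
      calc farWeight x₀ y ≤ ((1 + ‖(z - x₀).1‖) / 2) ^ (-(5 / 2) : ℝ) :=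
            Real.rpow_le_rpow_of_nonpos (by positivity) h7 (by norm_num)
        _ = _ := by
            rw [farWeight, Real.div_rpow (by positivity) (by norm_num), div_eq_mul_inv,
              Real.rpow_neg (by norm_num : (0 : ℝ) ≤ 2), inv_inv, mul_comm]
  have e1 : ∫⁻ z, ENNReal.ofReal c * ENNReal.ofReal (farWeight x₀ z) = I := by
    rw [lintegral_const_mul _ (measurable_farWeight x₀).ennreal_ofReal]
    have := lintegral_sub_right_eq_self (μ := (volume : Measure Dom))
      (fun z => ENNReal.ofReal (farWeight 0 z)) x₀
    simp only [farWeight, sub_zero] at this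
    simp only [I, farWeight, sub_zero]
    rw [← this]
  rw [e1, ← ENNReal.le_div_iff_mul_le (Or.inl h0) (Or.inl h1)] at h
  refine h.trans ?_
  rw [ENNReal.mul_div_right_comm]
  refine mul_le_mul_right ?_ _
  have := lintegral_rpow_ball_le v (r := 2) (by norm_num)
  simpa using this

theorem measurable_perQuad : Measurable fun q : Dom × E3 => perQuad q.1 q.2 := by
  unfold perQuad
  refine Finset.measurable_fun_sum _ fun i _ => Finset.measurable_fun_sum _ fun j _ => ?_
  exact ((measurable_perD i j).comp measurable_fst).mul (by fun_prop)

theorem aemeasurable_perQuad (x : Dom) {v : Dom → E3} (hv : AEStronglyMeasurable v) :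
    AEMeasurable fun y => perQuad (x - y) (v y) := by
  have h1 : AEMeasurable fun y => (x - y, v y) := (measurable_id.const_sub x).aemeasurable.prodMk hv.aemeasurable
  have h2 := measurable_perQuad.comp_aemeasurable h1
  exact h2

theorem ae_farIntegrand_eq (x₀ : Dom) (v : Dom → E3) (x : Dom) : ∀ᵐ y,
    farIntegrand x₀ v x y = perQuad (x - y) (v y) - perQuad (x₀ - y) (v y) := by
  filter_upwards [ae_kerQuad_eq x, ae_kerQuad_eq x₀] with y h1 h2
  rw [farIntegrand, h1, h2]

theorem aestronglyMeasurable_farIntegrand (x₀ : Dom) {v : Dom → E3} (hv : AEStronglyMeasurable v)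
    (x : Dom) : AEStronglyMeasurable (farIntegrand x₀ v x) :=
  (((aemeasurable_perQuad x hv).sub (aemeasurable_perQuad x₀ hv)).aestronglyMeasurable).congr
    ((ae_farIntegrand_eq x₀ v x).mono fun _ h => h.symm)

theorem exists_lintegral_farIntegrand_le : ∃ B : ℝ≥0, ∀ (x₀ : Dom) (v : Dom → E3),
    AEStronglyMeasurable v → ∀ x ∈ cyl x₀ (3 / 2),
      ∫⁻ y in (cyl x₀ 2)ᶜ, ‖farIntegrand x₀ v x y‖ₑ ≤ B * ulocNorm v 2 ^ 2 := by
  obtain ⟨C, hC, h⟩ := exists_abs_perQuad_sub_le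
  obtain ⟨D, hD⟩ := exists_lintegral_farWeight_le
  refine ⟨C.toNNReal * D, fun x₀ v hv x hx => ?_⟩
  calc ∫⁻ y in (cyl x₀ 2)ᶜ, ‖farIntegrand x₀ v x y‖ₑ
      ≤ ∫⁻ y in (cyl x₀ 2)ᶜ, ENNReal.ofReal C * (ENNReal.ofReal (farWeight x₀ y) * ‖v y‖ₑ ^ (2 : ℝ)) := by
        refine lintegral_mono_ae ?_
        filter_upwards [ae_restrict_of_ae (ae_farIntegrand_eq x₀ v x),
          ae_restrict_mem (measurableSet_cyl x₀ 2).compl] with y h1 h2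
        have h3 := h x₀ x y (v y) hx h2
        have h4 := farWeight_nonneg x₀ y
        rw [h1, ← ofReal_norm, Real.norm_eq_abs]
        refine (ENNReal.ofReal_le_ofReal h3).trans (le_of_eq ?_)
        rw [ENNReal.ofReal_mul hC, ENNReal.ofReal_mul h4, ENNReal.ofReal_pow (norm_nonneg _), ofReal_norm]
        simp
    _ ≤ ∫⁻ y, ENNReal.ofReal C * (ENNReal.ofReal (farWeight x₀ y) * ‖v y‖ₑ ^ (2 : ℝ)) :=
        setLIntegral_le_lintegral _ _
    _ = ENNReal.ofReal C * ∫⁻ y, ENNReal.ofReal (farWeight x₀ y) * ‖v y‖ₑ ^ (2 : ℝ) :=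
        lintegral_const_mul' _ _ ENNReal.ofReal_ne_top
    _ ≤ ENNReal.ofReal C * (D * ulocNorm v 2 ^ 2) := mul_le_mul_right (hD x₀ v hv) _
    _ = _ := by
        rw [ENNReal.coe_mul, mul_assoc]; rfl

theorem stronglyMeasurable_pFar (x₀ : Dom) {v : Dom → E3} (hv : AEStronglyMeasurable v) :
    StronglyMeasurable (pFar x₀ v) := by
  have hm : Measurable (Function.uncurry fun x y : Dom =>
      perQuad (x - y) (hv.mk v y) - perQuad (x₀ - y) (hv.mk v y)) := by
    have h1 : Measurable fun q : Dom × Dom => hv.mk v q.2 :=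
      hv.stronglyMeasurable_mk.measurable.comp measurable_snd
    have h2 : Measurable fun q : Dom × Dom => q.1 - q.2 := measurable_fst.sub measurable_snd
    have h3 : Measurable fun q : Dom × Dom => x₀ - q.2 := measurable_snd.const_sub x₀
    have h4 := measurable_perQuad.comp (h2.prodMk h1)
    have h5 := measurable_perQuad.comp (h3.prodMk h1)
    exact h4.sub h5
  have h := hm.stronglyMeasurable.integral_prod_right (ν := volume.restrict (cyl x₀ 2)ᶜ)
  convert h using 1
  funext x
  refine integral_congr_ae (ae_restrict_of_ae ?_)
  filter_upwards [ae_farIntegrand_eq x₀ v x, hv.ae_eq_mk] with y h1 h2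
  rw [h1, h2]

end

end NSCyl

namespace NSCyl

noncomputable section

/-! ### Lifting integrals to `ℝ³` -/

/-- The slab of points of height in `(a, b]`. -/
def slab (a b : ℝ) : Set E3 := {w | w 2 ∈ Ioc a b}

theorem measurableSet_slab (a b : ℝ) : MeasurableSet (slab a b) :=
  (by fun_prop : Measurable fun w : E3 => w 2) measurableSet_Ioc

theorem measurePreserving_horizontal_vertical :
    MeasurePreserving (fun w : E3 => ((!₂[w 0, w 1] : E2), w 2)) volume
      ((volume : Measure E2).prod (volume : Measure ℝ)) := by
  have h1 := PiLp.volume_preserving_ofLp (Fin 3)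
  have h2 := volume_preserving_piFinSuccAbove (fun _ : Fin 3 => ℝ) 2
  have h3 : MeasurePreserving (Prod.swap : ℝ × (Fin 2 → ℝ) → (Fin 2 → ℝ) × ℝ)
    (volume.prod volume) (volume.prod volume) := Measure.measurePreserving_swap
  have h4 : MeasurePreserving (Prod.map (WithLp.toLp 2 : (Fin 2 → ℝ) → E2) (id : ℝ → ℝ))
      (volume.prod volume) (volume.prod volume) :=
    (PiLp.volume_preserving_toLp (Fin 2)).prod (MeasurePreserving.id volume)
  have h := h4.comp (h3.comp (h2.comp h1))
  have e : (fun w : E3 => ((!₂[w 0, w 1] : E2), w 2)) = Prod.map (WithLp.toLp 2) id ∘ Prod.swap ∘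
      MeasurableEquiv.piFinSuccAbove (fun _ : Fin 3 => ℝ) 2 ∘ WithLp.ofLp := by
    funext w
    refine Prod.ext ?_ rfl
    ext i
    fin_cases i <;> rfl
  rw [e]
  exact h

/-- The base height a is arbitrary; later the period is centred at the height of the evaluation
point. -/
theorem measurePreserving_proj (a : ℝ) :
    MeasurePreserving proj (volume.restrict (slab a (a + 2 * Real.pi))) volume := by
  have h1 := measurePreserving_horizontal_vertical.restrict_preimage
    (s := univ ×ˢ Ioc a (a + 2 * Real.pi)) (MeasurableSet.univ.prod measurableSet_Ioc)
  rw [← Measure.prod_restrict, Measure.restrict_univ] at h1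
  have h2 := ((MeasurePreserving.id (volume : Measure E2)).prod
    (AddCircle.measurePreserving_mk (2 * Real.pi) a)).comp h1
  have e : slab a (a + 2 * Real.pi) =
      (fun w : E3 => ((!₂[w 0, w 1] : E2), w 2)) ⁻¹' univ ×ˢ Ioc a (a + 2 * Real.pi) := by
    ext w
    simp [slab]
  rw [e]
  exact h2

theorem measurePreserving_add_proj (x₀ : Dom) (a : ℝ) :
    MeasurePreserving (fun w => x₀ + proj w) (volume.restrict (slab a (a + 2 * Real.pi))) volume :=
  (measurePreserving_add_left volume x₀).comp (measurePreserving_proj a)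

theorem measurable_proj : Measurable proj := (measurePreserving_proj 0).measurable

theorem integral_slab (x₀ : Dom) (a : ℝ) {F : Dom → ℝ} (hF : AEStronglyMeasurable F) :
    ∫ w in slab a (a + 2 * Real.pi), F (x₀ + proj w) = ∫ y, F y := by
  have h := measurePreserving_add_proj x₀ a
  rw [← h.map_eq] at hF
  conv_rhs => rw [← h.map_eq]
  rw [integral_map h.aemeasurable hF]

theorem lintegral_slab (x₀ : Dom) (a : ℝ) {F : Dom → ℝ≥0∞} (hF : Measurable F) :
    ∫⁻ w in slab a (a + 2 * Real.pi), F (x₀ + proj w) = ∫⁻ y, F y :=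
  (measurePreserving_add_proj x₀ a).lintegral_comp hF

theorem len_proj {u : E3} (hu : |u 2| ≤ Real.pi) : len (proj u) = ‖u‖ := by
  have h1 : ‖((u 2 : ℝ) : AddCircle (2 * Real.pi))‖ = |u 2| := by
    refine (AddCircle.norm_coe_eq_abs_iff _ Real.two_pi_pos.ne').2 ?_
    rw [abs_of_pos Real.two_pi_pos]
    linarith
  rw [len, ← Real.sqrt_sq (norm_nonneg u), norm_sq_eq_horizontal]
  congr 2
  simp only [proj, h1, sq_abs]

/-- The lift to `ℝ² × (-2π, 2π]` of the restriction of a function to the cylinder of radius `2`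
about `x₀`. -/
def liftFun (x₀ : Dom) (f : Dom → ℝ) : E3 → ℝ :=
  (slab (-(2 * Real.pi)) (2 * Real.pi)).indicator fun w => (cyl x₀ 2).indicator f (x₀ + proj w)

theorem measurable_liftFun (x₀ : Dom) {f : Dom → ℝ} (hf : Measurable f) : Measurable (liftFun x₀ f) :=
  ((hf.indicator (measurableSet_cyl x₀ 2)).comp (measurable_const.add measurable_proj)).indicator
    (measurableSet_slab _ _)

theorem norm_le_of_liftFun_ne_zero (x₀ : Dom) (f : Dom → ℝ) (w : E3) (h : liftFun x₀ f w ≠ 0) :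
    ‖w‖ ≤ 7 := by
  have h1 := mem_of_indicator_ne_zero h
  have h2 : x₀ + proj w ∈ cyl x₀ 2 := by
    rw [liftFun, indicator_of_mem h1] at h
    exact mem_of_indicator_ne_zero h
  have h3 : ‖(proj w).1‖ < 2 := by simpa [cyl] using h2
  have h4 := norm_sq_eq_horizontal w
  have h5 := Real.pi_lt_d2
  have h6 : |w 2| ≤ 2 * 3.15 := abs_le.2 ⟨by linarith [h1.1], by linarith [h1.2]⟩
  have h7 : (w 2) ^ 2 ≤ (2 * 3.15) ^ 2 := by
    rw [← sq_abs]
    exact pow_le_pow_left₀ (abs_nonneg _) h6 2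
  nlinarith [norm_nonneg (proj w).1, norm_nonneg w]

/-- The lift covers two periods, whence the factor 2. Two are needed so that the window of height 2π
centred at any point of height in (-π, π] is contained in its domain. -/
theorem lintegral_liftFun (x₀ : Dom) {f : Dom → ℝ} (hf : Measurable f) {q : ℝ} (hq : 0 < q) :
    ∫⁻ w, ‖liftFun x₀ f w‖ₑ ^ q = 2 * ∫⁻ y in cyl x₀ 2, ‖f y‖ₑ ^ q := by
  have hpi := Real.pi_pos
  set H : Dom → ℝ≥0∞ := (cyl x₀ 2).indicator fun y => ‖f y‖ₑ ^ q
  have hH : Measurable H := (hf.enorm.pow_const q).indicator (measurableSet_cyl x₀ 2)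
  have e1 : ∀ w, ‖liftFun x₀ f w‖ₑ ^ q =
      (slab (-(2 * Real.pi)) (2 * Real.pi)).indicator (fun w => H (x₀ + proj w)) w := by
    intro w
    by_cases h1 : w ∈ slab (-(2 * Real.pi)) (2 * Real.pi)
    · by_cases h2 : x₀ + proj w ∈ cyl x₀ 2
      · simp only [liftFun, H, indicator_of_mem h1, indicator_of_mem h2]
      · simp [liftFun, H, indicator_of_mem h1, indicator_of_notMem h2, hq]
    · simp [liftFun, indicator_of_notMem h1, hq]
  have e2 : slab (-(2 * Real.pi)) (2 * Real.pi) =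
      slab (-(2 * Real.pi)) (-(2 * Real.pi) + 2 * Real.pi) ∪ slab 0 (0 + 2 * Real.pi) := by
    ext w
    have := Ioc_union_Ioc_eq_Ioc (a := -(2 * Real.pi)) (b := 0) (c := 2 * Real.pi) (by linarith)
      (by linarith)
    rw [neg_add_cancel, zero_add]
    change w 2 ∈ Ioc (-(2 * Real.pi)) (2 * Real.pi) ↔ w 2 ∈ Ioc (-(2 * Real.pi)) 0 ∪ Ioc 0 (2 * Real.pi)
    rw [this]
  have hd : Disjoint (slab (-(2 * Real.pi)) (-(2 * Real.pi) + 2 * Real.pi)) (slab 0 (0 + 2 * Real.pi)) := by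
    refine disjoint_left.2 fun w h1 h2 => ?_
    have h3 := h1.2
    have h4 := h2.1
    linarith
  simp_rw [e1]
  rw [lintegral_indicator (measurableSet_slab _ _), e2, lintegral_union (measurableSet_slab _ _) hd,
    lintegral_slab x₀ _ hH, lintegral_slab x₀ _ hH, lintegral_indicator (measurableSet_cyl x₀ 2)]
  exact (two_mul _).symm

/-! ### The truncated periodized kernel -/

/-- The truncated periodized kernel, restricted to one period. -/
def perT (ε : ℝ) (i j : Fin 3) (u : E3) : ℝ :=
  if u 2 ∈ Ico (-Real.pi) Real.pi ∧ ε ≤ ‖u‖ then perK i j u else 0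

theorem measurable_perT (ε : ℝ) (i j : Fin 3) : Measurable (perT ε i j) := by
  have h : Measurable (perK i j) := by
    have e : perK i j = perD i j ∘ proj := funext fun u => (perD_proj i j u).symm
    rw [e]
    exact (measurable_perD i j).comp measurable_proj
  refine Measurable.ite (MeasurableSet.inter ?_ (measurableSet_le measurable_const measurable_norm)) h
    measurable_const
  exact (by fun_prop : Measurable fun w : E3 => w 2) measurableSet_Ico

/-- Within the period the difference consists of the images k ≠ 0; outside it |u| ≥ 1 and the Riesz
kernel itself is bounded. The bound is uniform in ε because both kernels are truncated at the same
radius. -/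
theorem exists_abs_perT_sub_le : ∃ C : ℝ, 0 ≤ C ∧ ∀ (ε : ℝ) (i j : Fin 3) (u : E3),
    |perT ε i j u - rieszT ε i j u| ≤ C := by
  obtain ⟨C, hC, h⟩ := exists_perK_sub_le
  have hpi := Real.pi_gt_three
  refine ⟨C + 1, by linarith, fun ε i j u => ?_⟩
  by_cases h1 : ε ≤ ‖u‖
  · by_cases h2 : u 2 ∈ Ico (-Real.pi) Real.pi
    · have := h i j u (abs_le.2 ⟨h2.1, h2.2.le⟩)
      simp only [perT, rieszT, h1, h2, and_self, if_true]
      linarith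
    · have h3 : 1 ≤ ‖u‖ := by
        refine le_trans ?_ (abs_coord_le u 2)
        by_contra h4
        have h5 := abs_lt.1 (not_le.1 h4)
        exact h2 ⟨by linarith, by linarith⟩
      simp only [perT, rieszT, h1, h2, false_and, if_false, if_true, zero_sub, abs_neg]
      refine (abs_rieszK_le i j u).trans ?_
      have : 1 / ‖u‖ ^ 3 ≤ 1 := by
        rw [div_le_one (by positivity)]
        exact one_le_pow₀ h3
      linarith
  · simp only [perT, rieszT, h1, and_false, if_false, sub_zero, abs_zero]
    linarith

theorem exists_abs_perT_le {ε : ℝ} (hε : 0 < ε) : ∃ C : ℝ, ∀ (i j : Fin 3) (u : E3), |perT ε i j u| ≤ C := by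
  obtain ⟨C, hC, h⟩ := exists_abs_perT_sub_le
  refine ⟨C + 1 / ε ^ 3, fun i j u => ?_⟩
  have h1 := h ε i j u
  have h2 := abs_rieszT_le hε i j u
  have h3 := abs_sub_abs_le_abs_sub (perT ε i j u) (rieszT ε i j u)
  linarith

/-- A bounded perturbation of the kernel costs only its bound times the volume of the ball, by
Schur's test with a constant kernel. -/
theorem exists_eLpNorm_perT_le {q : ℝ} (hq : 1 < q) : ∃ A : ℝ≥0, ∀ ε : ℝ, 0 < ε → ε ≤ 1 →
    ∀ (i j : Fin 3) (f : E3 → ℝ), Integrable f → (∀ y, f y ≠ 0 → ‖y‖ ≤ 7) →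
    MemLp f (ENNReal.ofReal q) →
    eLpNorm (cv (perT ε i j) f) (ENNReal.ofReal q) (volume.restrict (Metric.closedBall 0 7)) ≤
      A * eLpNorm f (ENNReal.ofReal q) := by
  obtain ⟨A, hA⟩ := exists_eLpNorm_rieszT_le hq 7
  obtain ⟨C, hC, hC'⟩ := exists_abs_perT_sub_le
  set S := Metric.closedBall (0 : E3) 7
  have hS : volume S < ⊤ := Metric.isBounded_closedBall.measure_lt_top
  refine ⟨A + C.toNNReal * (volume S).toNNReal, fun ε hε hε1 i j f hf hfs hfq => ?_⟩
  obtain ⟨D, hD⟩ := exists_abs_perT_le hε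
  have hk : Measurable fun u => perT ε i j u - rieszT ε i j u :=
    (measurable_perT ε i j).sub (measurable_rieszT ε i j)
  have e : cv (perT ε i j) f = cv (rieszT ε i j) f + cv (fun u => perT ε i j u - rieszT ε i j u) f := by
    funext x
    have h1 := integrable_cv (measurable_rieszT ε i j) (fun z => abs_rieszT_le hε i j z) hf x
    have h2 := integrable_cv hk (hC' ε i j) hf x
    simp only [cv, Pi.add_apply]
    rw [← integral_add h1 h2]
    refine integral_congr_ae (Eventually.of_forall fun y => ?_)
    simp only
    ring
  have hq1 : 1 ≤ ENNReal.ofReal q := by simpa using hq.le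
  rw [e]
  refine (eLpNorm_add_le (measurable_cv (measurable_rieszT ε i j) hf).aestronglyMeasurable
    (measurable_cv hk hf).aestronglyMeasurable hq1).trans ?_
  have h2 : eLpNorm (cv (fun u => perT ε i j u - rieszT ε i j u) f) (ENNReal.ofReal q) (volume.restrict S) ≤
      (ENNReal.ofReal C * volume S) * eLpNorm f (ENNReal.ofReal q) (volume.restrict S) := by
    refine eLpNorm_le_of_schur (k := fun _ _ => ENNReal.ofReal C) measurable_const
      hf.aestronglyMeasurable.restrict (fun x => by simp) (fun x => by simp) hq fun x => ?_
    rw [cv]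
    refine (enorm_integral_le_lintegral_enorm _).trans ?_
    rw [← lintegral_indicator Metric.isClosed_closedBall.measurableSet]
    refine lintegral_mono fun y => ?_
    by_cases hy : f y = 0
    · simp [hy]
    · have : y ∈ S := by simpa [S] using hfs y hy
      rw [indicator_of_mem this, enorm_mul]
      refine mul_le_mul_left ?_ _
      rw [← ofReal_norm, Real.norm_eq_abs]
      exact ENNReal.ofReal_le_ofReal (hC' ε i j _)
  refine (add_le_add (hA ε hε hε1 i j f hf hfs hfq) (h2.trans
    (mul_le_mul_right (eLpNorm_mono_measure _ Measure.restrict_le_self) _))).trans (le_of_eq ?_)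
  rw [ENNReal.coe_add, ENNReal.coe_mul, ENNReal.coe_toNNReal hS.ne, add_mul]
  rfl

end

end NSCyl

namespace NSCyl

noncomputable section

/-! ### The near field -/

/-- The truncated singular integral. -/
def nearTrunc (x₀ : Dom) (v : Dom → E3) (ε : ℝ) (x : Dom) : ℝ :=
  ∫ y in cyl x₀ 2 \ ball x ε, perQuad (x - y) (v y)

/-- The lift of the product `vᵢ vⱼ`. -/
def liftProd (x₀ : Dom) (v : Dom → E3) (i j : Fin 3) : E3 → ℝ := liftFun x₀ fun y => v y i * v y j

theorem stronglyMeasurable_nearTrunc (x₀ : Dom) {v : Dom → E3} (hv : Measurable v) (ε : ℝ) :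
    StronglyMeasurable (nearTrunc x₀ v ε) := by
  have h1 : Measurable fun q : Dom × Dom => v q.2 := hv.comp measurable_snd
  have h2 : Measurable fun q : Dom × Dom => q.1 - q.2 := measurable_fst.sub measurable_snd
  have h3 := measurable_perQuad.comp (h2.prodMk h1)
  have hs : MeasurableSet {q : Dom × Dom | len (q.2 - q.1) < ε} :=
    (isOpen_lt (continuous_len.comp (continuous_snd.sub continuous_fst)) continuous_const).measurableSet
  have hm : Measurable (Function.uncurry fun x y : Dom =>
      {q : Dom × Dom | len (q.2 - q.1) < ε}ᶜ.indicator (fun q => perQuad (q.1 - q.2) (v q.2)) (x, y)) :=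
    Measurable.indicator h3 hs.compl
  have h := hm.stronglyMeasurable.integral_prod_right (ν := volume.restrict (cyl x₀ 2))
  have e : nearTrunc x₀ v ε = fun x => ∫ y in cyl x₀ 2,
      {q : Dom × Dom | len (q.2 - q.1) < ε}ᶜ.indicator (fun q => perQuad (q.1 - q.2) (v q.2)) (x, y) := by
    funext x
    rw [nearTrunc, sdiff_eq, ← setIntegral_indicator (measurableSet_ball x ε).compl]
    rfl
  rw [e]
  exact h

/-- The integral over the domain is lifted to the window of height 2π centred at the height of ξ.
There ξ - w stays in one period, where the flat distance on the domain is the Euclidean norm, and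
the truncated integral becomes a convolution on ℝ³. -/
theorem nearTrunc_eq (x₀ : Dom) {v : Dom → E3} (hv : Measurable v)
    (hInt : ∀ i j, Integrable (liftProd x₀ v i j)) {ε : ℝ} (hε : 0 < ε) {ξ : E3}
    (hξ : ξ ∈ slab (-Real.pi) Real.pi) :
    nearTrunc x₀ v ε (x₀ + proj ξ) =
      ∑ i : Fin 3, ∑ j : Fin 3, cv (perT ε i j) (liftProd x₀ v i j) ξ := by
  obtain ⟨C, hC⟩ := exists_abs_perT_le hε
  set x := x₀ + proj ξ
  set F : Dom → ℝ := (cyl x₀ 2 \ ball x ε).indicator fun y => perQuad (x - y) (v y)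
  have hFm : AEStronglyMeasurable F :=
    ((aemeasurable_perQuad x hv.aestronglyMeasurable).aestronglyMeasurable).indicator
      ((measurableSet_cyl x₀ 2).diff (measurableSet_ball x ε))
  have hper : slab (ξ 2 - Real.pi) (ξ 2 - Real.pi + 2 * Real.pi) = slab (ξ 2 - Real.pi) (ξ 2 + Real.pi) := by
    congr 1; ring
  have hpt : ∀ w, (slab (ξ 2 - Real.pi) (ξ 2 + Real.pi)).indicator (fun w => F (x₀ + proj w)) w =
      ∑ i : Fin 3, ∑ j : Fin 3, perT ε i j (ξ - w) * liftProd x₀ v i j w := by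
    intro w
    by_cases hw : w ∈ slab (ξ 2 - Real.pi) (ξ 2 + Real.pi)
    · rw [indicator_of_mem hw]
      -- The reflection w ↦ ξ - w turns the window open at the bottom into one open at the top,
      -- which is why `perT` uses `Ico`.
      have h1 : (ξ - w) 2 ∈ Ico (-Real.pi) Real.pi :=
        ⟨by rw [PiLp.sub_apply]; linarith [hw.2], by rw [PiLp.sub_apply]; linarith [hw.1]⟩
      have h2 : w ∈ slab (-(2 * Real.pi)) (2 * Real.pi) :=
        ⟨by linarith [hw.1, hξ.1], by linarith [hw.2, hξ.2]⟩
      have h3 : x - (x₀ + proj w) = proj (ξ - w) := by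
        rw [proj_sub]; simp only [x]; abel
      have h4 : x₀ + proj w ∈ ball x ε ↔ ¬ ε ≤ ‖ξ - w‖ := by
        rw [not_le, ← len_proj (abs_le.2 ⟨h1.1, h1.2.le⟩), ← h3, len_sub_comm]
        rfl
      by_cases hc : x₀ + proj w ∈ cyl x₀ 2
      · by_cases hb : ε ≤ ‖ξ - w‖
        · have hm : x₀ + proj w ∈ cyl x₀ 2 \ ball x ε := ⟨hc, fun h => h4.1 h hb⟩
          simp only [F, indicator_of_mem hm, h3, perQuad, perD_proj, perT, h1, hb, and_self, if_true,
            liftProd, liftFun, indicator_of_mem h2, indicator_of_mem hc]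
        · have hm : x₀ + proj w ∉ cyl x₀ 2 \ ball x ε := fun h => h.2 (h4.2 hb)
          simp only [F, indicator_of_notMem hm, perT, hb, and_false, if_false, zero_mul,
            Finset.sum_const_zero]
      · have hm : x₀ + proj w ∉ cyl x₀ 2 \ ball x ε := fun h => hc h.1
        simp only [F, indicator_of_notMem hm, liftProd, liftFun, indicator_of_mem h2,
          indicator_of_notMem hc, mul_zero, Finset.sum_const_zero]
    · rw [indicator_of_notMem hw]
      have h1 : ¬ (ξ - w) 2 ∈ Ico (-Real.pi) Real.pi := fun h => hw
        ⟨by have := h.2; rw [PiLp.sub_apply] at this; linarith,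
          by have := h.1; rw [PiLp.sub_apply] at this; linarith⟩
      simp only [perT, h1, false_and, if_false, zero_mul, Finset.sum_const_zero]
  calc nearTrunc x₀ v ε x = ∫ y, F y :=
        (integral_indicator ((measurableSet_cyl x₀ 2).diff (measurableSet_ball x ε))).symm
    _ = ∫ w in slab (ξ 2 - Real.pi) (ξ 2 + Real.pi), F (x₀ + proj w) := by
        rw [← integral_slab x₀ (ξ 2 - Real.pi) hFm, hper]
    _ = ∫ w, ∑ i : Fin 3, ∑ j : Fin 3, perT ε i j (ξ - w) * liftProd x₀ v i j w := by
        rw [← integral_indicator (measurableSet_slab _ _)]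
        exact integral_congr_ae (Eventually.of_forall hpt)
    _ = _ := by
        have hI : ∀ i j, Integrable fun w => perT ε i j (ξ - w) * liftProd x₀ v i j w := fun i j =>
          integrable_cv (measurable_perT ε i j) (hC i j) (hInt i j) ξ
        rw [integral_finsetSum _ fun i _ => integrable_finsetSum _ fun j _ => hI i j]
        refine Finset.sum_congr rfl fun i _ => ?_
        rw [integral_finsetSum _ fun j _ => hI i j]
        rfl

theorem measurable_mul_coord {v : Dom → E3} (hv : Measurable v) (i j : Fin 3) :
    Measurable fun y => v y i * v y j := by fun_prop

theorem lintegral_liftProd_le (x₀ : Dom) {v : Dom → E3} (hv : Measurable v) (i j : Fin 3) {q : ℝ}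
    (hq : 0 < q) :
    ∫⁻ w, ‖liftProd x₀ v i j w‖ₑ ^ q ≤ 2 * ∫⁻ y in cyl x₀ 2, ‖v y‖ₑ ^ (2 * q) := by
  rw [liftProd, lintegral_liftFun x₀ (measurable_mul_coord hv i j) hq]
  refine mul_le_mul_right (lintegral_mono fun y => ?_) _
  have h : ∀ k, ‖v y k‖ₑ ≤ ‖v y‖ₑ := fun k => by
    rw [← ofReal_norm, ← ofReal_norm]
    exact ENNReal.ofReal_le_ofReal (abs_coord_le (v y) k)
  rw [ENNReal.rpow_mul]
  refine ENNReal.rpow_le_rpow ?_ hq.le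
  rw [enorm_mul, ENNReal.rpow_two, sq]
  exact mul_le_mul' (h i) (h j)

theorem exists_eLpNorm_liftProd_le {q : ℝ} (hq : 1 < q) : ∃ C : ℝ≥0, ∀ (x₀ : Dom) (v : Dom → E3)
    (i j : Fin 3), Measurable v →
    eLpNorm (liftProd x₀ v i j) (ENNReal.ofReal q) ≤ C * ulocNorm v (ENNReal.ofReal (2 * q)) ^ 2 := by
  obtain ⟨C, hC⟩ := exists_lintegral_cyl_le
  have hq0 : 0 < q := by linarith
  refine ⟨(2 * C) ^ (1 / q), fun x₀ v i j hv => ?_⟩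
  rw [eLpNorm_eq_lintegral_rpow_enorm_toReal (by simpa using hq0) ENNReal.ofReal_ne_top,
    ENNReal.toReal_ofReal hq0.le]
  have h := (lintegral_liftProd_le x₀ hv i j hq0).trans
    (mul_le_mul_right (hC x₀ v (2 * q) (by linarith) hv.aestronglyMeasurable) 2)
  refine (ENNReal.rpow_le_rpow h (by positivity)).trans (le_of_eq ?_)
  rw [← mul_assoc, ENNReal.mul_rpow_of_nonneg _ _ (by positivity), ← ENNReal.rpow_mul,
    ENNReal.coe_rpow_of_nonneg _ (by positivity)]
  have : 2 * q * (1 / q) = 2 := by field_simp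
  rw [this, ENNReal.rpow_two]
  push_cast
  rfl

theorem measurable_liftProd (x₀ : Dom) {v : Dom → E3} (hv : Measurable v) (i j : Fin 3) :
    Measurable (liftProd x₀ v i j) := measurable_liftFun x₀ (measurable_mul_coord hv i j)

theorem integrable_of_memLp_of_norm_le {q : ℝ} (hq : 1 < q) {f : E3 → ℝ} (hf : MemLp f (ENNReal.ofReal q))
    {R : ℝ} (hs : ∀ y, f y ≠ 0 → ‖y‖ ≤ R) : Integrable f := by
  have h := hf.mono_exponent_of_measure_support_ne_top (s := Metric.closedBall 0 R) (p := 1)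
    (fun y hy => by
      by_contra h0
      exact hy (by simpa using hs y h0)) Metric.isBounded_closedBall.measure_lt_top.ne
    (by simpa using hq.le)
  exact memLp_one_iff_integrable.1 h

/-- The norm over C(x₀, 1) is pulled back to one period of ℝ³, which lies in the ball of radius 7
that also supports the lifted products; the nine convolutions are then bounded separately. -/
theorem exists_eLpNorm_nearTrunc_le {q : ℝ} (hq : 1 < q) : ∃ A : ℝ≥0, ∀ (x₀ : Dom) (v : Dom → E3),
    Measurable v → ulocNorm v (ENNReal.ofReal (2 * q)) < ⊤ → ∀ ε : ℝ, 0 < ε → ε ≤ 1 →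
    eLpNorm (nearTrunc x₀ v ε) (ENNReal.ofReal q) (volume.restrict (cyl x₀ 1)) ≤
      A * ulocNorm v (ENNReal.ofReal (2 * q)) ^ 2 := by
  obtain ⟨C, hC⟩ := exists_eLpNorm_liftProd_le hq
  obtain ⟨A, hA⟩ := exists_eLpNorm_perT_le hq
  have hq1 : 1 ≤ ENNReal.ofReal q := by simpa using hq.le
  refine ⟨9 * (A * C), fun x₀ v hv hU ε hε hε1 => ?_⟩
  set U := ulocNorm v (ENNReal.ofReal (2 * q))
  have hmem : ∀ i j, MemLp (liftProd x₀ v i j) (ENNReal.ofReal q) := fun i j =>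
    ⟨(measurable_liftProd x₀ hv i j).aestronglyMeasurable, (hC x₀ v i j hv).trans_lt
      (ENNReal.mul_lt_top ENNReal.coe_lt_top (ENNReal.pow_lt_top hU))⟩
  have hsupp : ∀ i j w, liftProd x₀ v i j w ≠ 0 → ‖w‖ ≤ 7 := fun i j w h =>
    norm_le_of_liftFun_ne_zero x₀ _ w h
  have hInt : ∀ i j, Integrable (liftProd x₀ v i j) := fun i j =>
    integrable_of_memLp_of_norm_le hq (hmem i j) (hsupp i j)
  set φ : E3 → Dom := fun w => x₀ + proj w
  have hφ : MeasurePreserving φ (volume.restrict (slab (-Real.pi) Real.pi)) volume := by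
    have := measurePreserving_add_proj x₀ (-Real.pi)
    rwa [show -Real.pi + 2 * Real.pi = Real.pi by ring] at this
  have hφ' := hφ.restrict_preimage (measurableSet_cyl x₀ 1)
  set G : E3 → ℝ := ∑ i : Fin 3, ∑ j : Fin 3, cv (perT ε i j) (liftProd x₀ v i j)
  have hms : MeasurableSet (φ ⁻¹' cyl x₀ 1) := hφ.measurable (measurableSet_cyl x₀ 1)
  have hsub : φ ⁻¹' cyl x₀ 1 ∩ slab (-Real.pi) Real.pi ⊆ Metric.closedBall 0 7 := by
    rintro w ⟨h1, h2⟩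
    have h3 : ‖(proj w).1‖ < 1 := by simpa [cyl, φ] using h1
    have h4 := norm_sq_eq_horizontal w
    have h5 := Real.pi_lt_d2
    have h6 : |w 2| ≤ 3.15 := abs_le.2 ⟨by linarith [h2.1], by linarith [h2.2]⟩
    have h7 : (w 2) ^ 2 ≤ 3.15 ^ 2 := by
      rw [← sq_abs]
      exact pow_le_pow_left₀ (abs_nonneg _) h6 2
    rw [mem_closedBall_zero_iff]
    nlinarith [norm_nonneg (proj w).1, norm_nonneg w]
  calc eLpNorm (nearTrunc x₀ v ε) (ENNReal.ofReal q) (volume.restrict (cyl x₀ 1))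
      = eLpNorm (nearTrunc x₀ v ε ∘ φ) (ENNReal.ofReal q)
          ((volume.restrict (slab (-Real.pi) Real.pi)).restrict (φ ⁻¹' cyl x₀ 1)) :=
        (eLpNorm_comp_measurePreserving
          (stronglyMeasurable_nearTrunc x₀ hv ε).aestronglyMeasurable hφ').symm
    _ = eLpNorm G (ENNReal.ofReal q)
          ((volume.restrict (slab (-Real.pi) Real.pi)).restrict (φ ⁻¹' cyl x₀ 1)) := by
        refine eLpNorm_congr_ae (ae_restrict_of_ae ?_)
        filter_upwards [ae_restrict_mem (measurableSet_slab _ _)] with w hw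
        simp only [Function.comp_apply, φ, G, Finset.sum_apply]
        exact nearTrunc_eq x₀ hv hInt hε hw
    _ ≤ eLpNorm G (ENNReal.ofReal q) (volume.restrict (Metric.closedBall 0 7)) := by
        rw [Measure.restrict_restrict hms]
        exact eLpNorm_mono_measure _ (Measure.restrict_mono hsub le_rfl)
    _ ≤ ∑ i : Fin 3, ∑ j : Fin 3, eLpNorm (cv (perT ε i j) (liftProd x₀ v i j)) (ENNReal.ofReal q)
          (volume.restrict (Metric.closedBall 0 7)) := by
        have hmeas : ∀ i j, Measurable (cv (perT ε i j) (liftProd x₀ v i j)) := fun i j =>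
          measurable_cv (measurable_perT ε i j) (hInt i j)
        refine (eLpNorm_sum_le (fun i _ => ?_) hq1).trans (Finset.sum_le_sum fun i _ => ?_)
        · exact Finset.aestronglyMeasurable_sum _ fun j _ => (hmeas i j).aestronglyMeasurable
        · exact eLpNorm_sum_le (fun j _ => (hmeas i j).aestronglyMeasurable) hq1
    _ ≤ ∑ i : Fin 3, ∑ j : Fin 3, A * (C * U ^ 2) :=
        Finset.sum_le_sum fun i _ => Finset.sum_le_sum fun j _ =>
          (hA ε hε hε1 i j _ (hInt i j) (hsupp i j) (hmem i j)).trans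
            (mul_le_mul_right (hC x₀ v i j hv) _)
    _ = _ := by
        simp only [Finset.sum_const, Finset.card_univ, Fintype.card_fin, nsmul_eq_mul]
        push_cast
        ring

/-! ### The principal value -/

theorem pv_eq {f : Dom → ℝ} {S : Set Dom} {x : Dom} {I : ℝ} (h : HasPV f S x I) : pv f S x = I := by
  have hex : ∃ I, HasPV f S x I := ⟨I, h⟩
  rw [pv, dif_pos hex]
  exact tendsto_nhds_unique hex.choose_spec.2 h.2

/-- Realizes the principal value as the limit of a sequence of measurable functions. Passing to a
measurable representative v' and from `kerQuad` to `perQuad` changes the integrands on null sets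
only. -/
theorem tendsto_nearTrunc {x₀ : Dom} {v v' : Dom → E3} (hvv : v =ᵐ[volume] v') {x : Dom}
    (h : ∃ I, HasPV (fun y => kerQuad (x - y) (v y)) (cyl x₀ 2) x I) :
    Tendsto (fun n : ℕ => nearTrunc x₀ v' (1 / ((n : ℝ) + 1)) x) atTop
      (𝓝 (pv (fun y => kerQuad (x - y) (v y)) (cyl x₀ 2) x)) := by
  obtain ⟨I, hI⟩ := h
  rw [pv_eq hI]
  have h1 : Tendsto (fun n : ℕ => 1 / ((n : ℝ) + 1)) atTop (𝓝[>] 0) :=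
    tendsto_nhdsWithin_iff.2 ⟨tendsto_one_div_add_atTop_nhds_zero_nat,
      Eventually.of_forall fun n => by rw [mem_Ioi]; positivity⟩
  refine (hI.2.comp h1).congr fun n => ?_
  refine integral_congr_ae (ae_restrict_of_ae ?_)
  filter_upwards [ae_kerQuad_eq x, hvv] with y h2 h3
  rw [h2, h3]

theorem ulocNorm_congr {v v' : Dom → E3} (h : v =ᵐ[volume] v') (r : ℝ≥0∞) : ulocNorm v r = ulocNorm v' r :=
  iSup_congr fun _ => eLpNorm_congr_ae (ae_restrict_of_ae h)

theorem aestronglyMeasurable_pv {x₀ : Dom} {v : Dom → E3} (hv : AEStronglyMeasurable v) {r : ℝ}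
    (h : ∀ᵐ x ∂volume.restrict (cyl x₀ r), ∃ I, HasPV (fun y => kerQuad (x - y) (v y)) (cyl x₀ 2) x I) :
    AEStronglyMeasurable (fun x => pv (fun y => kerQuad (x - y) (v y)) (cyl x₀ 2) x)
      (volume.restrict (cyl x₀ r)) :=
  aestronglyMeasurable_of_tendsto_ae atTop
    (fun n : ℕ => (stronglyMeasurable_nearTrunc x₀ hv.stronglyMeasurable_mk.measurable
      (1 / ((n : ℝ) + 1))).aestronglyMeasurable)
    (h.mono fun _ hx => tendsto_nearTrunc hv.ae_eq_mk hx)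

theorem aestronglyMeasurable_pNear {x₀ : Dom} {v : Dom → E3} (hv : AEStronglyMeasurable v) {r : ℝ}
    (h : ∀ᵐ x ∂volume.restrict (cyl x₀ r), ∃ I, HasPV (fun y => kerQuad (x - y) (v y)) (cyl x₀ 2) x I) :
    AEStronglyMeasurable (pNear x₀ v) (volume.restrict (cyl x₀ r)) :=
  ((hv.norm.pow 2).const_mul _).restrict.add (aestronglyMeasurable_pv hv h)

theorem cyl_subset_cyl (x₀ : Dom) {r s : ℝ} (h : r ≤ s) : cyl x₀ r ⊆ cyl x₀ s := fun _ hy =>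
  lt_of_lt_of_le hy h

theorem exists_eLpNorm_norm_sq_le {q : ℝ} (hq : 1 < q) : ∃ C : ℝ≥0, ∀ (x₀ : Dom) (v : Dom → E3),
    AEStronglyMeasurable v → eLpNorm (fun x => -(1 / 3) * ‖v x‖ ^ 2) (ENNReal.ofReal q)
      (volume.restrict (cyl x₀ 1)) ≤ C * ulocNorm v (ENNReal.ofReal (2 * q)) ^ 2 := by
  obtain ⟨C, hC⟩ := exists_lintegral_cyl_le
  have hq0 : 0 < q := by linarith
  refine ⟨C ^ (1 / q), fun x₀ v hv => ?_⟩
  rw [eLpNorm_eq_lintegral_rpow_enorm_toReal (by simpa using hq0) ENNReal.ofReal_ne_top,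
    ENNReal.toReal_ofReal hq0.le]
  have h : ∫⁻ x in cyl x₀ 1, ‖-(1 / 3) * ‖v x‖ ^ 2‖ₑ ^ q ≤
      C * ulocNorm v (ENNReal.ofReal (2 * q)) ^ (2 * q) := by
    refine le_trans ?_ (hC x₀ v (2 * q) (by linarith) hv)
    refine (lintegral_mono fun x => ?_).trans
      (lintegral_mono_set (cyl_subset_cyl x₀ (by norm_num : (1 : ℝ) ≤ 2)))
    rw [ENNReal.rpow_mul]
    refine ENNReal.rpow_le_rpow ?_ hq0.le
    rw [ENNReal.rpow_two, ← ofReal_norm, ← ofReal_norm, ← ENNReal.ofReal_pow (norm_nonneg _)]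
    refine ENNReal.ofReal_le_ofReal ?_
    rw [norm_mul, norm_pow, norm_norm]
    have : ‖(-(1 / 3) : ℝ)‖ ≤ 1 := by norm_num
    exact mul_le_of_le_one_left (by positivity) this
  refine (ENNReal.rpow_le_rpow h (by positivity)).trans (le_of_eq ?_)
  rw [ENNReal.mul_rpow_of_nonneg _ _ (by positivity), ← ENNReal.rpow_mul,
    ENNReal.coe_rpow_of_nonneg _ (by positivity)]
  have : 2 * q * (1 / q) = 2 := by field_simp
  rw [this, ENNReal.rpow_two]

/-- Fatou's lemma for the L^q norm along ε = 1/(n + 1): pointwise existence of the principal value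
is assumed, so only the uniform bound on truncations is needed and no maximal function enters. -/
theorem exists_eLpNorm_pNear_le {q : ℝ} (hq : 1 < q) : ∃ A : ℝ≥0, ∀ (x₀ : Dom) (v : Dom → E3),
    AEStronglyMeasurable v →
    (∀ᵐ x ∂volume.restrict (cyl x₀ 1), ∃ I, HasPV (fun y => kerQuad (x - y) (v y)) (cyl x₀ 2) x I) →
    eLpNorm (pNear x₀ v) (ENNReal.ofReal q) (volume.restrict (cyl x₀ 1)) ≤
      A * ulocNorm v (ENNReal.ofReal (2 * q)) ^ 2 := by
  obtain ⟨A, hA⟩ := exists_eLpNorm_nearTrunc_le hq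
  obtain ⟨C, hC⟩ := exists_eLpNorm_norm_sq_le hq
  -- The summand 1 keeps the constant nonzero, so that its product with an infinite norm is `⊤` and
  -- not 0 · `⊤` = 0.
  refine ⟨C + A + 1, fun x₀ v hv h => ?_⟩
  by_cases hU : ulocNorm v (ENNReal.ofReal (2 * q)) < ⊤
  · have hU' : ulocNorm (hv.mk v) (ENNReal.ofReal (2 * q)) < ⊤ := by
      rwa [← ulocNorm_congr hv.ae_eq_mk]
    have hpv : eLpNorm (fun x => pv (fun y => kerQuad (x - y) (v y)) (cyl x₀ 2) x) (ENNReal.ofReal q)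
        (volume.restrict (cyl x₀ 1)) ≤ A * ulocNorm v (ENNReal.ofReal (2 * q)) ^ 2 := by
      refine (Lp.eLpNorm_lim_le_liminf_eLpNorm (fun n : ℕ => (stronglyMeasurable_nearTrunc x₀
        hv.stronglyMeasurable_mk.measurable (1 / ((n : ℝ) + 1))).aestronglyMeasurable) _
        (h.mono fun _ hx => tendsto_nearTrunc hv.ae_eq_mk hx)).trans ?_
      refine liminf_le_of_frequently_le' (Frequently.of_forall fun n => ?_)
      rw [ulocNorm_congr hv.ae_eq_mk]
      refine hA x₀ _ hv.stronglyMeasurable_mk.measurable hU' _ (by positivity) ?_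
      rw [div_le_one (by positivity)]
      linarith [(Nat.cast_nonneg n : (0 : ℝ) ≤ n)]
    have h1 := eLpNorm_add_le (p := ENNReal.ofReal q) (μ := volume.restrict (cyl x₀ 1))
      (((hv.norm.pow 2).const_mul (-(1 / 3) : ℝ)).restrict) (aestronglyMeasurable_pv hv h)
      (by simpa using hq.le)
    refine h1.trans ((add_le_add (hC x₀ v hv) hpv).trans ?_)
    rw [← add_mul]
    refine mul_le_mul_left ?_ _
    push_cast
    exact le_self_add
  · have : ulocNorm v (ENNReal.ofReal (2 * q)) = ⊤ := by simpa using hU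
    rw [this, ENNReal.top_pow (by norm_num), ENNReal.mul_top]
    · exact le_top
    · simp

end

end NSCyl

/-! ### Measurability of time slices and conclusion. -/

namespace NSCyl

noncomputable section

/-- Measurability of a single slice u(t) is extracted from condition 4: testing against the vectors
of the standard basis, cut off to an exhaustion by compact cylinders, gives each coordinate as a
pointwise limit. -/
theorem aestronglyMeasurable_of_integrable_inner {w : Dom → E3}
    (h : ∀ g : Dom → E3, MemLp g 2 volume → HasCompactSupport g → Integrable fun x => inner ℝ (w x) (g x)) :
    AEStronglyMeasurable w := by
  have hcoord : ∀ i, AEStronglyMeasurable fun x => w x i := by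
    intro i
    set K : ℕ → Set Dom := fun n => Metric.closedBall 0 n ×ˢ univ
    have hK : ∀ n, IsCompact (K n) := fun n => (isCompact_closedBall _ _).prod isCompact_univ
    have hInt : ∀ n, Integrable fun x => inner ℝ (w x) ((K n).indicator (fun _ => bv i) x) := fun n =>
      h _ (memLp_indicator_const 2 (hK n).measurableSet _ (Or.inr (hK n).measure_lt_top.ne))
        (HasCompactSupport.of_support_subset_isCompact (hK n) support_indicator_subset)
    refine aestronglyMeasurable_of_tendsto_ae atTop (fun n => (hInt n).aestronglyMeasurable)
      (Eventually.of_forall fun x => ?_)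
    obtain ⟨n, hn⟩ := exists_nat_ge ‖x.1‖
    refine tendsto_const_nhds.congr' ?_
    filter_upwards [eventually_ge_atTop n] with m hm
    have hx : x ∈ K m := by
      refine ⟨?_, mem_univ _⟩
      rw [mem_closedBall_zero_iff]
      exact hn.trans (by exact_mod_cast hm)
    rw [indicator_of_mem hx]
    simp [bv, EuclideanSpace.inner_single_right]
  have h1 : AEMeasurable fun x i => w x i := aemeasurable_pi_lambda _ fun i => (hcoord i).aemeasurable
  have h2 := (WithLp.measurable_toLp 2 (Fin 3 → ℝ)).comp_aemeasurable h1
  exact h2.aestronglyMeasurable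

theorem IsLocalEnergyWeakSolution.aestronglyMeasurable_velocity {T : ℝ} {u₀ : Dom → E3} {u : ℝ → Dom → E3}
    {p : ℝ → Dom → ℝ} (h : IsLocalEnergyWeakSolution T u₀ u p) {t : ℝ} (ht : t ∈ Ioo 0 T) :
    AEStronglyMeasurable (u t) :=
  aestronglyMeasurable_of_integrable_inner fun g hg hg' =>
    (h.weak_continuity g hg hg').1 t ⟨ht.1.le, ht.2⟩

theorem enorm_pFar_le (x₀ : Dom) (v : Dom → E3) (x : Dom) :
    ‖pFar x₀ v x‖ₑ ≤ ∫⁻ y in (cyl x₀ 2)ᶜ, ‖farIntegrand x₀ v x y‖ₑ :=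
  enorm_integral_le_lintegral_enorm _

end

end NSCyl

theorem mainTheorem9 :
    ∃ (A : ℝ → ℝ≥0) (B : ℝ≥0),
      ∀ (T : ℝ) (u₀ : NSCyl.Dom → NSCyl.E3) (u : ℝ → NSCyl.Dom → NSCyl.E3)
        (p : ℝ → NSCyl.Dom → ℝ),
        NSCyl.IsLocalEnergyWeakSolution T u₀ u p →
        ∀ x₀ : NSCyl.Dom,
          (∃ c : ℝ → ℝ, MemLp c (3 / 2) (volume.restrict (Ioo 0 T)) ∧
            NSCyl.PressureFormula T u p x₀ c) ∧
          ∀ᵐ t ∂(volume.restrict (Ioo 0 T)),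
            (∀ x ∈ NSCyl.cyl x₀ (3 / 2),
              IntegrableOn (NSCyl.farIntegrand x₀ (u t) x) (NSCyl.cyl x₀ 2)ᶜ) ∧
            AEStronglyMeasurable (NSCyl.pNear x₀ (u t))
              (volume.restrict (NSCyl.cyl x₀ (3 / 2))) ∧
            AEStronglyMeasurable (NSCyl.pFar x₀ (u t))
              (volume.restrict (NSCyl.cyl x₀ (3 / 2))) ∧
            (∀ q : ℝ, 1 < q →
              eLpNorm (NSCyl.pNear x₀ (u t)) (ENNReal.ofReal q)
                  (volume.restrict (NSCyl.cyl x₀ 1))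
                ≤ A q * NSCyl.ulocNorm (u t) (ENNReal.ofReal (2 * q)) ^ 2) ∧
            eLpNorm (NSCyl.pFar x₀ (u t)) ⊤ (volume.restrict (NSCyl.cyl x₀ 1))
              ≤ B * NSCyl.ulocNorm (u t) 2 ^ 2 := by
  have hA : ∀ q : ℝ, ∃ A : ℝ≥0, 1 < q → ∀ (x₀ : NSCyl.Dom) (v : NSCyl.Dom → NSCyl.E3),
      AEStronglyMeasurable v →
      (∀ᵐ x ∂volume.restrict (NSCyl.cyl x₀ 1),
        ∃ I, NSCyl.HasPV (fun y => NSCyl.kerQuad (x - y) (v y)) (NSCyl.cyl x₀ 2) x I) →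
      eLpNorm (NSCyl.pNear x₀ v) (ENNReal.ofReal q) (volume.restrict (NSCyl.cyl x₀ 1)) ≤
        A * NSCyl.ulocNorm v (ENNReal.ofReal (2 * q)) ^ 2 := fun q => by
    by_cases hq : 1 < q
    · obtain ⟨A, h⟩ := NSCyl.exists_eLpNorm_pNear_le hq
      exact ⟨A, fun _ => h⟩
    · exact ⟨0, fun h => absurd h hq⟩
  choose A hA using hA
  obtain ⟨B, hB⟩ := NSCyl.exists_lintegral_farIntegrand_le
  refine ⟨A, B, fun T u₀ u p hu x₀ => ⟨hu.pressure_formula x₀, ?_⟩⟩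
  obtain ⟨c, -, hc⟩ := hu.pressure_formula x₀
  obtain ⟨M, hM⟩ := hu.velocity_bounded
  -- The exceptional set of times is fixed here, before q, so all exponents are treated at the same
  -- times.
  filter_upwards [hc, hM, ae_restrict_mem measurableSet_Ioo] with t hct hMt ht
  have hm := hu.aestronglyMeasurable_velocity ht
  have hpv := hct.mono fun x hx => hx.1
  refine ⟨fun x hx => ⟨(NSCyl.aestronglyMeasurable_farIntegrand x₀ hm x).restrict, ?_⟩,
    NSCyl.aestronglyMeasurable_pNear hm hpv,
    (NSCyl.stronglyMeasurable_pFar x₀ hm).aestronglyMeasurable, fun q hq => ?_, ?_⟩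
  · exact (hB x₀ (u t) hm x hx).trans_lt (ENNReal.mul_lt_top ENNReal.coe_lt_top
      (ENNReal.pow_lt_top (hMt.trans_lt ENNReal.coe_lt_top)))
  · exact hA q hq x₀ (u t) hm
      (ae_restrict_of_ae_restrict_of_subset (NSCyl.cyl_subset_cyl x₀ (by norm_num)) hpv)
  · rw [eLpNorm_exponent_top]
    refine eLpNormEssSup_le_of_ae_enorm_bound ?_
    filter_upwards [ae_restrict_mem (NSCyl.measurableSet_cyl x₀ 1)] with x hx
    exact (NSCyl.enorm_pFar_le x₀ (u t) x).trans
      (hB x₀ (u t) hm x (NSCyl.cyl_subset_cyl x₀ (by norm_num) hx))
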